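/- Let $M$ be a connected smooth manifold of dimension $n\ge 2$, and let $F=\alpha+\beta$ be a Randers metric on $M$: $\alpha=\sqrt{a_{ij}(x)y^iy^j}$ with $a$ a smooth Riemannian metric, and $\beta=b_i(x)y^i$ a smooth $1$-form with $\|\beta\|_\alpha<1$. Assume that $F$ is not Riemannian, i.e. $\beta\not\equiv 0$. Let $V=V^i\partial_{x^i}$ be a $C^2$ vector field on $M$ and $\kappa:M\to\mathbb R$ a function. For a function $L(x,y)$ on $TM$ put $\mathcal L_{\hat V}L=V^i\,\partial L/\partial x^i+y^j(\partial V^i/\partial x^j)\,\partial L/\partial y^i$ (the derivative along the complete lift $\hat V$ of $V$). With $g_{ij}=\frac12[F^2]_{y^iy^j}$ and $G^i=\frac14 g^{il}\{[F^2]_{x^my^l}y^m-[F^2]_{x^l}\}$, the Ricci curvature of $F$ is $\mathrm{Ric}=R^i{}_i$, where $$R^i{}_k=2\frac{\partial G^i}{\partial x^k}-\frac{\partial^2G^i}{\partial x^j\partial y^k}y^j+2G^j\frac{\partial^2G^i}{\partial y^j\partial y^k}-\frac{\partial G^i}{\partial y^j}\frac{\partial G^j}{\partial y^k},$$ and ${}^{\alpha}\mathrm{Ric}$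 denotes the Ricci curvature of $\alpha$. Let "$;$" be the covariant derivative of the Levi-Civita connection of $a$ and raise and lower indices with $a$. Put $$r_{ij}=\tfrac12(b_{i;j}+b_{j;i}),\quad s_{ij}=\tfrac12(b_{i;j}-b_{j;i}),\quad s_j=b^is_{ij},\quad e_{ij}=r_{ij}+b_is_j+b_js_i,\quad t_{ij}=s_{ik}s^k{}_j,\quad t^i{}_i=a^{ik}t_{ki},$$ and let an index $0$ denote contraction with $y$ (so $s_0=s_iy^i$, $s_{0;0}=s_{i;j}y^iy^j$, $e_{00}=e_{ij}y^iy^j$, $t_{00}=t_{ij}y^iy^j$). Then $(M,F,V)$ is an almost Ricci soliton with soliton scalar $\kappa$, i.e. $$2\,\mathrm{Ric}+\mathcal L_{\hat V}(F^2)=2\kappa F^2\quad\text{on } TM\setminus\{0\},$$ if and only if there are functions $c,\sigma:M\to\mathbb R$, with $\sigma$ smooth, such that $V$ is a conformal vector field of $\alpha$ with conformal factor $c$, i.e. $V_{i;j}+V_{j;i}=4c\,a_{ij}$, and the following identities hold on $TM$, where $\sigma_0=\sigma_{x^i}y^i$: $$e_{00}=2\sigma(\alpha^2-\beta^2),$$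 $${}^{\alpha}\mathrm{Ric}=(\kappa-2c)(\alpha^2+\beta^2)+t^i{}_i\,\alpha^2+2t_{00}-(n-1)\sigma^2(3\alpha^2-\beta^2)+2(n-1)\sigma_0\beta-(n-1)(s_0^2+s_{0;0}),$$ $$3(n-1)\sigma_0=2c\beta-\mathcal L_{\hat V}(\beta).$$ -/

import Mathlib

open scoped Manifold ContDiff Bundle

noncomputable section

namespace RandersSoliton

/-- The coordinate space `ℝⁿ` (with its Euclidean norm), on which the manifolds are modelled. -/
abbrev Coord (n : ℕ) : Type := EuclideanSpace ℝ (Fin n)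

/-! ### Partial derivatives in coordinates -/

/-- The partial derivative `∂f/∂uⁱ` of a function on `ℝⁿ`. -/
def pd {n : ℕ} (i : Fin n) (f : Coord n → ℝ) (u : Coord n) : ℝ :=
  fderiv ℝ f u (EuclideanSpace.single i 1)

/-- `∂L/∂xⁱ` for a function `L(x, y)` in the standard coordinates of the tangent bundle. -/
def dx {n : ℕ} (i : Fin n) (L : Coord n → Coord n → ℝ) : Coord n → Coord n → ℝ :=
  fun u y => pd i (fun w => L w y) u

/-- `∂L/∂yⁱ` for a function `L(x, y)` in the standard coordinates of the tangent bundle. -/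
def dy {n : ℕ} (i : Fin n) (L : Coord n → Coord n → ℝ) : Coord n → Coord n → ℝ :=
  fun u y => pd i (L u) y

/-- `L²` for a function `L(x, y)`. -/
def energy {n : ℕ} (F : Coord n → Coord n → ℝ) : Coord n → Coord n → ℝ :=
  fun u y => F u y ^ 2

/-! ### Finsler geometry in coordinates -/

/-- The fundamental tensor `g_{ij} = ½ [F²]_{yⁱyʲ}`. -/
def fundTensor {n : ℕ} (F : Coord n → Coord n → ℝ) (u y : Coord n) :
    Matrix (Fin n) (Fin n) ℝ :=
  Matrix.of fun i j => (1 / 2) * dy i (dy j (energy F)) u y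

/-- The geodesic coefficients `Gⁱ = ¼ g^{il} ([F²]_{xᵐyˡ} yᵐ - [F²]_{xˡ})`. -/
def geodCoeff {n : ℕ} (F : Coord n → Coord n → ℝ) (i : Fin n) : Coord n → Coord n → ℝ :=
  fun u y => (1 / 4) * ∑ l, (fundTensor F u y)⁻¹ i l *
    ((∑ m, dx m (dy l (energy F)) u y * y m) - dx l (energy F) u y)

/-- The Riemann curvature
`Rⁱₖ = 2 ∂Gⁱ/∂xᵏ - yʲ ∂²Gⁱ/∂xʲ∂yᵏ + 2 Gʲ ∂²Gⁱ/∂yʲ∂yᵏ - (∂Gⁱ/∂yʲ) (∂Gʲ/∂yᵏ)`. -/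
def riemann {n : ℕ} (F : Coord n → Coord n → ℝ) (i k : Fin n) (u y : Coord n) : ℝ :=
  2 * dx k (geodCoeff F i) u y
    - ∑ j, dx j (dy k (geodCoeff F i)) u y * y j
    + 2 * ∑ j, geodCoeff F j u y * dy j (dy k (geodCoeff F i)) u y
    - ∑ j, dy j (geodCoeff F i) u y * dy k (geodCoeff F j) u y

/-- The Ricci curvature `Ric = Rⁱᵢ` of a Finsler metric (in particular of a Riemannian metric
`F = √(a_{ij} yⁱ yʲ)`), a function of `(x, y)`. -/
def ricci {n : ℕ} (F : Coord n → Coord n → ℝ) (u y : Coord n) : ℝ :=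
  ∑ i, riemann F i i u y

/-- The Lie derivative `V̂(L)` of a function `L(x, y)` along the complete lift
`V̂ = Vⁱ ∂/∂xⁱ + yʲ (∂Vⁱ/∂xʲ) ∂/∂yⁱ` of the vector field with components `v`. -/
def lieLift {n : ℕ} (v : Coord n → Fin n → ℝ) (L : Coord n → Coord n → ℝ)
    (u y : Coord n) : ℝ :=
  (∑ i, v u i * dx i L u y)
    + ∑ i, ∑ j, y j * pd j (fun w => v w i) u * dy i L u y

/-! ### Riemannian tensor calculus in coordinates

Here `A = (a_{ij})` is a Riemannian metric and `b = (bᵢ)` a 1-form. -/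

/-- Christoffel symbols `Γᵏᵢⱼ` of the Levi-Civita connection of `A`. -/
def christoffel {n : ℕ} (A : Coord n → Matrix (Fin n) (Fin n) ℝ) (u : Coord n)
    (k i j : Fin n) : ℝ :=
  (1 / 2) * ∑ l, (A u)⁻¹ k l *
    (pd j (fun w => A w l i) u + pd i (fun w => A w l j) u - pd l (fun w => A w i j) u)

/-- The covariant derivative `w_{i;j} = ∂ⱼ wᵢ - Γᵏᵢⱼ wₖ` of a 1-form. -/
def covD {n : ℕ} (A : Coord n → Matrix (Fin n) (Fin n) ℝ) (w : Coord n → Fin n → ℝ)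
    (u : Coord n) (i j : Fin n) : ℝ :=
  pd j (fun z => w z i) u - ∑ k, christoffel A u k i j * w u k

/-- Lowering the index: `vᵢ = a_{ij} vʲ`. -/
def lower {n : ℕ} (A : Coord n → Matrix (Fin n) (Fin n) ℝ) (v : Coord n → Fin n → ℝ)
    (u : Coord n) (i : Fin n) : ℝ :=
  ∑ j, A u i j * v u j

/-- Raising the index: `bⁱ = a^{ij} bⱼ`. -/
def raise {n : ℕ} (A : Coord n → Matrix (Fin n) (Fin n) ℝ) (b : Coord n → Fin n → ℝ)
    (u : Coord n) (i : Fin n) : ℝ :=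
  ∑ j, (A u)⁻¹ i j * b u j

/-- `r_{ij} = ½ (b_{i;j} + b_{j;i})`. -/
def rT {n : ℕ} (A : Coord n → Matrix (Fin n) (Fin n) ℝ) (b : Coord n → Fin n → ℝ)
    (u : Coord n) (i j : Fin n) : ℝ :=
  (1 / 2) * (covD A b u i j + covD A b u j i)

/-- `s_{ij} = ½ (b_{i;j} - b_{j;i})`. -/
def sT {n : ℕ} (A : Coord n → Matrix (Fin n) (Fin n) ℝ) (b : Coord n → Fin n → ℝ)
    (u : Coord n) (i j : Fin n) : ℝ :=
  (1 / 2) * (covD A b u i j - covD A b u j i)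

/-- `sⱼ = bⁱ s_{ij}`. -/
def sV {n : ℕ} (A : Coord n → Matrix (Fin n) (Fin n) ℝ) (b : Coord n → Fin n → ℝ)
    (u : Coord n) (j : Fin n) : ℝ :=
  ∑ i, raise A b u i * sT A b u i j

/-- `e_{ij} = r_{ij} + bᵢ sⱼ + bⱼ sᵢ`. -/
def eT {n : ℕ} (A : Coord n → Matrix (Fin n) (Fin n) ℝ) (b : Coord n → Fin n → ℝ)
    (u : Coord n) (i j : Fin n) : ℝ :=
  rT A b u i j + b u i * sV A b u j + b u j * sV A b u i

/-- `t_{ij} = s_{ik} sᵏⱼ`, where `sᵏⱼ = a^{kl} s_{lj}`. -/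
def tT {n : ℕ} (A : Coord n → Matrix (Fin n) (Fin n) ℝ) (b : Coord n → Fin n → ℝ)
    (u : Coord n) (i j : Fin n) : ℝ :=
  ∑ k, sT A b u i k * ∑ l, (A u)⁻¹ k l * sT A b u l j

/-- The trace `tⁱᵢ = a^{ik} t_{ki}`. -/
def tTrace {n : ℕ} (A : Coord n → Matrix (Fin n) (Fin n) ℝ) (b : Coord n → Fin n → ℝ)
    (u : Coord n) : ℝ :=
  ∑ i, ∑ k, (A u)⁻¹ i k * tT A b u k i

/-- The contraction `w₀ = wᵢ yⁱ`. -/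
def contr {n : ℕ} (w : Fin n → ℝ) (y : Coord n) : ℝ := ∑ i, w i * y i

/-- The contraction `m₀₀ = m_{ij} yⁱ yʲ`. -/
def contr₂ {n : ℕ} (m : Fin n → Fin n → ℝ) (y : Coord n) : ℝ := ∑ i, ∑ j, m i j * y i * y j

/-! ### From the manifold to coordinates -/

section Manifold

variable {n : ℕ} {M : Type*} [TopologicalSpace M] [ChartedSpace (Coord n) M]

/-- The tangent vector `yⁱ ∂/∂xⁱ` at the point with coordinates `u` in the chart `e`. -/
def tangentVec (e : OpenPartialHomeomorph M (Coord n)) (u y : Coord n) :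
    TangentSpace (𝓡 n) (e.symm u) :=
  mfderiv (𝓡 n) (𝓡 n) e.symm u y

/-- The function `(x, y) ↦ F (x, yⁱ ∂/∂xⁱ)` representing in the chart `e` a function `F` on `TM`. -/
def inChart (e : OpenPartialHomeomorph M (Coord n)) (F : ∀ x : M, TangentSpace (𝓡 n) x → ℝ) :
    Coord n → Coord n → ℝ :=
  fun u y => F (e.symm u) (tangentVec e u y)

/-- The components `Vⁱ` of a vector field in the chart `e`. -/
def vecComp (e : OpenPartialHomeomorph M (Coord n)) (V : ∀ x : M, TangentSpace (𝓡 n) x) :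
    Coord n → Fin n → ℝ :=
  fun u i =>
    let w : Coord n := mfderiv (𝓡 n) (𝓡 n) e (e.symm u) (V (e.symm u))
    w i

/-- `(M, F, V)` is an almost Ricci soliton with soliton scalar `κ`:
`2 Ric + ℒ_{V̂}(F²) = 2 κ F²` on `TM ∖ {0}`, in the local coordinates of any smooth chart. -/
def IsAlmostRicciSoliton (F : ∀ x : M, TangentSpace (𝓡 n) x → ℝ)
    (V : ∀ x : M, TangentSpace (𝓡 n) x) (κ : M → ℝ) : Prop :=
  ∀ e ∈ IsManifold.maximalAtlas (𝓡 n) ∞ M, ∀ u ∈ e.target, ∀ y : Coord n, y ≠ 0 →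
    2 * ricci (inChart e F) u y + lieLift (vecComp e V) (energy (inChart e F)) u y
      = 2 * κ (e.symm u) * inChart e F u y ^ 2

variable [IsManifold (𝓡 n) ∞ M]

variable (n M) in
/-- A Riemannian metric `a` and a 1-form `β` (both smooth) with `‖β‖_α < 1` on `M`: the data of
a Randers metric `F = α + β`. The bound on the norm is stated as `|β(y)| < α(y)` for `y ≠ 0`. -/
structure RandersMetric where
  /-- The Riemannian metric `a_{ij}`. -/
  a : Bundle.ContMDiffRiemannianMetric (𝓡 n) ∞ (Coord n) (fun x : M => TangentSpace (𝓡 n) x)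
  /-- The 1-form `β`. -/
  β : ∀ x : M, TangentSpace (𝓡 n) x →L[ℝ] ℝ
  contMDiff_β : ContMDiff (𝓡 n) ((𝓡 n).prod 𝓘(ℝ, Coord n →L[ℝ] ℝ)) ∞
    (fun x => Bundle.TotalSpace.mk' (Coord n →L[ℝ] ℝ)
      (E := fun x : M => TangentSpace (𝓡 n) x →L[ℝ] ℝ) x (β x))
  norm_β_lt_one : ∀ (x : M) (y : TangentSpace (𝓡 n) x), y ≠ 0 → |β x y| < √(a.inner x y y)

/-- `F` is a Riemannian metric: `F(x, y) = √(h_{ij}(x) yⁱ yʲ)` for a smooth metric `h`. -/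
def IsRiemannian (F : ∀ x : M, TangentSpace (𝓡 n) x → ℝ) : Prop :=
  ∃ h : Bundle.ContMDiffRiemannianMetric (𝓡 n) ∞ (Coord n) (fun x : M => TangentSpace (𝓡 n) x),
    ∀ (x : M) (y : TangentSpace (𝓡 n) x), F x y = √(h.inner x y y)

namespace RandersMetric

/-- `α(x, y) = √(a_{ij}(x) yⁱ yʲ)`. -/
def α (R : RandersMetric n M) (x : M) (y : TangentSpace (𝓡 n) x) : ℝ := √(R.a.inner x y y)

/-- The Randers metric `F = α + β`. -/
def F (R : RandersMetric n M) (x : M) (y : TangentSpace (𝓡 n) x) : ℝ := R.α x y + R.β x y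

/-- The components `a_{ij}` in the chart `e`. -/
def aMat (R : RandersMetric n M) (e : OpenPartialHomeomorph M (Coord n)) :
    Coord n → Matrix (Fin n) (Fin n) ℝ :=
  fun u => Matrix.of fun i j => R.a.inner (e.symm u)
    (tangentVec e u (EuclideanSpace.single i 1)) (tangentVec e u (EuclideanSpace.single j 1))

/-- The components `bᵢ` of `β` in the chart `e`. -/
def bVec (R : RandersMetric n M) (e : OpenPartialHomeomorph M (Coord n)) :
    Coord n → Fin n → ℝ :=
  fun u i => R.β (e.symm u) (tangentVec e u (EuclideanSpace.single i 1))

/-- `V` is a conformal vector field of `α` with conformal factor `c`: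
`V_{i;j} + V_{j;i} = 4 c a_{ij}`, where `Vᵢ = a_{ij} Vʲ`. -/
def IsConformal (R : RandersMetric n M) (V : ∀ x : M, TangentSpace (𝓡 n) x) (c : M → ℝ) : Prop :=
  ∀ e ∈ IsManifold.maximalAtlas (𝓡 n) ∞ M, ∀ u ∈ e.target, ∀ i j : Fin n,
    covD (R.aMat e) (lower (R.aMat e) (vecComp e V)) u i j
      + covD (R.aMat e) (lower (R.aMat e) (vecComp e V)) u j i
      = 4 * c (e.symm u) * R.aMat e u i j

/-- `e₀₀ = 2 σ (α² - β²)` on `TM`. -/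
def EEq (R : RandersMetric n M) (σ : M → ℝ) : Prop :=
  ∀ e ∈ IsManifold.maximalAtlas (𝓡 n) ∞ M, ∀ u ∈ e.target, ∀ y : Coord n,
    let α := inChart e R.α u y
    let β := inChart e (fun x v => R.β x v) u y
    contr₂ (eT (R.aMat e) (R.bVec e) u) y = 2 * σ (e.symm u) * (α ^ 2 - β ^ 2)

/-- On `TM`, with `σ₀ = σ_{xⁱ} yⁱ`:
`ᵅRic = (κ - 2c)(α² + β²) + tⁱᵢ α² + 2 t₀₀ - (n-1) σ² (3α² - β²) + 2(n-1) σ₀ β`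
`- (n-1)(s₀² + s_{0;0})`. -/
def RicEq (R : RandersMetric n M) (κ c σ : M → ℝ) : Prop :=
  ∀ e ∈ IsManifold.maximalAtlas (𝓡 n) ∞ M, ∀ u ∈ e.target, ∀ y : Coord n,
    let A := R.aMat e
    let b := R.bVec e
    let p := e.symm u
    let α := inChart e R.α u y
    let β := inChart e (fun x v => R.β x v) u y
    let σ₀ := contr (fun i => pd i (fun w => σ (e.symm w)) u) y
    ricci (inChart e R.α) u y =
      (κ p - 2 * c p) * (α ^ 2 + β ^ 2) + tTrace A b u * α ^ 2 + 2 * contr₂ (tT A b u) y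
        - ((n : ℝ) - 1) * σ p ^ 2 * (3 * α ^ 2 - β ^ 2)
        + 2 * ((n : ℝ) - 1) * σ₀ * β
        - ((n : ℝ) - 1) * (contr (sV A b u) y ^ 2 + contr₂ (covD A (sV A b) u) y)

/-- `3 (n-1) σ₀ = 2 c β - ℒ_{V̂}(β)` on `TM`. -/
def SigmaEq (R : RandersMetric n M) (V : ∀ x : M, TangentSpace (𝓡 n) x) (c σ : M → ℝ) : Prop :=
  ∀ e ∈ IsManifold.maximalAtlas (𝓡 n) ∞ M, ∀ u ∈ e.target, ∀ y : Coord n,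
    let β := inChart e (fun x v => R.β x v)
    let σ₀ := contr (fun i => pd i (fun w => σ (e.symm w)) u) y
    3 * ((n : ℝ) - 1) * σ₀ = 2 * c (e.symm u) * β u y - lieLift (vecComp e V) β u y

end RandersMetric

end Manifold

end RandersSoliton

end

/-!
# Almost Ricci solitons on Randers manifolds

**Local computation.** In a chart, all curvature formulas are identities between functions of `(x, y)`
and their partial derivatives. They are proved in a `FiberCalculus`, a commutative ring with commuting
derivations `∂/∂xⁱ`, `∂/∂yⁱ` and elements `yⁱ`; the smooth functions on `U × W` form such a calculus
(`smoothCalculus`), and `Rep` relates its elements to the coordinate expressions. The spray of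
`F = α + β` is that of `α` plus `α sⁱ₀` plus a projective term `P yⁱ` with `P = e₀₀/(2F) - s₀`
(`FiberRanders.vert_G_Y_energy`); strong convexity (`LocalRanders.det_fundTensor_F_ne_zero`) shows that
the geodesic coefficients of `F` are these ones. The behaviour of the Ricci curvature under a projective
change (`FiberCalculus.ric_projective`) then gives `Ric` in terms of `α` and `β`
(`FiberRanders.ric_G`).

**Where `β ≠ 0`.** Restricted to a line `x m + p` in a tangent space, with `m` the direction of `b♯` and
`p` a unit vector orthogonal to it, the soliton equation times `4αF²` is polynomial in `x` and
`α = √(x² + 1)`. It therefore holds on the complex conic `α² = x² + 1`. At its points with `α = 0` it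
says that `α²` divides `V_{0;0}`, so that `V` is conformal, and at its points with `F = 0` that
`α² - β²` divides `e₀₀` (`solitonPoly_roots`, `LocalRanders.conformal_and_isotropic`).

**The remaining equations.** Once `e₀₀ = 2σ(α² - β²)` and `V_{0;0} = 2cα²`, the soliton equation reads
`E + βZ + α(2D + Z) = 0` (`LocalRanders.soliton_split`), where `E` and `D` are the defects of the
equations for `ᵅRic` and for the divergence `sⁱ_{0;i}`, and `Z = ℒ_{V̂}β - 2cβ + 3(n - 1)σ₀`. By parity in
`y`, this means `E = -βZ` and `2D = -Z`. On the other hand `D` is determined by `E`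
(`FiberIsotropic.divergence_identity`); this is the Ricci identity for `b♯`, combined with the closedness of
`s + 2σβ = -½ d log(1 - ‖β‖²)`. It forces `Z = 0` and hence `E = 0`
(`LocalRanders.equations_of_soliton`); conversely `E = 0` and `Z = 0` give `D = 0`
(`LocalRanders.soliton_of_equations`).

**Zeros of `β`.** The equations for `e₀₀` and `dσ` extend to all points by density, because they hold
trivially where `β` vanishes on an open set. They make `(b, ∂b, σ)` the solution of a closed system of
linear differential inequalities, so that this jet vanishes near each of its zeros
(`LocalRanders.Isotropic.eventually_b_eq_zero`). By connectedness, `β ≢ 0` then vanishes on no open set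
(`RandersMetric.not_eventually_β_eq_zero`), and density gives the conformality of `V` at all points.

**Globalization.** The local `c` and `σ` do not depend on the chart: `V_{0;0} = ½ ℒ_{V̂}(α²)`, and
`d‖β‖²(b♯) = 4‖β‖²(1 - ‖β‖²)σ` (`LocalRanders.Isotropic.fderiv_normSq_sharpVec`) determines `σ` on the dense
set where `β ≠ 0`.
-/

namespace RandersSoliton
noncomputable section
open Finset

/-! ### Calculus on a coordinate tangent bundle -/

/-- The algebraic form of calculus on an open subset of a tangent bundle with coordinates `(xⁱ, yⁱ)`:
an algebra `A` of functions with commuting derivations `Xᵢ = ∂/∂xⁱ` and `Yᵢ = ∂/∂yⁱ`, and the fibre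
coordinates `yⁱ ∈ A`. The base coordinates are not needed as elements of `A`. -/
structure FiberCalculus (n : ℕ) (A : Type*) [CommRing A] [Algebra ℝ A] where
  /-- `∂/∂xⁱ` -/
  X : Fin n → Derivation ℝ A A
  /-- `∂/∂yⁱ` -/
  Y : Fin n → Derivation ℝ A A
  /-- The fibre coordinate `yⁱ`. -/
  y : Fin n → A
  X_y : ∀ i j, X i (y j) = 0
  Y_y : ∀ i j, Y i (y j) = if i = j then 1 else 0
  XX : ∀ i j f, X i (X j f) = X j (X i f)
  XY : ∀ i j f, X i (Y j f) = Y j (X i f)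
  YY : ∀ i j f, Y i (Y j f) = Y j (Y i f)

theorem two_mul_cancel {A : Type*} [CommRing A] [Algebra ℝ A] {f g : A} (h : 2 * f = 2 * g) :
    f = g := by
  have h' : ∀ f : A, f = (1 / 2 : ℝ) • (2 * f) := fun f => by algebra
  rw [h' f, h, ← h' g]

theorem derivation_two_mul {A : Type*} [CommRing A] [Algebra ℝ A] (d : Derivation ℝ A A) (f : A) :
    d (2 * f) = 2 * d f := by
  simp only [two_mul, map_add]

theorem derivation_two {A : Type*} [CommRing A] [Algebra ℝ A] (d : Derivation ℝ A A) :
    d 2 = 0 := by simpa using d.map_natCast 2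

theorem derivation_three {A : Type*} [CommRing A] [Algebra ℝ A] (d : Derivation ℝ A A) :
    d 3 = 0 := by simpa using d.map_natCast 3

namespace FiberCalculus
variable {n : ℕ} {A : Type*} [CommRing A] [Algebra ℝ A] (K : FiberCalculus n A)

/-- The functions that are constant along the fibres: `∂f/∂yⁱ = 0`. -/
def IsBasic (f : A) : Prop := ∀ i, K.Y i f = 0

/-- The vertical derivation `Wⁱ ∂/∂yⁱ`; `vert y` is the Liouville (Euler) field. -/
def vert (W : Fin n → A) : Derivation ℝ A A := ∑ i, W i • K.Y i

theorem sum_derivation_apply {ι : Type*} (s : Finset ι) (d : ι → Derivation ℝ A A) (f : A) :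
    (∑ i ∈ s, d i) f = ∑ i ∈ s, d i f := by
  classical
  induction s using Finset.induction_on with
  | empty => simp
  | insert i s hi ih => rw [sum_insert hi, sum_insert hi, Derivation.add_apply, ih]

theorem vert_apply (W : Fin n → A) (f : A) : K.vert W f = ∑ i, W i * K.Y i f := by
  simp [vert, sum_derivation_apply]

theorem vert_y (W : Fin n → A) (i : Fin n) : K.vert W (K.y i) = W i := by
  simp [vert_apply, K.Y_y]

theorem vert_basic (W : Fin n → A) {f : A} (hf : K.IsBasic f) : K.vert W f = 0 := by
  simp [vert_apply, hf _]

theorem vert_add (W Z : Fin n → A) (f : A) :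
    K.vert (fun i => W i + Z i) f = K.vert W f + K.vert Z f := by
  simp [vert_apply, add_mul, sum_add_distrib]

theorem vert_mul (c : A) (W : Fin n → A) (f : A) :
    K.vert (fun i => c * W i) f = c * K.vert W f := by
  simp [vert_apply, mul_sum, mul_assoc]

theorem Y_vert (W : Fin n → A) (j : Fin n) (f : A) :
    K.Y j (K.vert W f) = ∑ i, K.Y j (W i) * K.Y i f + K.vert W (K.Y j f) := by
  simp only [vert_apply, map_sum, Derivation.leibniz, smul_eq_mul, sum_add_distrib, K.YY j]
  rw [add_comm]; congr 1
  exact sum_congr rfl fun i _ => mul_comm _ _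

theorem IsBasic.X {f : A} (hf : K.IsBasic f) (i : Fin n) : K.IsBasic (K.X i f) := fun j => by
  rw [← K.XY, hf j, map_zero]

/-- The horizontal part `yᵏ ∂/∂xᵏ` of every spray `yᵏ ∂/∂xᵏ - 2Gᵏ ∂/∂yᵏ`. -/
def euler : Derivation ℝ A A := ∑ i, K.y i • K.X i

theorem euler_apply (f : A) : K.euler f = ∑ i, K.y i * K.X i f := by
  simp [euler, sum_derivation_apply]

/-- The vertical divergence `∂Wⁱ/∂yⁱ`. -/
def vtr (W : Fin n → A) : A := ∑ i, K.Y i (W i)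

/-- The Ricci curvature of the spray `yᵏ ∂/∂xᵏ - 2Gᵏ ∂/∂yᵏ`, that is, the trace of its Riemann
curvature; see `ric_eq`. -/
def ric (G : Fin n → A) : A :=
  2 * ∑ i, K.X i (G i) - K.euler (K.vtr G) + 2 * K.vert G (K.vtr G)
    - ∑ i, ∑ j, K.Y j (G i) * K.Y i (G j)

/-- The function `f` is positively homogeneous of degree `k` in the fibre, in the infinitesimal form
`yⁱ ∂f/∂yⁱ = k f`. -/
def IsHom (k : ℕ) (f : A) : Prop := K.vert K.y f = k * f

theorem IsHom.Y {k : ℕ} {f : A} (hf : K.IsHom (k + 1) f) (j : Fin n) : K.IsHom k (K.Y j f) := by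
  have := congrArg (K.Y j) hf
  rw [Y_vert] at this
  simp only [K.Y_y, Derivation.leibniz] at this
  simp only [IsHom]
  have h2 : K.Y j ((k + 1 : ℕ) : A) = 0 := by simp
  rw [h2] at this
  simp at this
  linear_combination this

/-- The Ricci curvature under a projective change `Gⁱ = Hⁱ + P yⁱ` of the spray: it changes by
`(n - 1)(P² - D_H P)`, where `D_H = yᵏ ∂/∂xᵏ - 2Hᵏ ∂/∂yᵏ`. -/
theorem ric_projective (H : Fin n → A) (P : A) (hH : ∀ i, K.IsHom 2 (H i)) (hP : K.IsHom 1 P) :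
    K.ric (fun i => H i + P * K.y i)
      = K.ric H + ((n : A) - 1) * (P ^ 2 - (K.euler P - 2 * K.vert H P)) := by
  have e1 : K.vert K.y P = P := by simpa [IsHom] using hP
  have e0 (j) : K.vert K.y (K.Y j P) = 0 := by simpa [IsHom] using IsHom.Y K (k := 0) (by simpa using hP) j
  have h1 (i j) : K.vert K.y (K.Y j (H i)) = K.Y j (H i) := by
    simpa [IsHom] using IsHom.Y K (k := 1) (hH i) j
  have hHt : K.vert K.y (K.vtr H) = K.vtr H := by
    simp only [vtr, map_sum, h1]
  have h2 (i) : K.vert K.y (H i) = 2 * H i := by simpa [IsHom] using hH i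
  -- `∂ᵢ(P yⁱ) = (n + 1) P`
  have ht : K.vtr (fun i => H i + P * K.y i) = K.vtr H + ((n : A) + 1) * P := by
    simp only [vtr, map_add, Derivation.leibniz, smul_eq_mul, K.Y_y, sum_add_distrib]
    rw [← K.vert_apply K.y P, e1]
    simp
    ring
  have hX : ∑ i, K.X i (H i + P * K.y i) = ∑ i, K.X i (H i) + K.euler P := by
    simp [K.X_y, sum_add_distrib, euler_apply]
  have hv (f : A) : K.vert (fun i => H i + P * K.y i) f = K.vert H f + P * K.vert K.y f := by
    rw [vert_add, vert_mul]
  have hn : K.euler (n : A) = 0 := by simp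
  have hn' : ∀ W, K.vert W (n : A) = 0 := by simp
  have q1 : ∑ i, ∑ j, K.y j * K.Y j P * (K.y i * K.Y i P) = P * P := by
    conv_rhs => rw [← e1]
    rw [vert_apply, sum_mul_sum]
    exact sum_congr rfl fun i _ => sum_congr rfl fun j _ => by ring
  have q2 : ∑ i, ∑ j, K.Y j (H i) * (K.y j * K.Y i P) = 2 * K.vert H P := by
    rw [vert_apply, mul_sum]
    refine sum_congr rfl fun i _ => ?_
    have := h2 i
    rw [vert_apply] at this
    rw [← mul_assoc, ← this, sum_mul]
    exact sum_congr rfl fun j _ => by ring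
  have q2' : ∑ i, ∑ j, K.y i * K.Y j P * K.Y i (H j) = 2 * K.vert H P := by
    rw [sum_comm, ← q2]
    exact sum_congr rfl fun i _ => sum_congr rfl fun j _ => by ring
  have hq : ∑ i, ∑ j, K.Y j (H i + P * K.y i) * K.Y i (H j + P * K.y j)
      = ∑ i, ∑ j, K.Y j (H i) * K.Y i (H j) + 4 * K.vert H P + 2 * P * K.vtr H
        + ((n : A) + 3) * P ^ 2 := by
    have : ∀ i j, K.Y j (H i + P * K.y i) * K.Y i (H j + P * K.y j)
      = K.Y j (H i) * K.Y i (H j) + K.Y j (H i) * (K.y j * K.Y i P)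
        + K.y i * K.Y j P * K.Y i (H j) + K.y j * K.Y j P * (K.y i * K.Y i P)
        + (if i = j then 2 * P * K.Y i (H j) + P * (K.y i * K.Y i P) * 2 + P ^ 2 else 0) := by
      intro i j
      simp only [map_add, Derivation.leibniz, smul_eq_mul, K.Y_y]
      by_cases h : i = j
      · subst h; simp; ring
      · simp [h, Ne.symm h]; ring
    simp only [this, sum_add_distrib, q1, q2, q2']
    simp only [sum_ite_eq, mem_univ, if_true, sum_add_distrib, ← mul_sum, ← sum_mul, vtr]
    rw [← K.vert_apply K.y P, e1]
    simp
    ring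
  rw [ric, ht, hX, hq, ric]
  simp only [hv, map_add, Derivation.leibniz, smul_eq_mul, hn, hn', e1, hHt]
  simp
  ring

end FiberCalculus

end
end RandersSoliton

namespace RandersSoliton
noncomputable section
open Finset

/-! ### Riemannian metrics -/

/-- A Riemannian metric `a_{ij}(x)`, given with its inverse matrix. Positivity plays no role in the
identities. -/
structure FiberMetric {n : ℕ} {A : Type*} [CommRing A] [Algebra ℝ A] (K : FiberCalculus n A) where
  /-- The components `a_{ij}`. -/
  a : Fin n → Fin n → A
  /-- The components `a^{ij}` of the inverse matrix. -/
  ai : Fin n → Fin n → A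
  a_symm : ∀ i j, a i j = a j i
  ai_symm : ∀ i j, ai i j = ai j i
  a_basic : ∀ i j, K.IsBasic (a i j)
  ai_basic : ∀ i j, K.IsBasic (ai i j)
  a_ai : ∀ i j, ∑ k, a i k * ai k j = if i = j then 1 else 0

namespace FiberMetric
variable {n : ℕ} {A : Type*} [CommRing A] [Algebra ℝ A] {K : FiberCalculus n A}
  (g : FiberMetric K)

theorem ai_a (i j : Fin n) : ∑ k, g.ai i k * g.a k j = if i = j then 1 else 0 := by
  have := g.a_ai j i
  simp only [eq_comm (a := j)] at this
  rw [← this]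
  exact sum_congr rfl fun k _ => by rw [g.ai_symm i k, g.a_symm k j, mul_comm]

/-- Lowering an index: `Wᵢ = a_{ik} Wᵏ`. -/
def flat (W : Fin n → A) (i : Fin n) : A := ∑ k, g.a i k * W k

/-- Raising an index: `wⁱ = a^{ik} wₖ`. -/
def sharp (w : Fin n → A) (i : Fin n) : A := ∑ k, g.ai i k * w k

theorem flat_sharp (w : Fin n → A) (i : Fin n) : g.flat (g.sharp w) i = w i := by
  simp only [flat, sharp, mul_sum]
  rw [sum_comm]
  simp only [← mul_assoc, ← sum_mul, g.a_ai]
  simp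

theorem sharp_flat (w : Fin n → A) (i : Fin n) : g.sharp (g.flat w) i = w i := by
  simp only [flat, sharp, mul_sum]
  rw [sum_comm]
  simp only [← mul_assoc, ← sum_mul, g.ai_a]
  simp

theorem sum_sharp_mul (w z : Fin n → A) :
    ∑ i, g.sharp w i * z i = ∑ i, w i * g.sharp z i := by
  simp only [sharp, sum_mul, mul_sum]
  rw [sum_comm]
  exact sum_congr rfl fun i _ => sum_congr rfl fun j _ => by rw [g.ai_symm]; ring

theorem sum_flat_mul (w z : Fin n → A) :
    ∑ i, g.flat w i * z i = ∑ i, w i * g.flat z i := by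
  simp only [flat, sum_mul, mul_sum]
  rw [sum_comm]
  exact sum_congr rfl fun i _ => sum_congr rfl fun j _ => by rw [g.a_symm]; ring

/-- The Christoffel symbols of the first kind `Γ_{l,ij}`. -/
def chrL (l i j : Fin n) : A :=
  (1 / 2 : ℝ) • (K.X j (g.a l i) + K.X i (g.a l j) - K.X l (g.a i j))

/-- The Christoffel symbols `Γᵏᵢⱼ`. -/
def chr (k i j : Fin n) : A := g.sharp (fun l => g.chrL l i j) k

theorem chrL_symm (l i j : Fin n) : g.chrL l i j = g.chrL l j i := by
  simp only [chrL, g.a_symm i j]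
  algebra

theorem chr_symm (k i j : Fin n) : g.chr k i j = g.chr k j i := by
  simp only [chr, g.chrL_symm _ i j]

theorem flat_chr (l i j : Fin n) : g.flat (fun k => g.chr k i j) l = g.chrL l i j :=
  g.flat_sharp _ _

theorem X_a (k i j : Fin n) : K.X k (g.a i j) = g.chrL i j k + g.chrL j i k := by
  simp only [chrL, g.a_symm j i, g.a_symm j k, g.a_symm i k]
  algebra

theorem chr_basic (k i j : Fin n) : K.IsBasic (g.chr k i j) := fun m => by
  simp only [chr, sharp, chrL, map_sum, Derivation.leibniz, Derivation.map_smul, map_add, map_sub]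
  simp [g.ai_basic _ _ m, (g.a_basic _ _).X K _ m]

/-- The nonlinear connection `Nⁱⱼ = Γⁱⱼₗ yˡ`. -/
def conn (i j : Fin n) : A := ∑ l, g.chr i j l * K.y l

theorem Y_conn (k i j : Fin n) : K.Y k (g.conn i j) = g.chr i j k := by
  simp [conn, K.Y_y, g.chr_basic _ _ _ k]

/-- The geodesic coefficients `½ Γⁱⱼₗ yʲ yˡ` of the metric. -/
def spray (i : Fin n) : A := (1 / 2 : ℝ) • ∑ j, g.conn i j * K.y j

theorem two_spray (i : Fin n) : 2 * g.spray i = ∑ j, g.conn i j * K.y j := by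
  simp only [spray]; algebra

theorem Y_spray (k i : Fin n) : K.Y k (g.spray i) = g.conn i k := by
  apply two_mul_cancel
  have : 2 * K.Y k (g.spray i) = K.Y k (2 * g.spray i) := by simp only [two_mul, map_add]
  rw [this, two_spray]
  simp only [map_sum, Derivation.leibniz, smul_eq_mul, K.Y_y, g.Y_conn, sum_add_distrib]
  simp [conn, g.chr_symm i k, mul_comm, two_mul]

/-- The horizontal derivation `δₖ = ∂/∂xᵏ - Nⁱₖ ∂/∂yⁱ`. On functions that are polynomial in `y` it is
covariant differentiation of the corresponding symmetric tensors. -/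
def hor (k : Fin n) : Derivation ℝ A A := K.X k - K.vert (fun i => g.conn i k)

theorem hor_apply (k : Fin n) (f : A) :
    g.hor k f = K.X k f - K.vert (fun i => g.conn i k) f := rfl

/-- The derivation `yᵏ δₖ` along the geodesic spray, so that `w_{0;0}` is `geo` of `w₀`. -/
def geo : Derivation ℝ A A := ∑ k, K.y k • g.hor k

theorem geo_apply (f : A) : g.geo f = ∑ k, K.y k * g.hor k f := by
  simp [geo, FiberCalculus.sum_derivation_apply]

theorem geo_eq (f : A) : g.geo f = K.euler f - 2 * K.vert g.spray f := by
  simp only [geo_apply, hor_apply, mul_sub, sum_sub_distrib, ← K.euler_apply]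
  congr 1
  simp only [K.vert_apply, mul_sum]
  rw [sum_comm]
  refine sum_congr rfl fun i _ => ?_
  rw [← mul_assoc, g.two_spray, sum_mul]
  exact sum_congr rfl fun j _ => by ring

theorem hor_basic {f : A} (hf : K.IsBasic f) (k : Fin n) : g.hor k f = K.X k f := by
  simp [hor_apply, K.vert_basic _ hf]

theorem hor_y (k i : Fin n) : g.hor k (K.y i) = - g.conn i k := by
  simp [hor_apply, K.X_y, K.vert_y]

theorem Y_hor (j k : Fin n) (f : A) :
    K.Y j (g.hor k f) = g.hor k (K.Y j f) - ∑ m, g.chr m j k * K.Y m f := by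
  simp only [hor_apply, map_sub, K.Y_vert, K.XY, Y_conn, g.chr_symm _ k j]
  ring

theorem Y_geo (l : Fin n) (f : A) :
    K.Y l (g.geo f) = g.geo (K.Y l f) + g.hor l f - ∑ m, g.conn m l * K.Y m f := by
  simp only [geo_apply, map_sum, Derivation.leibniz, smul_eq_mul, Y_hor, K.Y_y, sum_add_distrib,
    mul_sub, sum_sub_distrib]
  have : ∑ k, K.y k * ∑ m, g.chr m l k * K.Y m f = ∑ m, g.conn m l * K.Y m f := by
    simp only [mul_sum, conn, sum_mul]
    rw [sum_comm]
    exact sum_congr rfl fun i _ => sum_congr rfl fun j _ => by ring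
  rw [this]
  simp
  ring

/-- The energy `α² = a_{ij} yⁱ yʲ`. -/
def en : A := ∑ i, g.flat K.y i * K.y i

theorem Y_flat_y (k i : Fin n) : K.Y k (g.flat K.y i) = g.a i k := by
  simp [flat, g.a_basic _ _ k, K.Y_y]

theorem Y_en (k : Fin n) : K.Y k g.en = 2 * g.flat K.y k := by
  simp only [en, map_sum, Derivation.leibniz, smul_eq_mul, K.Y_y, Y_flat_y, sum_add_distrib]
  simp only [mul_ite, mul_one, mul_zero, sum_ite_eq, mem_univ, if_true, two_mul]
  congr 1
  simp only [flat]
  exact sum_congr rfl fun j _ => by rw [g.a_symm]; ring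

theorem vert_en (W : Fin n → A) : K.vert W g.en = 2 * ∑ i, W i * g.flat K.y i := by
  simp only [K.vert_apply, Y_en, mul_sum]
  exact sum_congr rfl fun j _ => by ring

theorem flat_conn (l k : Fin n) : g.flat (fun i => g.conn i k) l = ∑ j, g.chrL l k j * K.y j := by
  simp only [← g.flat_chr, flat, conn, mul_sum, sum_mul]
  rw [sum_comm]
  exact sum_congr rfl fun i _ => sum_congr rfl fun j _ => by ring

theorem hor_en (k : Fin n) : g.hor k g.en = 0 := by
  have h1 : ∑ i, g.conn i k * g.flat K.y i = ∑ i, ∑ j, g.chrL i j k * K.y j * K.y i := by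
    rw [← g.sum_flat_mul]
    refine sum_congr rfl fun i _ => ?_
    rw [flat_conn, sum_mul]
    exact sum_congr rfl fun j _ => by rw [g.chrL_symm]
  have h2 : K.X k g.en = ∑ i, ∑ j, (g.chrL i j k + g.chrL j i k) * K.y j * K.y i := by
    simp only [en, flat, map_sum, Derivation.leibniz, smul_eq_mul, K.X_y, g.X_a, sum_mul]
    refine sum_congr rfl fun i _ => ?_
    simp only [mul_zero, zero_add]
    exact sum_congr rfl fun j _ => by ring
  have h3 : ∑ i, ∑ j, g.chrL j i k * K.y j * K.y i = ∑ i, ∑ j, g.chrL i j k * K.y j * K.y i := by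
    rw [sum_comm]
    exact sum_congr rfl fun i _ => sum_congr rfl fun j _ => by ring
  rw [hor_apply, h2, vert_en, h1]
  simp only [add_mul, sum_add_distrib, h3]
  ring

theorem geo_en : g.geo g.en = 0 := by simp [geo_apply, hor_en]

/-- The geodesic equation for the energy `α²`. -/
theorem spray_en (l : Fin n) :
    2 * K.vert g.spray (K.Y l g.en) = K.euler (K.Y l g.en) - K.X l g.en := by
  have h := g.Y_geo l g.en
  rw [geo_en, geo_eq, hor_en, map_zero] at h
  have h2 := g.hor_en l
  rw [hor_apply, K.vert_apply] at h2
  linear_combination h + h2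

/-- The divergence `W^i_{;i}` of a vector field with coefficients depending on `y`: covariant
differentiation acts on the index of `W` and on the arguments `y`. -/
def hdiv (W : Fin n → A) : A := ∑ i, (g.hor i (W i) + ∑ j, g.chr i i j * W j)

theorem vtr_spray : K.vtr g.spray = ∑ i, g.conn i i := by simp [FiberCalculus.vtr, Y_spray]

/-- The Ricci curvature of a deformation of the spray of a metric by a field without vertical divergence. -/
theorem ric_spray_add (Q : Fin n → A) (hQ : K.vtr Q = 0) :
    K.ric (fun i => g.spray i + Q i)
      = K.ric g.spray + 2 * g.hdiv Q - ∑ i, ∑ j, K.Y j (Q i) * K.Y i (Q j) := by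
  have ht : K.vtr (fun i => g.spray i + Q i) = K.vtr g.spray := by
    simp only [FiberCalculus.vtr, map_add, sum_add_distrib] at hQ ⊢
    rw [hQ, add_zero]
  have h1 : K.vert Q (K.vtr g.spray) = ∑ i, ∑ j, g.chr i i j * Q j := by
    rw [vtr_spray, map_sum]
    refine sum_congr rfl fun i _ => ?_
    rw [K.vert_apply]
    exact sum_congr rfl fun j _ => by rw [g.Y_conn, mul_comm]
  have h2 : ∑ i, ∑ j, g.conn i j * K.Y i (Q j) = ∑ i, ∑ j, g.conn j i * K.Y j (Q i) := sum_comm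
  rw [FiberCalculus.ric, FiberCalculus.ric, ht, K.vert_add, h1]
  simp only [hdiv, hor_apply, K.vert_apply, map_add, sum_add_distrib, sum_sub_distrib, add_mul,
    mul_add, Y_spray, h2]
  have h3 : ∑ i, ∑ j, K.Y j (Q i) * g.conn j i = ∑ i, ∑ j, g.conn j i * K.Y j (Q i) :=
    sum_congr rfl fun i _ => sum_congr rfl fun j _ => by ring
  rw [h3]
  ring

end FiberMetric

end
end RandersSoliton

namespace RandersSoliton
noncomputable section
open Finset

/-! ### Randers metrics and their sprays -/

/-- A 1-form `bᵢ(x)` on a space with metric `g`. -/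
structure FiberForm {n : ℕ} {A : Type*} [CommRing A] [Algebra ℝ A] {K : FiberCalculus n A}
    (g : FiberMetric K) where
  /-- The components `bᵢ`. -/
  b : Fin n → A
  b_basic : ∀ i, K.IsBasic (b i)

namespace FiberForm
variable {n : ℕ} {A : Type*} [CommRing A] [Algebra ℝ A] {K : FiberCalculus n A}
  {g : FiberMetric K} (η : FiberForm g)

/-- `β = bᵢ yⁱ` -/
def β : A := ∑ i, η.b i * K.y i

/-- `s_{ij} = ½ (b_{i;j} - b_{j;i})`; the Christoffel symbols cancel, so that partial derivatives
suffice. -/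
def s (i j : Fin n) : A := (1 / 2 : ℝ) • (K.X j (η.b i) - K.X i (η.b j))

theorem s_antisymm (i j : Fin n) : η.s i j = - η.s j i := by simp only [s]; algebra

theorem s_basic (i j : Fin n) : K.IsBasic (η.s i j) := fun m => by
  simp only [s, Derivation.map_smul, map_sub]
  simp [(η.b_basic _).X K _ m]

theorem sum_s_mul_self (W : Fin n → A) : ∑ i, ∑ j, η.s i j * W j * W i = 0 := by
  apply two_mul_cancel
  have : ∑ i, ∑ j, η.s i j * W j * W i = ∑ i, ∑ j, - (η.s i j * W j * W i) := by
    conv_lhs => rw [sum_comm]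
    exact sum_congr rfl fun i _ => sum_congr rfl fun j _ => by rw [η.s_antisymm]; ring
  simp only [sum_neg_distrib] at this
  linear_combination this

/-- `s_{i0} = s_{ij} yʲ` -/
def sy (i : Fin n) : A := ∑ j, η.s i j * K.y j

/-- `sⁱ₀ = a^{ik} s_{k0}` -/
def S0 : Fin n → A := g.sharp η.sy

/-- `sⁱⱼ = a^{ik} s_{kj}` -/
def sm (i j : Fin n) : A := g.sharp (fun l => η.s l j) i

/-- The vector field `bⁱ = a^{ij} bⱼ`. -/
def B : Fin n → A := g.sharp η.b

/-- `sⱼ = bⁱ s_{ij}` -/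
def s1 (j : Fin n) : A := ∑ i, η.B i * η.s i j

/-- `s₀ = sⱼ yʲ` -/
def s0 : A := ∑ j, η.s1 j * K.y j

/-- `r₀₀ = b_{i;j} yⁱ yʲ` -/
def r00 : A := g.geo η.β

/-- `e₀₀ = r₀₀ + 2 β s₀` -/
def e00 : A := η.r00 + 2 * η.β * η.s0

/-- `t₀₀ = s_{0k} sᵏ₀ = -s_{k0} sᵏ₀` -/
def t00 : A := - ∑ k, η.sy k * η.S0 k

/-- `tⁱᵢ = sⁱⱼ sʲᵢ` -/
def ttr : A := ∑ i, ∑ j, η.sm i j * η.sm j i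

theorem Y_β (k : Fin n) : K.Y k η.β = η.b k := by
  simp [β, η.b_basic _ k, K.Y_y]

theorem vert_β (W : Fin n → A) : K.vert W η.β = ∑ i, η.b i * W i := by
  simp [K.vert_apply, Y_β, mul_comm]

theorem sm_basic (i j : Fin n) : K.IsBasic (η.sm i j) := fun m => by
  simp only [sm, FiberMetric.sharp, map_sum, Derivation.leibniz]
  simp [g.ai_basic _ _ m, η.s_basic _ _ m]

theorem B_basic (i : Fin n) : K.IsBasic (η.B i) := fun m => by
  simp only [B, FiberMetric.sharp, map_sum, Derivation.leibniz]
  simp [g.ai_basic _ _ m, η.b_basic _ m]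

theorem s1_basic (i : Fin n) : K.IsBasic (η.s1 i) := fun m => by
  simp only [s1, map_sum, Derivation.leibniz]
  simp [η.B_basic _ m, η.s_basic _ _ m]

theorem S0_eq (i : Fin n) : η.S0 i = ∑ j, η.sm i j * K.y j := by
  simp only [S0, FiberMetric.sharp, sy, sm, mul_sum, sum_mul]
  rw [sum_comm]
  exact sum_congr rfl fun i _ => sum_congr rfl fun j _ => by ring

theorem Y_S0 (k i : Fin n) : K.Y k (η.S0 i) = η.sm i k := by
  simp [S0_eq, η.sm_basic _ _ k, K.Y_y]

theorem Y_s0 (k : Fin n) : K.Y k η.s0 = η.s1 k := by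
  simp [s0, η.s1_basic _ k, K.Y_y]

theorem flat_S0 (l : Fin n) : g.flat η.S0 l = η.sy l := g.flat_sharp _ _

theorem sum_sy_y : ∑ i, η.sy i * K.y i = 0 := by
  simp only [sy, sum_mul]; exact η.sum_s_mul_self _

theorem sum_S0_flat_y : ∑ i, η.S0 i * g.flat K.y i = 0 := by
  rw [← g.sum_flat_mul]; simp only [flat_S0, sum_sy_y]

theorem s0_eq : η.s0 = ∑ i, η.B i * η.sy i := by
  simp only [s0, s1, sy, mul_sum, sum_mul]
  rw [sum_comm]
  exact sum_congr rfl fun i _ => sum_congr rfl fun j _ => by ring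

theorem vert_S0_β : K.vert η.S0 η.β = η.s0 := by
  rw [vert_β, s0_eq, B, g.sum_sharp_mul]; rfl

theorem hor_β (k : Fin n) :
    g.hor k η.β = ∑ i, (K.X k (η.b i) - ∑ m, g.chr m i k * η.b m) * K.y i := by
  simp only [g.hor_apply, vert_β]
  simp only [β, map_sum, Derivation.leibniz, smul_eq_mul, K.X_y, mul_zero, zero_add, sub_mul,
    sum_sub_distrib, FiberMetric.conn, mul_sum, sum_mul]
  congr 1
  · exact sum_congr rfl fun i _ => by ring
  · rw [sum_comm]
    exact sum_congr rfl fun i _ => sum_congr rfl fun j _ => by rw [g.chr_symm]; ring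

/-- `∂r₀₀/∂yˡ = b_{0;l} + b_{l;0} = 2b_{0;l} + 2s_{l0}`, where `b_{0;l} = δ_l β`. -/
theorem Y_r00 (l : Fin n) : K.Y l η.r00 = 2 * g.hor l η.β + 2 * η.sy l := by
  have h1 : 2 * η.sy l = ∑ k, K.y k * (K.X k (η.b l) - K.X l (η.b k)) := by
    simp only [sy, s, mul_sum]
    exact sum_congr rfl fun j _ => by algebra
  have h2 : g.geo (η.b l) = ∑ k, K.y k * K.X k (η.b l) := by
    simp only [g.geo_apply, g.hor_basic (η.b_basic l)]
  have h3 := g.hor_apply l η.β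
  have h4 : K.X l η.β = ∑ k, K.y k * K.X l (η.b k) := by
    simp [β, K.X_y]
  rw [K.vert_apply] at h3
  simp only [Y_β] at h3
  rw [r00, g.Y_geo, Y_β, h1, h2]
  simp only [Y_β, mul_sub, sum_sub_distrib, ← h4]
  linear_combination -h3

theorem hom_b : K.vert K.y η.β = η.β := by rw [vert_β]; rfl

theorem hom_s0 : K.vert K.y η.s0 = η.s0 := by
  simp only [K.vert_apply, Y_s0]; simp [s0, mul_comm]

theorem hom_S0 (i : Fin n) : K.vert K.y (η.S0 i) = η.S0 i := by
  simp only [K.vert_apply, Y_S0]; simp [S0_eq, mul_comm]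

end FiberForm

namespace FiberMetric
variable {n : ℕ} {A : Type*} [CommRing A] [Algebra ℝ A] {K : FiberCalculus n A}
  (g : FiberMetric K)

theorem hom_spray (i : Fin n) : K.vert K.y (g.spray i) = 2 * g.spray i := by
  rw [two_spray]
  simp [K.vert_apply, Y_spray, mul_comm]

theorem hom_en : K.vert K.y g.en = 2 * g.en := by
  rw [vert_en, en]; simp [mul_comm]

/-- The horizontal derivations preserve the degree of homogeneity. -/
theorem hom_hor (k : Fin n) (f : A) : K.vert K.y (g.hor k f) = g.hor k (K.vert K.y f) := by
  simp only [K.vert_apply, Y_hor, map_sum, Derivation.leibniz, smul_eq_mul, hor_y, mul_sub,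
    sum_add_distrib, sum_sub_distrib]
  have : ∑ i, K.y i * ∑ m, g.chr m i k * K.Y m f = ∑ i, K.Y i f * g.conn i k := by
    simp only [conn, mul_sum]
    rw [sum_comm]
    exact sum_congr rfl fun i _ => sum_congr rfl fun j _ => by rw [g.chr_symm]; ring
  rw [this]
  simp only [mul_neg, sum_neg_distrib]
  ring

theorem hom_geo (f : A) : K.vert K.y (g.geo f) = g.geo f + g.geo (K.vert K.y f) := by
  simp only [geo_apply, map_sum, Derivation.leibniz, smul_eq_mul, hom_hor, K.vert_y,
    sum_add_distrib]
  rw [add_comm]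
  congr 1
  exact sum_congr rfl fun i _ => mul_comm _ _

end FiberMetric

/-- A Randers metric `F = α + β`: a metric and a 1-form together with a square root `α` of the energy
such that `α` and `α + β` are invertible. -/
structure FiberRanders {n : ℕ} {A : Type*} [CommRing A] [Algebra ℝ A] {K : FiberCalculus n A}
    (g : FiberMetric K) extends FiberForm g where
  /-- `α = √(a_{ij} yⁱ yʲ)` -/
  α : A
  /-- `1 / α` -/
  αi : A
  /-- `1 / F` -/
  Fi : A
  α_sq : α * α = g.en
  α_inv : α * αi = 1
  F_inv : (α + toFiberForm.β) * Fi = 1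

namespace FiberRanders
variable {n : ℕ} {A : Type*} [CommRing A] [Algebra ℝ A] {K : FiberCalculus n A}
  {g : FiberMetric K} (η : FiberRanders g)

/-- The Randers metric `F = α + β`. -/
def F : A := η.α + η.β

/-- The projective factor `P = e₀₀ / (2F) - s₀` in the spray of `F`. -/
def P : A := (1 / 2 : ℝ) • (η.e00 * η.Fi) - η.s0

/-- The geodesic coefficients `Gⁱ + α sⁱ₀ + P yⁱ` of the Randers metric, where `Gⁱ` are those of `α`;
that they are so is `vert_G_Y_energy`. -/
def G (i : Fin n) : A := g.spray i + η.α * η.S0 i + η.P * K.y i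

theorem α_cancel {f h : A} (e : η.α * f = η.α * h) : f = h := by
  linear_combination η.αi * e + (h - f) * η.α_inv

theorem F_cancel {f h : A} (e : η.F * f = η.F * h) : f = h := by
  rw [F] at e
  linear_combination η.Fi * e + (h - f) * η.F_inv

/-- The derivative of `α` from that of `α²`. -/
theorem α_mul_derivation (d : Derivation ℝ A A) : 2 * (η.α * d η.α) = d g.en := by
  rw [← η.α_sq, Derivation.leibniz]; simp only [smul_eq_mul]; ring

theorem derivation_α_eq_zero {d : Derivation ℝ A A} (h : d g.en = 0) : d η.α = 0 := by
  apply η.α_cancel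
  apply two_mul_cancel
  rw [α_mul_derivation, h]; ring

theorem hor_α (k : Fin n) : g.hor k η.α = 0 := η.derivation_α_eq_zero (g.hor_en k)
theorem geo_α : g.geo η.α = 0 := η.derivation_α_eq_zero g.geo_en
theorem vert_S0_α : K.vert η.S0 η.α = 0 := η.derivation_α_eq_zero (by
  rw [g.vert_en, η.sum_S0_flat_y, mul_zero])

theorem α_mul_Y (k : Fin n) : η.α * K.Y k η.α = g.flat K.y k := by
  apply two_mul_cancel
  rw [α_mul_derivation, g.Y_en]

theorem Y_α (k : Fin n) : K.Y k η.α = η.αi * g.flat K.y k := by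
  apply η.α_cancel
  rw [α_mul_Y]
  linear_combination -(g.flat K.y k) * η.α_inv

theorem hom_α : K.vert K.y η.α = η.α := by
  apply η.α_cancel
  apply two_mul_cancel
  rw [α_mul_derivation, g.hom_en, η.α_sq]

theorem derivation_αi (d : Derivation ℝ A A) : d η.αi = - η.αi ^ 2 * d η.α := by
  have h := congrArg d η.α_inv
  rw [Derivation.leibniz] at h
  simp only [smul_eq_mul, Derivation.map_one_eq_zero] at h
  linear_combination η.αi * h - d η.αi * η.α_inv

theorem derivation_Fi (d : Derivation ℝ A A) : d η.Fi = - η.Fi ^ 2 * d η.F := by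
  have h := congrArg d η.F_inv
  rw [Derivation.leibniz] at h
  simp only [smul_eq_mul, Derivation.map_one_eq_zero] at h
  rw [F]
  linear_combination η.Fi * h - d η.Fi * η.F_inv

theorem geo_F : g.geo η.F = η.r00 := by
  rw [F, map_add, geo_α, zero_add]; rfl

theorem hom_F : K.vert K.y η.F = η.F := by
  rw [F, map_add, hom_α, η.hom_b]

theorem two_F_P : 2 * η.F * η.P = η.r00 - 2 * η.α * η.s0 := by
  have h : 2 * η.P = η.e00 * η.Fi - 2 * η.s0 := by rw [P]; algebra
  have := η.F_inv
  rw [FiberForm.e00] at h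
  rw [F]
  linear_combination (η.α + η.β) * h + (η.r00 + 2 * η.β * η.s0) * η.F_inv

/-- The vertical part `2Gⁱ ∂/∂yⁱ` of the spray of a Randers metric in terms of the derivation along the
spray of `α`. -/
theorem vert_G (f : A) :
    2 * K.vert η.G f = K.euler f - g.geo f + 2 * η.α * K.vert η.S0 f
      + 2 * η.P * K.vert K.y f := by
  have : K.vert η.G f = K.vert g.spray f + η.α * K.vert η.S0 f + η.P * K.vert K.y f := by
    rw [show η.G = fun i => (g.spray i + η.α * η.S0 i) + η.P * K.y i from rfl, K.vert_add,
      K.vert_add, K.vert_mul, K.vert_mul]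
  rw [this, g.geo_eq]
  ring

/-- The spray of a Randers metric preserves the metric. -/
theorem vert_G_F : 2 * K.vert η.G η.F = K.euler η.F := by
  rw [vert_G, geo_F, hom_F]
  have h : K.vert η.S0 η.F = η.s0 := by rw [F, map_add, vert_S0_α, η.vert_S0_β, zero_add]
  rw [h]
  linear_combination η.two_F_P

/-- The Euler–Lagrange equation of `F` along its spray. -/
theorem vert_G_Y_F (l : Fin n) :
    2 * K.vert η.G (K.Y l η.F) = K.euler (K.Y l η.F) - K.X l η.F := by
  have h0 : K.vert K.y (K.Y l η.F) = 0 := by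
    have := FiberCalculus.IsHom.Y K (k := 0) (f := η.F) (by simp [FiberCalculus.IsHom, hom_F]) l
    simpa [FiberCalculus.IsHom] using this
  have h1 : K.vert η.S0 (K.Y l η.F) = η.αi * η.sy l := by
    have h2 : K.vert η.S0 (g.flat K.y l) = η.sy l := by
      rw [← η.flat_S0]
      simp only [K.vert_apply, g.Y_flat_y]; simp [FiberMetric.flat, mul_comm]
    rw [F, map_add, map_add, η.Y_β, K.vert_basic _ (η.b_basic l), Y_α, Derivation.leibniz,
      derivation_αi, vert_S0_α, h2]
    simp
  have h3 := g.Y_geo l η.F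
  rw [geo_F, η.Y_r00] at h3
  have h4 : g.hor l η.F = g.hor l η.β := by rw [F, map_add, hor_α, zero_add]
  have h5 := g.hor_apply l η.F
  rw [K.vert_apply] at h5
  rw [vert_G, h0, h1]
  linear_combination 2 * η.sy l * η.α_inv + h3 - h5 + 2 * h4

/-- The Euler–Lagrange equation of `F²`, which characterizes the geodesic coefficients of `F`. -/
theorem vert_G_Y_energy (l : Fin n) :
    2 * K.vert η.G (K.Y l (η.F ^ 2)) = K.euler (K.Y l (η.F ^ 2)) - K.X l (η.F ^ 2) := by
  have hd (d : Derivation ℝ A A) : d (η.F ^ 2) = 2 * (η.F * d η.F) := by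
    rw [pow_two, Derivation.leibniz, smul_eq_mul]; ring
  have hd2 (d : Derivation ℝ A A) (f : A) : d (2 * f) = 2 * d f := by simp only [two_mul, map_add]
  simp only [hd, hd2, Derivation.leibniz, smul_eq_mul]
  linear_combination 2 * η.F * η.vert_G_Y_F l + 2 * K.Y l η.F * η.vert_G_F

end FiberRanders

end
end RandersSoliton

namespace RandersSoliton
noncomputable section
open Finset

/-! ### The Ricci curvature of a Randers metric -/

namespace FiberMetric
variable {n : ℕ} {A : Type*} [CommRing A] [Algebra ℝ A] {K : FiberCalculus n A}
  (g : FiberMetric K)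

theorem hdiv_add (W Z : Fin n → A) : g.hdiv (fun i => W i + Z i) = g.hdiv W + g.hdiv Z := by
  simp only [hdiv, map_add, mul_add, sum_add_distrib]; ring

theorem hdiv_mul (f : A) (W : Fin n → A) :
    g.hdiv (fun i => f * W i) = f * g.hdiv W + ∑ i, W i * g.hor i f := by
  simp only [hdiv, Derivation.leibniz, smul_eq_mul, mul_sum, mul_add, sum_add_distrib,
    mul_left_comm f]
  ring

theorem hdiv_y : g.hdiv K.y = 0 := by
  simp only [hdiv, hor_y, sum_add_distrib, conn, sum_neg_distrib]; ring

end FiberMetric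

namespace FiberForm
variable {n : ℕ} {A : Type*} [CommRing A] [Algebra ℝ A] {K : FiberCalculus n A}
  {g : FiberMetric K} (η : FiberForm g)

theorem sum_sm : ∑ i, η.sm i i = 0 := by
  apply two_mul_cancel
  have : ∑ i, η.sm i i = ∑ i, - η.sm i i := by
    simp only [sm, FiberMetric.sharp, ← sum_neg_distrib]
    conv_lhs => rw [sum_comm]
    exact sum_congr rfl fun i _ => sum_congr rfl fun j _ => by
      rw [η.s_antisymm, g.ai_symm]; ring
  simp only [sum_neg_distrib] at this
  linear_combination this

theorem sum_sm_flat_y (j : Fin n) : ∑ i, η.sm i j * g.flat K.y i = - η.sy j := by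
  simp only [sm]
  rw [g.sum_sharp_mul, sy, ← sum_neg_distrib]
  refine sum_congr rfl fun i _ => ?_
  rw [g.sharp_flat, η.s_antisymm]; ring

/-- `s_{0;0} = s_{i;j} yⁱ yʲ` -/
def s00 : A := g.geo η.s0

/-- `t₀ = sᵢ sⁱ₀` -/
def t0 : A := K.vert η.S0 η.s0

end FiberForm

namespace FiberRanders
variable {n : ℕ} {A : Type*} [CommRing A] [Algebra ℝ A] {K : FiberCalculus n A}
  {g : FiberMetric K} (η : FiberRanders g)

theorem vtr_α_S0 : K.vtr (fun i => η.α * η.S0 i) = 0 := by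
  simp only [FiberCalculus.vtr, Derivation.leibniz, smul_eq_mul, Y_α, η.Y_S0, sum_add_distrib,
    ← mul_sum, η.sum_sm]
  have : ∑ i, η.S0 i * (η.αi * g.flat K.y i) = η.αi * ∑ i, η.S0 i * g.flat K.y i := by
    rw [mul_sum]; exact sum_congr rfl fun i _ => by ring
  rw [this, η.sum_S0_flat_y]; simp

theorem sum_Y_α_S0 : ∑ i, ∑ j, K.Y j (η.α * η.S0 i) * K.Y i (η.α * η.S0 j)
    = 2 * η.t00 + η.α ^ 2 * η.ttr := by
  have e : ∀ i j, K.Y j (η.α * η.S0 i) * K.Y i (η.α * η.S0 j)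
      = η.α ^ 2 * (η.sm i j * η.sm j i) + (η.α * η.αi) * (η.S0 j * (η.sm i j * g.flat K.y i))
        + (η.α * η.αi) * (η.S0 i * (η.sm j i * g.flat K.y j))
        + η.αi ^ 2 * ((η.S0 i * g.flat K.y i) * (η.S0 j * g.flat K.y j)) := by
    intro i j
    simp only [Derivation.leibniz, smul_eq_mul, Y_α, η.Y_S0]
    ring
  have h1 : ∑ i, ∑ j, η.S0 j * (η.sm i j * g.flat K.y i) = η.t00 := by
    rw [sum_comm]
    simp only [← mul_sum, η.sum_sm_flat_y]
    rw [FiberForm.t00, ← sum_neg_distrib]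
    exact sum_congr rfl fun i _ => by ring
  have h2 : ∑ i, ∑ j, η.S0 i * (η.sm j i * g.flat K.y j) = η.t00 := by
    rw [sum_comm, h1]
  simp only [e, sum_add_distrib]
  have h3 : ∑ i, η.S0 i * ∑ j, η.sm j i * g.flat K.y j = η.t00 := by simp only [mul_sum, h2]
  simp only [η.α_inv, one_mul, h1, ← mul_sum, h3, η.sum_S0_flat_y, FiberForm.ttr]
  simp
  ring

theorem hdiv_α_S0 : g.hdiv (fun i => η.α * η.S0 i) = η.α * g.hdiv η.S0 := by
  simp [g.hdiv_mul, hor_α]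

/-- The derivation `yᵏ δₖ - 2α sⁱ₀ ∂/∂yⁱ` along the spray of `F`, without the projective part
`-2P yⁱ ∂/∂yⁱ`. -/
def rgeo : Derivation ℝ A A := g.geo - (2 * η.α) • K.vert η.S0

theorem rgeo_apply (f : A) : η.rgeo f = g.geo f - 2 * η.α * K.vert η.S0 f := rfl

theorem hom_Fi : K.vert K.y η.Fi = - η.Fi := by
  rw [derivation_Fi, hom_F]
  have := η.F_inv
  rw [F]
  linear_combination -η.Fi * this

theorem hom_r00 : K.vert K.y η.r00 = 2 * η.r00 := by
  rw [FiberForm.r00, g.hom_geo, η.hom_b]; ring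

theorem hom_e00 : K.vert K.y η.e00 = 2 * η.e00 := by
  simp only [FiberForm.e00, map_add, Derivation.leibniz, hom_r00, η.hom_b, η.hom_s0, smul_eq_mul,
    derivation_two]
  ring

theorem two_P : 2 * η.P = η.e00 * η.Fi - 2 * η.s0 := by rw [P]; algebra

theorem hom_P : K.vert K.y η.P = η.P := by
  apply two_mul_cancel
  rw [← derivation_two_mul, two_P, map_sub, derivation_two_mul, Derivation.leibniz, hom_e00, hom_Fi,
    η.hom_s0]
  simp only [smul_eq_mul]; ring

/-- The Ricci curvature of a Randers metric. -/
theorem ric_G : K.ric η.G = K.ric g.spray + 2 * η.α * g.hdiv η.S0 - 2 * η.t00 - g.en * η.ttr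
    + ((n : A) - 1) * (η.P ^ 2 - η.rgeo η.P) := by
  have h := K.ric_projective (fun i => g.spray i + η.α * η.S0 i) η.P ?_ ?_
  · rw [show η.G = fun i => (g.spray i + η.α * η.S0 i) + η.P * K.y i from rfl, h,
      g.ric_spray_add _ η.vtr_α_S0, hdiv_α_S0, sum_Y_α_S0, K.vert_add, K.vert_mul, rgeo_apply,
      g.geo_eq, ← η.α_sq]
    ring
  · intro i
    rw [FiberCalculus.IsHom, map_add, g.hom_spray, Derivation.leibniz, hom_α, η.hom_S0]
    simp; ring
  · rw [FiberCalculus.IsHom, hom_P]; simp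

theorem rgeo_F : η.rgeo η.F = 2 * η.F * η.P := by
  rw [rgeo_apply, geo_F, F, map_add, vert_S0_α, η.vert_S0_β, ← F, two_F_P]; ring

theorem rgeo_s0 : η.rgeo η.s0 = η.s00 - 2 * η.α * η.t0 := rfl

/-- The equation `2FP = e₀₀ - 2F s₀`, which defines `P` without a division. -/
theorem two_F_P' : 2 * η.F * η.P = η.e00 - 2 * η.F * η.s0 := by
  rw [two_F_P, FiberForm.e00, F]; ring

/-- The projective factor, cleared of denominators. -/
theorem four_F_sq_mul : 4 * η.F ^ 2 * (η.P ^ 2 - η.rgeo η.P)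
    = 3 * η.e00 ^ 2 - 8 * η.F * η.e00 * η.s0 + 4 * η.F ^ 2 * η.s0 ^ 2
      - 2 * η.F * η.rgeo η.e00 + 4 * η.F ^ 2 * (η.s00 - 2 * η.α * η.t0) := by
  have h1 := congrArg η.rgeo η.two_F_P'
  simp only [map_sub, mul_assoc, derivation_two_mul] at h1
  simp only [Derivation.leibniz, smul_eq_mul, rgeo_F, rgeo_s0] at h1
  have h2 := η.two_F_P'
  linear_combination -2 * η.F * h1
    + (3 * (2 * η.F * η.P + η.e00 - 2 * η.F * η.s0) + 4 * η.F * η.s0) * h2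

/-- The condition `e₀₀ = 2σ(α² - β²)`. It is equivalent to isotropic S-curvature `(n + 1) σ F`. -/
def IsotropicS (σ : A) : Prop := η.e00 = 2 * σ * (g.en - η.β ^ 2)

variable {η} in
theorem IsotropicS.P_eq {σ : A} (h : η.IsotropicS σ) : η.P = σ * (η.α - η.β) - η.s0 := by
  apply η.F_cancel
  apply two_mul_cancel
  have h2 := η.two_F_P'
  rw [h, ← η.α_sq, F] at h2
  rw [F]
  linear_combination h2

variable {η} in
/-- If `e₀₀ = 2σ(α² - β²)`, then `P = σ(α - β) - s₀` has no denominator, and the Ricci curvature of `F` is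
a polynomial in `y` plus `α` times a polynomial. -/
theorem IsotropicS.ric_G {σ : A} (hσ : K.IsBasic σ) (h : η.IsotropicS σ) :
    K.ric η.G = (K.ric g.spray - 2 * η.t00 - g.en * η.ttr
        + ((n : A) - 1) * (σ ^ 2 * (3 * g.en - η.β ^ 2) + η.s0 ^ 2 + g.geo σ * η.β + η.s00))
      + η.α * (2 * g.hdiv η.S0 + ((n : A) - 1) *
        (-2 * σ ^ 2 * η.β - 4 * σ * η.s0 - g.geo σ - 2 * η.t0)) := by
  have h1 : η.rgeo σ = g.geo σ := by rw [rgeo_apply, K.vert_basic _ hσ]; ring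
  have h2 : η.rgeo η.α = 0 := by rw [rgeo_apply, geo_α, vert_S0_α]; ring
  have h3 : η.rgeo η.β = 2 * (η.α + η.β) * η.P := by
    rw [← F, ← rgeo_F, F, map_add, h2, zero_add]
  have h4 : η.rgeo η.P = g.geo σ * (η.α - η.β) - σ * (2 * (η.α + η.β) * η.P)
      - (η.s00 - 2 * η.α * η.t0) := by
    conv_lhs => rw [h.P_eq]
    simp only [map_sub, Derivation.leibniz, smul_eq_mul, h1, h2, h3, rgeo_s0]
    ring
  rw [FiberRanders.ric_G, h4, h.P_eq, ← η.α_sq]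
  ring

end FiberRanders

end
end RandersSoliton

namespace RandersSoliton
noncomputable section
open Finset

/-! ### The Ricci identity and divergences -/

namespace FiberMetric
variable {n : ℕ} {A : Type*} [CommRing A] [Algebra ℝ A] {K : FiberCalculus n A}
  (g : FiberMetric K)

/-- The covariant derivative `∇_y W` of a vector field. -/
def covy (W : Fin n → A) (i : Fin n) : A := g.geo (W i) + ∑ j, g.conn i j * W j

/-- The derivation `∇_W = Wᵏ δₖ`. -/
def horAlong (W : Fin n → A) (f : A) : A := ∑ k, W k * g.hor k f

/-- Leibniz rule for the contraction of the derivative of `f` with `W`. -/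
theorem geo_vert (W : Fin n → A) (f : A) :
    g.geo (K.vert W f) = K.vert (g.covy W) f + K.vert W (g.geo f) - g.horAlong W f := by
  have h : ∀ l, g.geo (K.Y l f) = K.Y l (g.geo f) - g.hor l f + ∑ m, g.conn m l * K.Y m f := by
    intro l; rw [Y_geo]; ring
  simp only [K.vert_apply, covy, horAlong, map_sum, Derivation.leibniz, smul_eq_mul, h, mul_add,
    mul_sub, add_mul, sum_add_distrib, sum_sub_distrib]
  have e : ∑ i, W i * ∑ m, g.conn m i * K.Y m f = ∑ i, (∑ j, g.conn i j * W j) * K.Y i f := by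
    simp only [mul_sum, sum_mul]
    rw [sum_comm]
    exact sum_congr rfl fun i _ => sum_congr rfl fun j _ => by ring
  rw [e]
  simp only [mul_comm (g.geo _)]
  ring

theorem geo_a (l k : Fin n) :
    g.geo (g.a l k) = g.flat (fun i => g.conn i k) l + g.flat (fun i => g.conn i l) k := by
  rw [flat_conn, flat_conn, ← sum_add_distrib, geo_apply]
  refine sum_congr rfl fun j _ => ?_
  rw [g.hor_basic (g.a_basic _ _), g.X_a]; ring

/-- The geodesic covariant derivative commutes with lowering. -/
theorem flat_covy (W : Fin n → A) (l : Fin n) :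
    g.flat (g.covy W) l = g.geo (g.flat W l) - ∑ m, g.conn m l * g.flat W m := by
  have h1 : g.geo (g.flat W l) = ∑ k, g.geo (g.a l k) * W k + ∑ k, g.a l k * g.geo (W k) := by
    simp only [flat, map_sum, Derivation.leibniz, smul_eq_mul, sum_add_distrib]
    rw [add_comm]
    congr 1
    exact sum_congr rfl fun j _ => by ring
  have h2 : ∑ k, g.geo (g.a l k) * W k
      = ∑ k, g.a l k * ∑ j, g.conn k j * W j + ∑ m, g.conn m l * g.flat W m := by
    simp only [geo_a, add_mul, sum_add_distrib, flat, mul_sum, sum_mul]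
    congr 1
    · rw [sum_comm]
      exact sum_congr rfl fun i _ => sum_congr rfl fun j _ => by ring
    · rw [sum_comm]
      exact sum_congr rfl fun i _ => sum_congr rfl fun j _ => by rw [g.a_symm]; ring
  have h3 : g.flat (g.covy W) l = ∑ k, g.a l k * g.geo (W k) + ∑ k, g.a l k * ∑ j, g.conn k j * W j := by
    simp only [flat, covy, mul_add, sum_add_distrib]
  rw [h3, h1, h2]; ring

/-- `Γⁱᵢⱼ` -/
def chrTr (j : Fin n) : A := ∑ i, g.chr i i j

theorem chrTr_basic (j : Fin n) : K.IsBasic (g.chrTr j) := fun m => by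
  simp only [chrTr, map_sum]
  exact sum_eq_zero fun i _ => g.chr_basic _ _ _ m

theorem two_chrTr (k : Fin n) : 2 * g.chrTr k = ∑ i, ∑ l, g.ai i l * K.X k (g.a i l) := by
  have h1 : 2 * g.chrTr k = ∑ i, ∑ l, g.ai i l * (K.X k (g.a i l) + (K.X i (g.a l k) - K.X l (g.a i k))) := by
    simp only [chrTr, chr, sharp, chrL, mul_sum]
    refine sum_congr rfl fun i _ => sum_congr rfl fun l _ => ?_
    rw [g.a_symm l i]
    algebra
  have h2 : ∑ i, ∑ l, g.ai i l * K.X i (g.a l k) = ∑ i, ∑ l, g.ai i l * K.X l (g.a i k) := by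
    rw [sum_comm]
    exact sum_congr rfl fun i _ => sum_congr rfl fun j _ => by rw [g.ai_symm]
  rw [h1]
  simp only [mul_add, mul_sub, sum_add_distrib, sum_sub_distrib, h2]
  ring

theorem X_ai (j i l : Fin n) :
    K.X j (g.ai i l) = - ∑ p, ∑ q, g.ai i p * K.X j (g.a p q) * g.ai q l := by
  have h1 : ∀ k, ∑ m, K.X j (g.ai i m) * g.a m k = - ∑ p, g.ai i p * K.X j (g.a p k) := by
    intro k
    have h := congrArg (K.X j) (g.ai_a i k)
    simp only [map_sum, Derivation.leibniz, smul_eq_mul, sum_add_distrib] at h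
    have h0 : K.X j (if i = k then (1 : A) else 0) = 0 := by split_ifs <;> simp
    rw [h0] at h
    simp only [mul_comm (K.X j (g.ai i _))]
    linear_combination h
  have h2 : K.X j (g.ai i l) = ∑ k, (∑ m, K.X j (g.ai i m) * g.a m k) * g.ai k l := by
    simp only [sum_mul]
    rw [sum_comm]
    simp only [mul_assoc, ← mul_sum, g.a_ai]
    simp
  rw [h2]
  simp only [h1, neg_mul, sum_neg_distrib, sum_mul]
  rw [sum_comm]

/-- `Γⁱᵢⱼ = ∂ⱼ log √det a` is a closed 1-form. -/
theorem X_chrTr (j k : Fin n) : K.X j (g.chrTr k) = K.X k (g.chrTr j) := by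
  have h : ∀ j k, K.X j (2 * g.chrTr k)
      = ∑ i, ∑ l, g.ai i l * K.X j (K.X k (g.a i l))
        - ∑ i, ∑ l, ∑ p, ∑ q, g.ai i p * K.X j (g.a p q) * g.ai q l * K.X k (g.a i l) := by
    intro j k
    rw [two_chrTr]
    simp only [map_sum, Derivation.leibniz, smul_eq_mul, X_ai, sum_add_distrib,
      mul_comm (K.X k _)]
    simp only [neg_mul, sum_neg_distrib, sum_mul, sub_eq_add_neg]
  have h2 : ∀ j k, ∑ i, ∑ l, ∑ p, ∑ q, g.ai i p * K.X j (g.a p q) * g.ai q l * K.X k (g.a i l)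
      = ∑ p, ∑ q, ∑ i, ∑ l, g.ai p i * K.X k (g.a i l) * g.ai l q * K.X j (g.a p q) := by
    intro j k
    have : ∀ i, ∑ l, ∑ p, ∑ q, g.ai i p * K.X j (g.a p q) * g.ai q l * K.X k (g.a i l)
        = ∑ p, ∑ q, ∑ l, g.ai i p * K.X j (g.a p q) * g.ai q l * K.X k (g.a i l) := by
      intro i
      rw [sum_comm]
      exact sum_congr rfl fun p _ => sum_comm
    simp only [this]
    rw [sum_comm]
    refine sum_congr rfl fun p _ => ?_
    rw [sum_comm]
    refine sum_congr rfl fun q _ => sum_congr rfl fun i _ => sum_congr rfl fun l _ => ?_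
    rw [g.ai_symm i p, g.ai_symm q l]
    ring
  apply two_mul_cancel
  have e1 := h j k
  have e2 := h k j
  rw [h2] at e1
  rw [derivation_two_mul] at e1 e2
  rw [e1, e2]
  simp only [K.XX j k]

/-- The contracted Ricci identity `∇ᵢ∇_y Wⁱ - ∇_y ∇ᵢ Wⁱ = Ric(W, y)`; as `Ric` is quadratic in `y`, the
polar form `Ric(W, y)` is `½ Wⁱ ∂Ric/∂yⁱ`. -/
theorem hdiv_covy (W : Fin n → A) (hW : ∀ i, K.IsBasic (W i)) :
    2 * g.hdiv (g.covy W) = K.vert W (K.ric g.spray) + 2 * g.geo (g.hdiv W) := by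
  -- the Ricci tensor contracted once with `y`
  let ρ : Fin n → A := fun k => ∑ i, g.hor i (g.conn i k) + ∑ j, g.chrTr j * g.conn j k
    - g.geo (g.chrTr k)
  have hsw : ∀ u : Fin n → A, ∑ i, ∑ j, g.chr i i j * u j = ∑ j, g.chrTr j * u j := by
    intro u
    rw [sum_comm]
    simp only [chrTr, sum_mul]
  have h1 : g.hdiv (g.covy W) = ∑ k, W k * ρ k + g.geo (g.hdiv W) := by
    have hc : ∀ i, g.hor i (g.geo (W i)) = g.geo (K.X i (W i)) - ∑ k, g.conn k i * K.X k (W i) := by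
      intro i
      simp only [geo_apply, map_sum, Derivation.leibniz, smul_eq_mul, hor_y,
        g.hor_basic (hW _), g.hor_basic ((hW _).X K _), sum_add_distrib, K.XX i]
      simp only [mul_comm (K.X _ (W i)), neg_mul, sum_neg_distrib]
      ring
    have hb : ∑ i, ∑ j, g.conn i j * K.X i (W j) = ∑ i, ∑ k, g.conn k i * K.X k (W i) := sum_comm
    have hd : ∑ i, ∑ j, W j * g.hor i (g.conn i j) = ∑ k, W k * ∑ i, g.hor i (g.conn i k) := by
      rw [sum_comm]; simp only [mul_sum]
    have he : ∑ j, g.chrTr j * ∑ k, g.conn j k * W k = ∑ k, W k * ∑ j, g.chrTr j * g.conn j k := by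
      simp only [mul_sum]
      rw [sum_comm]
      exact sum_congr rfl fun i _ => sum_congr rfl fun j _ => by ring
    simp only [hdiv, hsw, sum_add_distrib, covy, map_add, map_sum, Derivation.leibniz, smul_eq_mul,
      hc, mul_add, g.hor_basic (hW _), sum_sub_distrib, hb, hd, he, ρ, mul_sub]
    simp only [mul_comm (W _) (g.geo _)]
    ring
  have h2 : ∀ k, K.Y k (K.ric g.spray) = 2 * ρ k := by
    intro k
    have ht : K.vtr g.spray = ∑ j, g.chrTr j * K.y j := by
      rw [vtr_spray]
      simp only [conn]
      rw [hsw]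
    have hYt : ∀ k, K.Y k (∑ j, g.chrTr j * K.y j) = g.chrTr k := by
      intro k
      simp [K.Y_y, g.chrTr_basic _ k]
    have hr : K.ric g.spray = 2 * ∑ i, K.X i (g.spray i) - g.geo (∑ j, g.chrTr j * K.y j)
        - ∑ i, ∑ j, g.conn i j * g.conn j i := by
      rw [FiberCalculus.ric, ht, g.geo_eq]
      simp only [Y_spray]; ring
    have h3 : g.hor k (∑ j, g.chrTr j * K.y j)
        = ∑ j, K.y j * K.X k (g.chrTr j) - ∑ m, g.chrTr m * g.conn m k := by
      simp only [map_sum, Derivation.leibniz, smul_eq_mul, hor_y, g.hor_basic (g.chrTr_basic _),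
        sum_add_distrib, mul_neg, sum_neg_distrib]
      ring
    have h4 : g.geo (g.chrTr k) = ∑ j, K.y j * K.X k (g.chrTr j) := by
      simp only [geo_apply, g.hor_basic (g.chrTr_basic _), g.X_chrTr k]
    have h5 : ∑ i, g.hor i (g.conn i k)
        = ∑ i, K.X i (g.conn i k) - ∑ i, ∑ j, g.conn j i * g.chr i k j := by
      simp only [hor_apply, sum_sub_distrib, K.vert_apply, Y_conn]
    have h6 : ∑ i, ∑ j, K.Y k (g.conn i j * g.conn j i) = 2 * ∑ i, ∑ j, g.conn j i * g.chr i k j := by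
      have e : ∑ i, ∑ j, g.conn i j * g.chr j i k = ∑ i, ∑ j, g.conn j i * g.chr i k j := by
        rw [sum_comm]
        exact sum_congr rfl fun i _ => sum_congr rfl fun j _ => by rw [g.chr_symm i]
      simp only [Derivation.leibniz, smul_eq_mul, Y_conn, sum_add_distrib, e]
      simp only [g.chr_symm _ _ k]
      ring
    rw [hr]
    simp only [map_sub, derivation_two_mul, map_sum (K.Y k), h6, ← K.XY, Y_spray]
    rw [Y_geo, hYt, h3]
    simp only [hYt, ρ, h5]
    simp only [mul_comm (g.conn _ k)]
    linear_combination h4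
  rw [h1, K.vert_apply]
  simp only [h2, mul_sum, mul_add]
  congr 1
  exact sum_congr rfl fun i _ => by ring

/-- Leibniz rule for the divergence of `Wʲ ∂Zⁱ/∂yʲ`, the contraction of the field `Z` with `W`. -/
theorem hdiv_vert (W Z : Fin n → A) (hW : ∀ i, K.IsBasic (W i)) :
    g.hdiv (fun i => K.vert W (Z i))
      = K.vert W (g.hdiv Z) + ∑ i, ∑ j, K.Y i (g.covy W j) * K.Y j (Z i) := by
  have h1 : ∀ i j, K.Y i (g.covy W j) = K.X i (W j) + ∑ k, g.chr j k i * W k := by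
    intro i j
    have : K.Y i (g.geo (W j)) = K.X i (W j) := by
      rw [Y_geo, hW j i, g.hor_basic (hW j)]
      simp [hW j _]
    simp only [covy, map_add, this, map_sum, Derivation.leibniz, smul_eq_mul, Y_conn, hW _ i,
      mul_zero, zero_add]
    congr 1
    exact sum_congr rfl fun _ _ => mul_comm _ _
  have h2 : ∀ i f, g.hor i (K.vert W f)
      = K.vert W (g.hor i f) + ∑ j, K.Y i (g.covy W j) * K.Y j f := by
    intro i f
    have e : ∑ j, W j * ∑ m, g.chr m j i * K.Y m f = ∑ j, (∑ k, g.chr j k i * W k) * K.Y j f := by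
      simp only [mul_sum, sum_mul]
      rw [sum_comm]
      exact sum_congr rfl fun i _ => sum_congr rfl fun j _ => by ring
    simp only [K.vert_apply, map_sum, Derivation.leibniz, smul_eq_mul, h1, add_mul, ← e,
      sum_add_distrib, Y_hor, mul_sub, sum_sub_distrib, g.hor_basic (hW _)]
    simp only [mul_comm (K.Y _ f)]
    ring
  simp only [hdiv, h2, map_add, map_sum, Derivation.leibniz, smul_eq_mul,
    K.vert_basic W (g.chr_basic _ _ _), sum_add_distrib]
  simp
  ring

end FiberMetric

end
end RandersSoliton

namespace RandersSoliton
noncomputable section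
open Finset

/-! ### The condition `e₀₀ = 2σ(α² - β²)` -/

namespace FiberForm
variable {n : ℕ} {A : Type*} [CommRing A] [Algebra ℝ A] {K : FiberCalculus n A}
  {g : FiberMetric K} (η : FiberForm g)

/-- `‖β‖² = bᵢ bⁱ` -/
def q : A := ∑ i, η.b i * η.B i

/-- `sⁱ = a^{ij} sⱼ` -/
def ss : Fin n → A := g.sharp η.s1

theorem q_basic : K.IsBasic η.q := fun m => by
  simp only [q, map_sum, Derivation.leibniz]
  simp [η.b_basic _ m, η.B_basic _ m]

theorem ss_basic (i : Fin n) : K.IsBasic (η.ss i) := fun m => by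
  simp only [ss, FiberMetric.sharp, map_sum, Derivation.leibniz]
  simp [g.ai_basic _ _ m, η.s1_basic _ m]

theorem flat_B (l : Fin n) : g.flat η.B l = η.b l := g.flat_sharp _ _

theorem flat_ss (l : Fin n) : g.flat η.ss l = η.s1 l := g.flat_sharp _ _

theorem sum_s1_B : ∑ i, η.s1 i * η.B i = 0 := by
  have := η.sum_s_mul_self η.B
  rw [sum_comm] at this
  rw [← this]
  refine sum_congr rfl fun j _ => ?_
  rw [s1, sum_mul]
  exact sum_congr rfl fun i _ => by ring

theorem sum_b_ss : ∑ i, η.b i * η.ss i = 0 := by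
  rw [ss, ← g.sum_sharp_mul, ← η.sum_s1_B]
  exact sum_congr rfl fun i _ => mul_comm _ _

theorem vert_B_β : K.vert η.B η.β = η.q := η.vert_β _

theorem vert_s0 (W : Fin n → A) : K.vert W η.s0 = ∑ i, η.s1 i * W i := by
  simp only [K.vert_apply, Y_s0, mul_comm]

theorem vert_B_s0 : K.vert η.B η.s0 = 0 := by rw [vert_s0, sum_s1_B]

theorem vert_ss_β : K.vert η.ss η.β = 0 := by rw [vert_β, sum_b_ss]

theorem vert_B_en : K.vert η.B g.en = 2 * η.β := by
  rw [g.vert_en, ← g.sum_flat_mul]; simp only [flat_B]; rfl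

theorem vert_ss_en : K.vert η.ss g.en = 2 * η.s0 := by
  rw [g.vert_en, ← g.sum_flat_mul]; simp only [flat_ss]; rfl

theorem sum_s0_ss : ∑ i, η.ss i * η.sy i = η.t0 := by
  rw [ss, g.sum_sharp_mul, t0, vert_s0]; rfl

/-- The covariant derivative of `B` along `y`, lowered: `b_{i;0} = r_{i0} + s_{i0}`. -/
theorem flat_covy_B (l : Fin n) : 2 * g.flat (g.covy η.B) l = K.Y l η.r00 + 2 * η.sy l := by
  rw [g.flat_covy]
  have h := g.Y_geo l η.β
  have h2 := η.Y_r00 l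
  simp only [Y_β] at h
  simp only [flat_B]
  rw [r00] at h2 ⊢
  linear_combination h2 - 2 * h

theorem horAlong_β (W : Fin n → A) :
    2 * g.horAlong W η.β = K.vert W η.r00 - 2 * ∑ i, W i * η.sy i := by
  simp only [FiberMetric.horAlong, K.vert_apply, mul_sum, ← sum_sub_distrib]
  exact sum_congr rfl fun i _ => by rw [Y_r00]; ring

/-- A closed form has symmetric covariant derivative. -/
theorem Y_geo_of_closed (hc : ∀ i j, K.X i (η.b j) = K.X j (η.b i)) (l : Fin n) :
    K.Y l (g.geo η.β) = 2 * g.hor l η.β := by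
  have := η.Y_r00 l
  have hs : η.sy l = 0 := by
    rw [sy]
    refine sum_eq_zero fun j _ => ?_
    rw [s, hc, sub_self]; simp
  rw [hs] at this
  rw [r00] at this
  linear_combination this

theorem vert_B_S0 (i : Fin n) : K.vert η.B (η.S0 i) = - η.ss i := by
  simp only [K.vert_apply, Y_S0, sm, ss, FiberMetric.sharp, mul_sum, ← sum_neg_distrib, s1]
  rw [sum_comm]
  refine sum_congr rfl fun l _ => sum_congr rfl fun j _ => ?_
  rw [η.s_antisymm]; ring

theorem sum_b_sm (j : Fin n) : ∑ i, η.b i * η.sm i j = η.s1 j := by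
  simp only [sm, s1]
  rw [← g.sum_sharp_mul]; rfl

theorem sum_sm_B (i : Fin n) : ∑ j, η.sm i j * η.B j = - η.ss i := by
  rw [← vert_B_S0]; simp only [K.vert_apply, Y_S0, mul_comm]

end FiberForm

/-- A 1-form with `e₀₀ = 2σ(α² - β²)` for a function `σ(x)`, and with `1 - ‖β‖²` invertible. -/
structure FiberIsotropic {n : ℕ} {A : Type*} [CommRing A] [Algebra ℝ A] {K : FiberCalculus n A}
    (g : FiberMetric K) extends FiberForm g where
  /-- The factor `σ`. -/
  σ : A
  /-- `1 / (1 - ‖β‖²)` -/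
  qi : A
  σ_basic : K.IsBasic σ
  q_inv : (1 - toFiberForm.q) * qi = 1
  e00_eq : toFiberForm.e00 = 2 * σ * (g.en - toFiberForm.β ^ 2)

namespace FiberIsotropic
variable {n : ℕ} {A : Type*} [CommRing A] [Algebra ℝ A] {K : FiberCalculus n A}
  {g : FiberMetric K} (η : FiberIsotropic g)

theorem r00_eq : η.r00 = 2 * (η.σ * (g.en - η.β * η.β) - η.β * η.s0) := by
  have := η.e00_eq
  rw [FiberForm.e00] at this
  linear_combination this

theorem q_cancel {f h : A} (e : (1 - η.q) * f = (1 - η.q) * h) : f = h := by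
  linear_combination η.qi * e + (h - f) * η.q_inv

theorem vert_r00 (W : Fin n → A) : K.vert W η.r00 = 2 * (η.σ * (K.vert W g.en
    - 2 * η.β * K.vert W η.β) - η.β * K.vert W η.s0 - η.s0 * K.vert W η.β) := by
  rw [r00_eq, derivation_two_mul]
  simp only [map_sub, Derivation.leibniz, smul_eq_mul, K.vert_basic W η.σ_basic]
  ring

theorem Y_r00_eq (l : Fin n) : K.Y l η.r00 = 2 * (η.σ * (2 * g.flat K.y l
    - 2 * η.β * η.b l) - η.β * η.s1 l - η.s0 * η.b l) := by
  rw [r00_eq, derivation_two_mul]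
  simp only [map_sub, Derivation.leibniz, smul_eq_mul, η.σ_basic l, g.Y_en, η.Y_β, η.Y_s0]
  ring

/-- The covariant derivative `∇_y bⁱ = 2σ(yⁱ - β bⁱ) - s₀ bⁱ - β sⁱ + sⁱ₀`: the condition on `e₀₀`
determines the symmetric part of `b_{i;j}`. -/
theorem covy_B : g.covy η.B = fun i =>
    2 * η.σ * (K.y i - η.β * η.B i) - η.s0 * η.B i - η.β * η.ss i + η.S0 i := by
  have h : ∀ l, g.flat (g.covy η.B) l = g.flat (fun i =>
      2 * η.σ * (K.y i - η.β * η.B i) - η.s0 * η.B i - η.β * η.ss i + η.S0 i) l := by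
    intro l
    have e : g.flat (fun i =>
      2 * η.σ * (K.y i - η.β * η.B i) - η.s0 * η.B i - η.β * η.ss i + η.S0 i) l
      = 2 * η.σ * (g.flat K.y l - η.β * g.flat η.B l) - η.s0 * g.flat η.B l
        - η.β * g.flat η.ss l + g.flat η.S0 l := by
      simp only [FiberMetric.flat, mul_add, mul_sub, sum_add_distrib, sum_sub_distrib, mul_sum,
        mul_left_comm (g.a l _)]
    apply two_mul_cancel
    rw [e, η.flat_covy_B, η.flat_B, η.flat_ss, η.flat_S0, Y_r00_eq]
    ring
  funext i
  rw [← g.sharp_flat (g.covy η.B), ← g.sharp_flat (fun i =>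
      2 * η.σ * (K.y i - η.β * η.B i) - η.s0 * η.B i - η.β * η.ss i + η.S0 i)]
  rw [funext h]

theorem vert_covy_B (f : A) : K.vert (g.covy η.B) f = 2 * η.σ * (K.vert K.y f - η.β * K.vert η.B f)
    - η.s0 * K.vert η.B f - η.β * K.vert η.ss f + K.vert η.S0 f := by
  rw [covy_B]
  simp only [K.vert_apply, add_mul, sub_mul, mul_sub, sum_add_distrib, sum_sub_distrib, mul_sum,
    mul_assoc]

theorem horAlong_B_β : g.horAlong η.B η.β = 2 * η.σ * η.β * (1 - η.q) - η.q * η.s0 - η.s0 := by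
  apply two_mul_cancel
  rw [η.horAlong_β, vert_r00, η.vert_B_en, η.vert_B_β, η.vert_B_s0, ← η.s0_eq]
  ring

theorem geo_q : g.geo η.q = 2 * ((1 - η.q) * (2 * η.σ * η.β + η.s0)) := by
  rw [← η.vert_B_β, g.geo_vert, vert_covy_B, horAlong_B_β, η.hom_b, η.vert_B_β, η.vert_ss_β,
    η.vert_S0_β, ← FiberForm.r00, vert_r00, η.vert_B_en, η.vert_B_β, η.vert_B_s0]
  ring

/-- Equivalently, `d(-½ log(1 - ‖β‖²)) = 2σβ + s`. -/
theorem X_q (i : Fin n) : K.X i η.q = 2 * ((1 - η.q) * (2 * η.σ * η.b i + η.s1 i)) := by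
  have h := congrArg (K.Y i) η.geo_q
  rw [g.Y_geo, η.q_basic i, g.hor_basic η.q_basic, derivation_two_mul] at h
  simp only [Derivation.leibniz, map_add, map_sub, smul_eq_mul, η.q_basic i, η.q_basic _,
    η.σ_basic i, η.Y_β, η.Y_s0, derivation_two] at h
  simp at h
  rw [h]

/-- The 1-form `2σβ + s`, which is the differential of `-½ log(1 - ‖β‖²)`. -/
def potential : FiberForm g where
  b i := 2 * η.σ * η.b i + η.s1 i
  b_basic i m := by
    simp [η.b_basic i m, η.s1_basic i m, η.σ_basic m, derivation_two]

/-- Differentiation of `X_q`, and symmetry of the second derivatives of `‖β‖²`. -/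
theorem potential_closed (i j : Fin n) :
    K.X i (η.potential.b j) = K.X j (η.potential.b i) := by
  have h : ∀ i j, K.X i (K.X j η.q) = 2 * ((1 - η.q) * K.X i (η.potential.b j))
      - 4 * (1 - η.q) * η.potential.b i * η.potential.b j := by
    intro i j
    rw [η.X_q j, derivation_two_mul, Derivation.leibniz, map_sub, η.X_q i]
    simp only [smul_eq_mul, potential]
    simp
    ring
  apply η.q_cancel
  apply two_mul_cancel
  have e1 := h i j
  rw [K.XX, h j i] at e1
  linear_combination -e1

theorem potential_β : η.potential.β = 2 * η.σ * η.β + η.s0 := by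
  simp only [FiberForm.β, potential, FiberForm.s0, add_mul, sum_add_distrib, mul_sum, mul_assoc]

theorem horAlong_leibniz (W : Fin n → A) (f h : A) :
    g.horAlong W (f * h) = f * g.horAlong W h + h * g.horAlong W f := by
  simp only [FiberMetric.horAlong, Derivation.leibniz, smul_eq_mul, mul_add, sum_add_distrib,
    mul_sum, mul_left_comm (W _)]

/-- `‖s‖² = sᵢ sⁱ` -/
def p : A := K.vert η.ss η.s0

theorem vert_covy_B_s0 : K.vert (g.covy η.B) η.s0 = 2 * η.σ * η.s0 - η.β * η.p + η.t0 := by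
  rw [vert_covy_B, η.hom_s0, η.vert_B_s0, FiberForm.t0, p]; ring

/-- `bᵏ ∂σ/∂xᵏ` -/
def σB : A := g.horAlong η.B η.σ

theorem vert_geo_σ (W : Fin n → A) : K.vert W (g.geo η.σ) = g.horAlong W η.σ := by
  have : ∀ i, K.Y i (g.geo η.σ) = g.hor i η.σ := by
    intro i
    rw [g.Y_geo, η.σ_basic i]
    simp [η.σ_basic _]
  simp only [K.vert_apply, this]; rfl

/-- The derivative `bᵏ s_{0;k}`: the potential `2σβ + s` is closed, which exchanges `bᵏ s_{0;k}` with
`bᵏ s_{k;0}`, and `bᵏ sₖ = 0`. -/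
theorem horAlong_B_s0 : g.horAlong η.B η.s0
    = 2 * (η.q * g.geo η.σ - η.β * η.σB) + 2 * η.σ * η.s0 + η.β * η.p - η.t0 := by
  have h1 := g.geo_vert η.B η.potential.β
  have h2 : K.vert η.B (g.geo η.potential.β) = 2 * g.horAlong η.B η.potential.β := by
    simp only [K.vert_apply, FiberMetric.horAlong, mul_sum,
      η.potential.Y_geo_of_closed η.potential_closed]
    exact sum_congr rfl fun i _ => by ring
  have h3 : ∀ W, K.vert W η.potential.β = 2 * (η.σ * K.vert W η.β) + K.vert W η.s0 := by
    intro W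
    rw [potential_β, map_add, mul_assoc, derivation_two_mul, Derivation.leibniz, K.vert_basic W η.σ_basic]
    simp
  have h4 : g.horAlong η.B η.potential.β = 2 * (η.σ * g.horAlong η.B η.β + η.β * η.σB)
      + g.horAlong η.B η.s0 := by
    rw [σB, ← horAlong_leibniz, potential_β, mul_assoc]
    simp only [FiberMetric.horAlong, map_add, derivation_two_mul, mul_add, sum_add_distrib, mul_sum,
      mul_left_comm (η.B _)]
  rw [h2, h3, h3, η.vert_B_β, η.vert_B_s0, h4, horAlong_B_β, vert_covy_B_s0, vert_covy_B,
    η.hom_b, η.vert_B_β, η.vert_ss_β, η.vert_S0_β, add_zero, derivation_two_mul, Derivation.leibniz, geo_q] at h1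
  simp only [smul_eq_mul] at h1
  linear_combination -h1

/-- The contraction `bᵏ (s_{0;k} + s_{k;0})`. -/
theorem vert_B_s00 : K.vert η.B η.s00
    = 2 * (η.q * g.geo η.σ - η.β * η.σB) + 2 * η.β * η.p - 2 * η.t0 := by
  have h := g.geo_vert η.B η.s0
  rw [η.vert_B_s0, map_zero, vert_covy_B_s0, horAlong_B_s0] at h
  rw [FiberForm.s00]
  linear_combination -h

theorem Y_covy_B (i j : Fin n) : K.Y i (g.covy η.B j) = 2 * η.σ * ((if i = j then 1 else 0)
    - η.b i * η.B j) - η.s1 i * η.B j - η.b i * η.ss j + η.sm j i := by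
  simp only [covy_B, map_add, map_sub, Derivation.leibniz, smul_eq_mul, K.Y_y, η.Y_β,
    η.Y_s0, η.Y_S0, η.B_basic j i, η.ss_basic j i, η.σ_basic i, derivation_two]
  ring

theorem hdiv_B : g.hdiv η.B = 2 * η.σ * ((n : A) - η.q) := by
  have h : g.hdiv η.B = ∑ i, K.Y i (g.covy η.B i) := by
    rw [FiberMetric.hdiv]
    have e : ∀ i, K.Y i (g.covy η.B i) = g.hor i (η.B i) + ∑ j, g.chr i i j * η.B j := by
      intro i
      simp only [FiberMetric.covy, map_add, g.Y_geo, η.B_basic i i, map_sum, Derivation.leibniz,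
        smul_eq_mul, η.B_basic _ i, g.Y_conn, η.B_basic i _, g.chr_symm i i]
      simp [mul_comm]
    simp only [e]
  rw [h]
  have e1 : ∑ i, η.b i * η.B i = η.q := rfl
  simp only [Y_covy_B, sum_add_distrib, sum_sub_distrib, ← mul_sum, η.sum_sm, η.sum_s1_B,
    η.sum_b_ss, e1]
  simp

/-- The divergence of `s♯`, from `sⁱ = -sⁱⱼ bʲ`. -/
theorem hdiv_ss : g.hdiv η.ss = - K.vert η.B (g.hdiv η.S0) - η.ttr := by
  have h := g.hdiv_vert η.B η.S0 η.B_basic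
  have h1 : g.hdiv (fun i => K.vert η.B (η.S0 i)) = - g.hdiv η.ss := by
    simp only [η.vert_B_S0]
    have := g.hdiv_mul (-1) η.ss
    simp only [neg_one_mul] at this
    rw [this]; simp
  have h2 : ∑ i, ∑ j, K.Y i (g.covy η.B j) * K.Y j (η.S0 i) = η.ttr := by
    have e : ∀ i j, K.Y i (g.covy η.B j) * K.Y j (η.S0 i)
        = (if i = j then 2 * η.σ * η.sm i j else 0) - 2 * η.σ * η.b i * (η.sm i j * η.B j)
          - η.s1 i * (η.sm i j * η.B j) - η.ss j * (η.b i * η.sm i j)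
          + η.sm i j * η.sm j i := by
      intro i j
      rw [Y_covy_B, η.Y_S0]
      split_ifs <;> ring
    have e2 : ∑ i, ∑ j, η.ss j * (η.b i * η.sm i j) = ∑ j, η.ss j * η.s1 j := by
      rw [sum_comm]; simp only [← mul_sum, η.sum_b_sm]
    have e3 : ∑ i, 2 * η.σ * η.b i * η.ss i = 2 * η.σ * ∑ i, η.b i * η.ss i := by
      rw [mul_sum]; exact sum_congr rfl fun _ _ => by ring
    have e4 : ∑ i, η.s1 i * η.ss i = ∑ i, η.ss i * η.s1 i :=
      sum_congr rfl fun _ _ => mul_comm _ _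
    simp only [e, sum_add_distrib, sum_sub_distrib, e2]
    simp only [← mul_sum, η.sum_sm_B, mul_neg, sum_neg_distrib, e3, η.sum_b_ss, e4]
    simp only [sum_ite_eq, mem_univ, if_true, ← mul_sum, η.sum_sm, FiberForm.ttr]
    ring
  rw [h1, h2] at h
  linear_combination -h

/-- The Ricci identity for `b♯`: with `∇_y b♯` from `covy_B`, the divergence of `∇_y b♯` contains that of
`sⁱ₀`, and `Ric(b♯, y)` is the derivative of `ᵅRic` along `b♯`. -/
theorem hdiv_S0 : 2 * (g.hdiv η.S0 + η.β * K.vert η.B (g.hdiv η.S0)) = K.vert η.B (K.ric g.spray)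
    + 2 * (2 * g.geo η.σ * ((n : A) - 1 - η.q) + 2 * η.σB * η.β
      + 4 * ((n : A) - 1) * η.σ ^ 2 * η.β + (2 * n - 4) * η.σ * η.s0 + g.horAlong η.B η.s0
      - η.β * η.p - η.t0 - η.β * η.ttr) := by
  have h1 := g.hdiv_covy η.B η.B_basic
  have h2 : g.covy η.B = fun i => (((2 * η.σ) * K.y i + (-(2 * η.σ * η.β)) * η.B i)
      + ((-η.s0) * η.B i + (-η.β) * η.ss i)) + η.S0 i := by
    rw [covy_B]; funext i; ring
  have h3 : g.horAlong K.y (2 * η.σ) = 2 * g.geo η.σ := by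
    rw [← derivation_two_mul, g.geo_apply]; rfl
  have hf : ∀ W f, ∑ i, W i * g.hor i f = g.horAlong W f := fun _ _ => rfl
  have hneg : ∀ W f, g.horAlong W (-f) = - g.horAlong W f := by
    intro W f; simp [FiberMetric.horAlong]
  have h4 : g.horAlong η.B (2 * η.σ * η.β) = 2 * (η.σ * g.horAlong η.B η.β + η.β * η.σB) := by
    rw [σB, ← horAlong_leibniz, mul_assoc]
    simp only [FiberMetric.horAlong, derivation_two_mul, mul_sum, mul_left_comm (η.B _)]
  have h5 : g.horAlong η.ss η.β = η.σ * 2 * η.s0 - η.β * η.p - η.t0 := by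
    apply two_mul_cancel
    rw [η.horAlong_β, vert_r00, η.vert_ss_en, η.vert_ss_β, η.sum_s0_ss, ← p]; ring
  have h6 : g.geo (g.hdiv η.B) = 2 * (((n : A) - η.q) * g.geo η.σ - η.σ * g.geo η.q) := by
    rw [hdiv_B, mul_assoc, derivation_two_mul, Derivation.leibniz, map_sub]
    simp
    ring
  rw [h6, h2] at h1
  simp only [g.hdiv_add, g.hdiv_mul, g.hdiv_y, hf, hneg, h3, h4, h5, hdiv_ss, hdiv_B, horAlong_B_β,
    geo_q] at h1
  linear_combination h1

end FiberIsotropic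

end
end RandersSoliton

namespace RandersSoliton
noncomputable section
open Finset

/-! ### The divergence identity -/

namespace FiberForm
variable {n : ℕ} {A : Type*} [CommRing A] [Algebra ℝ A] {K : FiberCalculus n A}
  {g : FiberMetric K} (η : FiberForm g)

theorem ttr_basic : K.IsBasic η.ttr := fun m => by
  simp only [ttr, map_sum, Derivation.leibniz]
  simp [η.sm_basic _ _ m]

theorem vert_B_sy (i : Fin n) : K.vert η.B (η.sy i) = - η.s1 i := by
  rw [← η.flat_S0]
  have : K.vert η.B (g.flat η.S0 i) = g.flat (fun k => K.vert η.B (η.S0 k)) i := by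
    simp [FiberMetric.flat, K.vert_basic _ (g.a_basic _ _)]
  rw [this]
  simp only [vert_B_S0, ← η.flat_ss]
  simp [FiberMetric.flat]

theorem vert_B_t00 : K.vert η.B η.t00 = 2 * η.t0 := by
  have h1 : ∑ i, η.S0 i * η.s1 i = η.t0 := by
    rw [t0, η.vert_s0]; exact sum_congr rfl fun _ _ => mul_comm _ _
  have h2 : ∑ i, η.sy i * η.ss i = η.t0 := by
    rw [← η.sum_s0_ss]; exact sum_congr rfl fun _ _ => mul_comm _ _
  simp only [t00, map_neg, map_sum, Derivation.leibniz, smul_eq_mul, vert_B_sy, vert_B_S0, mul_neg,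
    sum_add_distrib, sum_neg_distrib, h1, h2]
  ring

theorem vert_B_t0 : K.vert η.B η.t0 = - K.vert η.ss η.s0 := by
  rw [t0, vert_s0, vert_s0]
  simp [vert_B_S0, K.vert_basic _ (η.s1_basic _)]

end FiberForm

namespace FiberIsotropic
variable {n : ℕ} {A : Type*} [CommRing A] [Algebra ℝ A] {K : FiberCalculus n A}
  {g : FiberMetric K} (η : FiberIsotropic g)

/-- The value of `ᵅRic` in the classification, as a function of `l = κ - 2c`, which is constant on
each fibre and may therefore be taken to be a real number. -/
def ricRhs (l : ℝ) : A := algebraMap ℝ A l * (g.en + η.β ^ 2) + η.ttr * g.en + 2 * η.t00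
  - ((n : A) - 1) * (η.σ ^ 2 * (3 * g.en - η.β ^ 2)) + 2 * ((n : A) - 1) * (g.geo η.σ * η.β)
  - ((n : A) - 1) * (η.s0 ^ 2 + η.s00)

/-- The value that the divergence of `sⁱ₀` takes for an almost Ricci soliton, where `l = κ - 2c`. -/
def divRhs (l : ℝ) : A := algebraMap ℝ A l * η.β
  + ((n : A) - 1) * (η.σ ^ 2 * η.β + 2 * (η.σ * η.s0) + 2 * g.geo η.σ + η.t0)

/-- The defect `D` of the equation for the divergence of `sⁱ₀` and the defect `E` of the equation for
`ᵅRic` satisfy `2 (D(y) + β D(b♯)) = dE(b♯)`. Hence the second equation implies the first one. -/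
theorem divergence_identity (l : ℝ) :
    2 * ((g.hdiv η.S0 - η.divRhs l) + η.β * K.vert η.B (g.hdiv η.S0 - η.divRhs l))
      = K.vert η.B (K.ric g.spray - η.ricRhs l) := by
  have h := η.hdiv_S0
  have hn : K.vert η.B (n : A) = 0 := by simp
  have h1 : K.vert η.B (η.divRhs l) = algebraMap ℝ A l * η.q
      + ((n : A) - 1) * (η.σ ^ 2 * η.q + 2 * η.σB - η.p) := by
    simp only [divRhs, map_add, map_sub, Derivation.leibniz, derivation_two, smul_eq_mul,
      η.vert_B_β, η.vert_B_s0, η.vert_B_t0, vert_geo_σ, K.vert_basic η.B η.σ_basic, hn, pow_two,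
      Derivation.map_algebraMap, Derivation.map_one_eq_zero]
    rw [← σB, ← p]
    ring
  have h2 : K.vert η.B (η.ricRhs l) = algebraMap ℝ A l * (2 * η.β + 2 * η.β * η.q)
      + 2 * η.ttr * η.β + 4 * η.t0 - ((n : A) - 1) * (η.σ ^ 2 * (6 * η.β - 2 * η.β * η.q))
      + 2 * ((n : A) - 1) * (η.σB * η.β + g.geo η.σ * η.q)
      - ((n : A) - 1) * K.vert η.B η.s00 := by
    simp only [ricRhs, map_add, map_sub, mul_assoc, derivation_two_mul]
    simp only [map_add, map_sub, Derivation.leibniz, smul_eq_mul,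
      η.vert_B_β, η.vert_B_s0, η.vert_B_t00, vert_geo_σ, K.vert_basic η.B η.σ_basic, hn, pow_two,
      Derivation.map_algebraMap, Derivation.map_one_eq_zero, derivation_three, η.vert_B_en,
      K.vert_basic η.B η.ttr_basic]
    rw [← σB]
    ring
  rw [map_sub, map_sub, h1, h2, vert_B_s00]
  rw [horAlong_B_s0] at h
  rw [divRhs]
  linear_combination h

end FiberIsotropic

end
end RandersSoliton

namespace RandersSoliton
noncomputable section
open Set TopologicalSpace

/-! ### Smooth functions on an open set -/

section SmoothFun
variable {E : Type*} [NormedAddCommGroup E] [NormedSpace ℝ E]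

/-- The algebra of smooth real functions on an open set `Ω`: functions on `Ω` that are restrictions of
functions smooth on `Ω`. Equality is equality on `Ω`, so that identities in this ring carry no
domain conditions. -/
def SmoothFun (Ω : Opens E) : Subalgebra ℝ (Ω → ℝ) where
  carrier := {f | ∃ g : E → ℝ, ContDiffOn ℝ ∞ g Ω ∧ ∀ p : Ω, g p = f p}
  mul_mem' := by
    rintro f f' ⟨g, hg, h⟩ ⟨g', hg', h'⟩
    exact ⟨fun p => g p * g' p, hg.mul hg', fun p => by simp [h, h']⟩
  add_mem' := by
    rintro f f' ⟨g, hg, h⟩ ⟨g', hg', h'⟩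
    exact ⟨fun p => g p + g' p, hg.add hg', fun p => by simp [h, h']⟩
  algebraMap_mem' r := ⟨fun _ => r, contDiffOn_const, fun _ => rfl⟩

namespace SmoothFun
variable {Ω : Opens E}

/-- The restriction to `Ω` of a function that is smooth on `Ω`. -/
def mk (g : E → ℝ) (hg : ContDiffOn ℝ ∞ g Ω) : SmoothFun Ω := ⟨fun p => g p, g, hg, fun _ => rfl⟩

@[simp] theorem mk_apply (g : E → ℝ) (hg : ContDiffOn ℝ ∞ g Ω) (p : Ω) : (mk g hg).1 p = g p := rfl

section Values
variable (f f' : SmoothFun Ω) (p : Ω)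

theorem val_add : (f + f').1 p = f.1 p + f'.1 p := rfl
theorem val_sub : (f - f').1 p = f.1 p - f'.1 p := rfl
theorem val_mul : (f * f').1 p = f.1 p * f'.1 p := rfl
theorem val_neg : (-f).1 p = - f.1 p := rfl
theorem val_pow (k : ℕ) : (f ^ k).1 p = f.1 p ^ k := rfl
theorem val_one : (1 : SmoothFun Ω).1 p = 1 := rfl
theorem val_natCast (k : ℕ) : (k : SmoothFun Ω).1 p = k := rfl
theorem val_two : (2 : SmoothFun Ω).1 p = 2 := rfl
theorem val_three : (3 : SmoothFun Ω).1 p = 3 := rfl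
theorem val_four : (4 : SmoothFun Ω).1 p = 4 := rfl
theorem val_algebraMap (r : ℝ) : (algebraMap ℝ (SmoothFun Ω) r).1 p = r := rfl
theorem val_sum {ι : Type*} (s : Finset ι) (f : ι → SmoothFun Ω) :
    (∑ i ∈ s, f i).1 p = ∑ i ∈ s, (f i).1 p := by simp

end Values

/-- A function on the whole space with restriction `f`; its values outside `Ω` are arbitrary. -/
def ext (f : SmoothFun Ω) : E → ℝ := f.2.choose

theorem ext_contDiffOn (f : SmoothFun Ω) : ContDiffOn ℝ ∞ (ext f) Ω := f.2.choose_spec.1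

theorem ext_apply (f : SmoothFun Ω) (p : Ω) : ext f p = f.1 p := f.2.choose_spec.2 p

theorem ext_differentiableAt (f : SmoothFun Ω) (p : Ω) : DifferentiableAt ℝ (ext f) p :=
  (((ext_contDiffOn f).contDiffAt (Ω.isOpen.mem_nhds p.2)).differentiableAt (by simp))

theorem fderiv_eq_of_eq {f f' : E → ℝ} (h : ∀ p : Ω, f p = f' p) (p : Ω) :
    fderiv ℝ f p = fderiv ℝ f' p := by
  apply Filter.EventuallyEq.fderiv_eq
  filter_upwards [Ω.isOpen.mem_nhds p.2] with x hx using h ⟨x, hx⟩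

theorem contDiffOn_fderiv (f : SmoothFun Ω) (v : E) :
    ContDiffOn ℝ ∞ (fun p => fderiv ℝ (ext f) p v) Ω :=
  ((ext_contDiffOn f).fderiv_of_isOpen Ω.isOpen (m := ∞) (by simp)).clm_apply contDiffOn_const

/-- The derivative of smooth functions in the direction `v`. -/
def dir (v : E) : Derivation ℝ (SmoothFun Ω) (SmoothFun Ω) :=
  Derivation.mk'
    { toFun := fun f => mk (fun p => fderiv ℝ (ext f) p v) (contDiffOn_fderiv f v)
      map_add' := fun f f' => by
        apply Subtype.ext; funext p
        have := fderiv_eq_of_eq (f := ext (f + f')) (f' := fun x => ext f x + ext f' x)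
          (fun p => by simp [ext_apply]) p
        simp [this, fderiv_fun_add (ext_differentiableAt f p) (ext_differentiableAt f' p)]
      map_smul' := fun r f => by
        apply Subtype.ext; funext p
        have := fderiv_eq_of_eq (f := ext (r • f)) (f' := fun x => r * ext f x)
          (fun p => by simp [ext_apply]) p
        simp [this, fderiv_const_mul (ext_differentiableAt f p)] }
    (fun f f' => by
        apply Subtype.ext; funext p
        have := fderiv_eq_of_eq (f := ext (f * f')) (f' := fun x => ext f x * ext f' x)
          (fun p => by simp [ext_apply]) p
        simp [this, fderiv_fun_mul (ext_differentiableAt f p) (ext_differentiableAt f' p), ext_apply])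

theorem dir_apply (v : E) (f : SmoothFun Ω) {g : E → ℝ} (h : ∀ p : Ω, g p = f.1 p) (p : Ω) :
    (dir v f).1 p = fderiv ℝ g p v := by
  change fderiv ℝ (ext f) p v = _
  rw [fderiv_eq_of_eq (f' := g) (fun p => by rw [ext_apply, h])]

theorem dir_comm (v w : E) (f : SmoothFun Ω) : dir v (dir w f) = dir w (dir v f) := by
  apply Subtype.ext; funext p
  have key : ∀ v w, (dir v (dir w f)).1 p = fderiv ℝ (fderiv ℝ (ext f)) p v w := by
    intro v w
    rw [dir_apply v (dir w f) (g := fun p => fderiv ℝ (ext f) p w)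
      (fun p => (dir_apply w f (ext_apply f) p).symm)]
    have hd : DifferentiableAt ℝ (fderiv ℝ (ext f)) p :=
      (((ext_contDiffOn f).fderiv_of_isOpen Ω.isOpen (m := ∞) (by simp)).contDiffAt
        (Ω.isOpen.mem_nhds p.2)).differentiableAt (by simp)
    rw [fderiv_clm_apply hd (differentiableAt_const w)]
    simp
  rw [key, key]
  have hs : IsSymmSndFDerivAt ℝ (ext f) p :=
    ((ext_contDiffOn f).contDiffAt (Ω.isOpen.mem_nhds p.2)).isSymmSndFDerivAt
      (by rw [minSmoothness_of_isRCLikeNormedField]; exact ENat.LEInfty.out)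
  exact hs v w

end SmoothFun
end SmoothFun

/-- The open set `U × W` of points `(x, y)`. -/
def prodOpens {n : ℕ} (U W : Opens (Coord n)) : Opens (Coord n × Coord n) :=
  ⟨U ×ˢ W, U.2.prod W.2⟩

open SmoothFun

theorem hasFDerivAt_snd_coord {n : ℕ} (j : Fin n) (p : Coord n × Coord n) :
    HasFDerivAt (fun p : Coord n × Coord n => p.2 j)
      ((EuclideanSpace.proj j : Coord n →L[ℝ] ℝ).comp
        (ContinuousLinearMap.snd ℝ (Coord n) (Coord n))) p :=
  ContinuousLinearMap.hasFDerivAt ((EuclideanSpace.proj j : Coord n →L[ℝ] ℝ).comp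
        (ContinuousLinearMap.snd ℝ (Coord n) (Coord n)))

/-- The calculus of smooth functions of `(x, y) ∈ U × W`. -/
def smoothCalculus {n : ℕ} (U W : Opens (Coord n)) :
    FiberCalculus n (SmoothFun (prodOpens U W)) where
  X i := dir (EuclideanSpace.single i 1, 0)
  Y i := dir (0, EuclideanSpace.single i 1)
  y i := mk (fun p => p.2 i) (by fun_prop)
  X_y i j := by
    apply Subtype.ext; funext p
    rw [dir_apply _ _ (g := fun p => p.2 j) (fun _ => rfl)]
    rw [(hasFDerivAt_snd_coord j p.1).fderiv]
    simp
  Y_y i j := by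
    apply Subtype.ext; funext p
    rw [dir_apply _ _ (g := fun p => p.2 j) (fun _ => rfl)]
    rw [(hasFDerivAt_snd_coord j p.1).fderiv]
    by_cases h : i = j
    · simp [h]
    · simp [h, Ne.symm h]
  XX i j f := dir_comm _ _ f
  XY i j f := dir_comm _ _ f
  YY i j f := dir_comm _ _ f

/-- The element `f` of the algebra is the restriction of the function `L(x, y)`. This relation
translates between identities in the algebra and the coordinate definitions. -/
def Rep {n : ℕ} {U W : Opens (Coord n)} (L : Coord n → Coord n → ℝ)
    (f : SmoothFun (prodOpens U W)) : Prop :=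
  ∀ p : prodOpens U W, L p.1.1 p.1.2 = f.1 p

namespace Rep
variable {n : ℕ} {U W : Opens (Coord n)} {L L' : Coord n → Coord n → ℝ}
  {f f' : SmoothFun (prodOpens U W)}

theorem dx (h : Rep L f) (i : Fin n) : Rep (dx i L) ((smoothCalculus U W).X i f) := by
  intro p
  have h1 : (fun w => L w p.1.2) =ᶠ[nhds p.1.1] fun w => ext f (w, p.1.2) := by
    filter_upwards [U.2.mem_nhds p.2.1] with w hw
    exact (h ⟨(w, p.1.2), hw, p.2.2⟩).trans (ext_apply f ⟨(w, p.1.2), hw, p.2.2⟩).symm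
  have h2 : HasFDerivAt (fun w : Coord n => (w, p.1.2)) (ContinuousLinearMap.inl ℝ _ (Coord n)) p.1.1 :=
    hasFDerivAt_prodMk_left _ _
  have h3 := (ext_differentiableAt f p).hasFDerivAt.comp p.1.1 h2
  change fderiv ℝ (fun w => L w p.1.2) p.1.1 _ = (dir _ f).1 p
  rw [h1.fderiv_eq, dir_apply _ f (ext_apply f)]
  have h4 := h3.fderiv
  rw [show (fun w => ext f (w, p.1.2)) = ext f ∘ fun w => (w, p.1.2) from rfl, h4]
  simp

theorem dy (h : Rep L f) (i : Fin n) : Rep (dy i L) ((smoothCalculus U W).Y i f) := by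
  intro p
  have h1 : (fun w => L p.1.1 w) =ᶠ[nhds p.1.2] fun w => ext f (p.1.1, w) := by
    filter_upwards [W.2.mem_nhds p.2.2] with w hw
    exact (h ⟨(p.1.1, w), p.2.1, hw⟩).trans (ext_apply f ⟨(p.1.1, w), p.2.1, hw⟩).symm
  have h2 : HasFDerivAt (fun w : Coord n => (p.1.1, w)) (ContinuousLinearMap.inr ℝ (Coord n) _) p.1.2 :=
    hasFDerivAt_prodMk_right _ _
  have h3 := (ext_differentiableAt f p).hasFDerivAt.comp p.1.2 h2
  change fderiv ℝ (fun w => L p.1.1 w) p.1.2 _ = (dir _ f).1 p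
  rw [h1.fderiv_eq, dir_apply _ f (ext_apply f)]
  have h4 := h3.fderiv
  rw [show (fun w => ext f (p.1.1, w)) = ext f ∘ fun w => (p.1.1, w) from rfl, h4]
  simp

theorem add (h : Rep L f) (h' : Rep L' f') : Rep (fun u y => L u y + L' u y) (f + f') :=
  fun p => by simp [h p, h' p]

theorem sub (h : Rep L f) (h' : Rep L' f') : Rep (fun u y => L u y - L' u y) (f - f') :=
  fun p => by simp [h p, h' p]

theorem mul (h : Rep L f) (h' : Rep L' f') : Rep (fun u y => L u y * L' u y) (f * f') :=
  fun p => by simp [h p, h' p]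

theorem sum {ι : Type*} {s : Finset ι} {L : ι → Coord n → Coord n → ℝ}
    {f : ι → SmoothFun (prodOpens U W)} (h : ∀ i, Rep (L i) (f i)) :
    Rep (fun u y => ∑ i ∈ s, L i u y) (∑ i ∈ s, f i) :=
  fun p => by simp [fun i => h i p]

theorem smul (r : ℝ) (h : Rep L f) : Rep (fun u y => r * L u y) (r • f) :=
  fun p => by simp [h p]

end Rep

theorem isBasic_of_rep {n : ℕ} {U W : Opens (Coord n)} {w : Coord n → ℝ}
    {f : SmoothFun (prodOpens U W)} (h : Rep (fun u _ => w u) f) : (smoothCalculus U W).IsBasic f := by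
  intro i
  apply Subtype.ext; funext p
  rw [← h.dy i p]
  simp [dy, pd]

end
end RandersSoliton

namespace RandersSoliton
noncomputable section
open Set TopologicalSpace
open SmoothFun Finset

/-! ### Randers metrics in coordinates -/

theorem contDiffOn_base {n : ℕ} {U : Opens (Coord n)} (W : Opens (Coord n)) {w : Coord n → ℝ}
    (h : ContDiffOn ℝ ∞ w U) :
    ContDiffOn ℝ ∞ (fun p : Coord n × Coord n => w p.1) (prodOpens U W) :=
  h.comp contDiffOn_fst fun _ hp => hp.1

/-- A function on the base `U`, as a function on `U × W`. -/
def base {n : ℕ} {U : Opens (Coord n)} (W : Opens (Coord n)) (w : Coord n → ℝ)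
    (h : ContDiffOn ℝ ∞ w U) : SmoothFun (prodOpens U W) :=
  mk (fun p => w p.1) (contDiffOn_base W h)

theorem rep_base {n : ℕ} {U : Opens (Coord n)} (W : Opens (Coord n)) (w : Coord n → ℝ)
    (h : ContDiffOn ℝ ∞ w U) : Rep (fun u _ => w u) (base W w h) := fun _ => rfl

/-- A Randers metric on an open subset `U` of the coordinate space. Symmetry is required at all points,
which for the expression of a Randers metric in a chart holds outside `U` as well. -/
structure LocalRanders (n : ℕ) where
  /-- The domain. -/
  U : Opens (Coord n)
  /-- The components `a_{ij}` of the Riemannian metric. -/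
  a : Coord n → Matrix (Fin n) (Fin n) ℝ
  /-- The components `bᵢ` of the 1-form. -/
  b : Coord n → Fin n → ℝ
  smooth_a : ∀ i j, ContDiffOn ℝ ∞ (fun u => a u i j) U
  smooth_b : ∀ i, ContDiffOn ℝ ∞ (fun u => b u i) U
  symm : ∀ u i j, a u i j = a u j i
  pos : ∀ u ∈ U, ∀ y : Coord n, y ≠ 0 → 0 < contr₂ (a u) y
  lt : ∀ u ∈ U, ∀ y : Coord n, y ≠ 0 → |contr (b u) y| < √(contr₂ (a u) y)

namespace LocalRanders
variable {n : ℕ} (R : LocalRanders n)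

/-- `α = √(a_{ij} yⁱ yʲ)` -/
def alpha (u y : Coord n) : ℝ := √(contr₂ (R.a u) y)
/-- `β = bᵢ yⁱ` -/
def beta (u y : Coord n) : ℝ := contr (R.b u) y
/-- `F = α + β` -/
def F (u y : Coord n) : ℝ := R.alpha u y + R.beta u y

theorem contr₂_eq (m : Matrix (Fin n) (Fin n) ℝ) (y : Coord n) :
    contr₂ m y = (y : Fin n → ℝ) ⬝ᵥ m.mulVec y := by
  simp only [contr₂, dotProduct, Matrix.mulVec, mul_sum]
  exact sum_congr rfl fun i _ => sum_congr rfl fun j _ => by ring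

theorem contr₂_zero (m : Fin n → Fin n → ℝ) : contr₂ m 0 = 0 := by simp [contr₂]

theorem contr_zero (m : Fin n → ℝ) : contr m 0 = 0 := by simp [contr]

theorem nonneg {u : Coord n} (hu : u ∈ R.U) (y : Coord n) : 0 ≤ contr₂ (R.a u) y := by
  by_cases h : y = 0
  · subst h; simp [contr₂]
  · exact (R.pos u hu y h).le

theorem isUnit_det {u : Coord n} (hu : u ∈ R.U) : IsUnit (R.a u).det := by
  rw [isUnit_iff_ne_zero]
  intro h
  obtain ⟨v, hv, h0⟩ := Matrix.exists_mulVec_eq_zero_iff.mpr h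
  have := R.pos u hu (WithLp.toLp 2 v) (by
    intro h'; apply hv; exact (WithLp.toLp_eq_zero 2).mp h')
  rw [contr₂_eq] at this
  simp [h0] at this

theorem a_mul_inv {u : Coord n} (hu : u ∈ R.U) (i j : Fin n) :
    ∑ k, R.a u i k * (R.a u)⁻¹ k j = if i = j then 1 else 0 := by
  have := congrFun (congrFun (Matrix.mul_nonsing_inv (R.a u) (R.isUnit_det hu)) i) j
  rw [Matrix.mul_apply] at this
  rw [this, Matrix.one_apply]

theorem inv_symm (u : Coord n) (i j : Fin n) : (R.a u)⁻¹ i j = (R.a u)⁻¹ j i := by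
  have : (R.a u).transpose = R.a u := by ext i j; exact (R.symm u i j).symm
  have h := Matrix.transpose_nonsing_inv (R.a u)
  rw [this] at h
  conv_lhs => rw [← h, Matrix.transpose_apply]

theorem smooth_det : ContDiffOn ℝ ∞ (fun u => (R.a u).det) R.U := by
  simp only [Matrix.det_apply]
  apply ContDiffOn.sum
  intro σ _
  apply ContDiffOn.const_smul
  exact contDiffOn_prod fun i _ => R.smooth_a _ _

theorem smooth_inv (i j : Fin n) : ContDiffOn ℝ ∞ (fun u => (R.a u)⁻¹ i j) R.U := by
  have h : ∀ u, (R.a u)⁻¹ i j = ((R.a u).det)⁻¹ * (R.a u).adjugate i j := by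
    intro u; simp [Matrix.inv_def]
  simp only [h]
  refine (R.smooth_det.inv fun u hu => (R.isUnit_det hu).ne_zero).mul ?_
  simp only [Matrix.adjugate_apply, Matrix.det_apply]
  apply ContDiffOn.sum
  intro σ _
  apply ContDiffOn.const_smul
  refine contDiffOn_prod fun k _ => ?_
  simp only [Matrix.updateRow_apply]
  split_ifs
  · exact contDiffOn_const
  · exact R.smooth_a _ _

/-- The Riemannian metric, in the calculus of smooth functions on `U × W`. -/
def metric (W : Opens (Coord n)) : FiberMetric (smoothCalculus R.U W) where
  a i j := base W _ (R.smooth_a i j)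
  ai i j := base W _ (R.smooth_inv i j)
  a_symm i j := Subtype.ext (funext fun p => R.symm _ _ _)
  ai_symm i j := Subtype.ext (funext fun p => R.inv_symm _ _ _)
  a_basic i j := isBasic_of_rep (rep_base W _ _)
  ai_basic i j := isBasic_of_rep (rep_base W _ _)
  a_ai i j := by
    apply Subtype.ext; funext p
    have := R.a_mul_inv p.2.1 i j
    by_cases h : i = j <;> simpa [h, base] using this

/-- The 1-form, in the calculus of smooth functions on `U × W`. -/
def form (W : Opens (Coord n)) : FiberForm (R.metric W) where
  b i := base W _ (R.smooth_b i)
  b_basic _ := isBasic_of_rep (rep_base W _ _)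

variable (W : Opens (Coord n))

theorem rep_y (i : Fin n) : Rep (fun _ y => y i) ((smoothCalculus R.U W).y i) := fun _ => rfl
theorem rep_a (i j : Fin n) : Rep (fun u _ => R.a u i j) ((R.metric W).a i j) := fun _ => rfl
theorem rep_ai (i j : Fin n) : Rep (fun u _ => (R.a u)⁻¹ i j) ((R.metric W).ai i j) := fun _ => rfl
theorem rep_b (i : Fin n) : Rep (fun u _ => R.b u i) ((R.form W).b i) := fun _ => rfl

theorem rep_chr (k i j : Fin n) :
    Rep (fun u _ => christoffel R.a u k i j) ((R.metric W).chr k i j) := by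
  have h := Rep.sum (s := univ) fun l => (R.rep_ai W k l).mul ((((R.rep_a W l i).dx j).add
    ((R.rep_a W l j).dx i)).sub ((R.rep_a W i j).dx l) |>.smul (1 / 2))
  intro p
  rw [FiberMetric.chr, FiberMetric.sharp]
  refine Eq.trans ?_ (h p)
  simp only [christoffel, mul_sum]
  exact sum_congr rfl fun l _ => by
    rw [mul_left_comm]; rfl

/-- The covariant derivative `w_{i;j} = ∂ⱼwᵢ - Γᵏᵢⱼwₖ` of a 1-form. -/
def covForm {W} (w : Fin n → SmoothFun (prodOpens R.U W)) (i j : Fin n) :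
    SmoothFun (prodOpens R.U W) :=
  (smoothCalculus R.U W).X j (w i) - ∑ k, (R.metric W).chr k i j * w k

variable {W} in
theorem rep_covD {w : Coord n → Fin n → ℝ} {w' : Fin n → SmoothFun (prodOpens R.U W)}
    (h : ∀ i, Rep (fun u _ => w u i) (w' i)) (i j : Fin n) :
    Rep (fun u _ => covD R.a w u i j) (R.covForm w' i j) :=
  ((h i).dx j).sub (Rep.sum fun k => (R.rep_chr W k i j).mul (h k))

theorem rep_s (i j : Fin n) : Rep (fun u _ => sT R.a R.b u i j) ((R.form W).s i j) := by
  have h := (((R.rep_covD (R.rep_b W) i j).sub (R.rep_covD (R.rep_b W) j i)).smul (1 / 2))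
  have e : (R.form W).s i j
      = (1 / 2 : ℝ) • (R.covForm (R.form W).b i j - R.covForm (R.form W).b j i) := by
    simp only [FiberForm.s, covForm, (R.metric W).chr_symm _ i j]
    algebra
  rw [e]; exact h

theorem rep_B (i : Fin n) : Rep (fun u _ => raise R.a R.b u i) ((R.form W).B i) :=
  Rep.sum fun j => (R.rep_ai W i j).mul (R.rep_b W j)

theorem rep_s1 (j : Fin n) : Rep (fun u _ => sV R.a R.b u j) ((R.form W).s1 j) :=
  Rep.sum fun i => (R.rep_B W i).mul (R.rep_s W i j)

theorem rep_sm (i j : Fin n) :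
    Rep (fun u _ => ∑ l, (R.a u)⁻¹ i l * sT R.a R.b u l j) ((R.form W).sm i j) :=
  Rep.sum fun l => (R.rep_ai W i l).mul (R.rep_s W l j)

theorem rep_ttr : Rep (fun u _ => tTrace R.a R.b u) (R.form W).ttr := by
  have h := Rep.sum (s := univ) fun i => Rep.sum (s := univ) fun k => (R.rep_ai W i k).mul
    (Rep.sum (s := univ) fun l => (R.rep_s W k l).mul (R.rep_sm W l i))
  have e : (R.form W).ttr = ∑ i, ∑ k, (R.metric W).ai i k *
      ∑ l, (R.form W).s k l * (R.form W).sm l i := by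
    refine sum_congr rfl fun i _ => ?_
    simp only [mul_sum]
    rw [sum_comm]
    refine sum_congr rfl fun l _ => ?_
    rw [show (R.form W).sm i l = ∑ k, (R.metric W).ai i k * (R.form W).s k l from rfl, sum_mul]
    exact sum_congr rfl fun k _ => by ring
  rw [e]; exact h

variable {W} in
theorem rep_contr {w : Coord n → Fin n → ℝ} {w' : Fin n → SmoothFun (prodOpens R.U W)}
    (h : ∀ i, Rep (fun u _ => w u i) (w' i)) :
    Rep (fun u y => contr (w u) y) (∑ i, w' i * (smoothCalculus R.U W).y i) :=
  Rep.sum fun i => (h i).mul (R.rep_y W i)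

variable {W} in
theorem rep_contr₂ {w : Coord n → Fin n → Fin n → ℝ}
    {w' : Fin n → Fin n → SmoothFun (prodOpens R.U W)}
    (h : ∀ i j, Rep (fun u _ => w u i j) (w' i j)) :
    Rep (fun u y => contr₂ (w u) y)
      (∑ i, ∑ j, w' i j * (smoothCalculus R.U W).y i * (smoothCalculus R.U W).y j) :=
  Rep.sum fun i => Rep.sum fun j => ((h i j).mul (R.rep_y W i)).mul (R.rep_y W j)

theorem rep_s0 : Rep (fun u y => contr (sV R.a R.b u) y) (R.form W).s0 := R.rep_contr (R.rep_s1 W)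

theorem rep_beta : Rep R.beta (R.form W).β := R.rep_contr (R.rep_b W)

theorem rep_en : Rep (fun u y => contr₂ (R.a u) y) (R.metric W).en := by
  have h := R.rep_contr₂ (R.rep_a W)
  have e : (R.metric W).en = ∑ i, ∑ j, (R.metric W).a i j * (smoothCalculus R.U W).y i
      * (smoothCalculus R.U W).y j := by
    simp only [FiberMetric.en, FiberMetric.flat, sum_mul]
    exact sum_congr rfl fun i _ => sum_congr rfl fun j _ => by ring
  rw [e]; exact h

/-- The covariant derivative of a 1-form, contracted twice with `y`. -/
theorem geo_form {W} (η : FiberForm (R.metric W)) : (R.metric W).geo η.β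
    = ∑ i, ∑ j, R.covForm η.b i j * (smoothCalculus R.U W).y i * (smoothCalculus R.U W).y j := by
  rw [(R.metric W).geo_apply, sum_comm]
  refine sum_congr rfl fun k _ => ?_
  rw [η.hor_β, mul_sum]
  exact sum_congr rfl fun i _ => by rw [covForm]; ring

theorem rep_r00 : Rep (fun u y => contr₂ (covD R.a R.b u) y) (R.form W).r00 := by
  rw [FiberForm.r00, geo_form]
  exact R.rep_contr₂ (R.rep_covD (R.rep_b W))

theorem rep_s00 : Rep (fun u y => contr₂ (covD R.a (sV R.a R.b) u) y) (R.form W).s00 := by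
  have h : (R.form W).s00 = ∑ i, ∑ j, R.covForm (R.form W).s1 i j
      * (smoothCalculus R.U W).y i * (smoothCalculus R.U W).y j :=
    R.geo_form (W := W) ⟨(R.form W).s1, (R.form W).s1_basic⟩
  rw [h]
  exact R.rep_contr₂ (R.rep_covD (R.rep_s1 W))

theorem rep_e00 : Rep (fun u y => contr₂ (eT R.a R.b u) y) (R.form W).e00 := by
  have h : ∀ u y, contr₂ (eT R.a R.b u) y = contr₂ (covD R.a R.b u) y
      + 2 * (R.beta u y * contr (sV R.a R.b u) y) := by
    intro u y
    have e1 : R.beta u y * contr (sV R.a R.b u) y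
        = ∑ i, ∑ j, R.b u i * sV R.a R.b u j * y i * y j := by
      simp only [beta, contr, sum_mul_sum]
      exact sum_congr rfl fun i _ => sum_congr rfl fun j _ => by ring
    have e2 : R.beta u y * contr (sV R.a R.b u) y
        = ∑ i, ∑ j, R.b u j * sV R.a R.b u i * y i * y j := by
      rw [e1, sum_comm]
      exact sum_congr rfl fun i _ => sum_congr rfl fun j _ => by ring
    have e3 : contr₂ (covD R.a R.b u) y = ∑ i, ∑ j, covD R.a R.b u j i * y i * y j := by
      rw [contr₂, sum_comm]
      exact sum_congr rfl fun i _ => sum_congr rfl fun j _ => by ring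
    have e4 : contr₂ (covD R.a R.b u) y
        = (1 / 2) * (contr₂ (covD R.a R.b u) y + ∑ i, ∑ j, covD R.a R.b u j i * y i * y j) := by
      rw [← e3]; ring
    rw [two_mul]
    nth_rewrite 1 [e1]
    rw [e2, e4]
    simp only [contr₂, eT, rT, mul_sum, ← sum_add_distrib]
    exact sum_congr rfl fun i _ => sum_congr rfl fun j _ => by ring
  have e : (R.form W).e00 = (R.form W).r00 + (2 : ℝ) • ((R.form W).β * (R.form W).s0) := by
    rw [FiberForm.e00]; algebra
  intro p
  rw [e, ← ((R.rep_r00 W).add (((R.rep_beta W).mul (R.rep_s0 W)).smul 2)) p]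
  exact h _ _

theorem rep_t00 : Rep (fun u y => contr₂ (tT R.a R.b u) y) (R.form W).t00 := by
  have h := R.rep_contr₂ (W := W) (w := tT R.a R.b)
    (w' := fun i j => ∑ k, (R.form W).s i k * (R.form W).sm k j)
    (fun i j => Rep.sum fun k => (R.rep_s W i k).mul (R.rep_sm W k j))
  have e : (R.form W).t00 = ∑ i, ∑ j, (∑ k, (R.form W).s i k * (R.form W).sm k j)
      * (smoothCalculus R.U W).y i * (smoothCalculus R.U W).y j := by
    have : ∀ i, ∑ j, (∑ k, (R.form W).s i k * (R.form W).sm k j)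
      * (smoothCalculus R.U W).y i * (smoothCalculus R.U W).y j
      = ∑ k, (R.form W).s i k * (smoothCalculus R.U W).y i * (R.form W).S0 k := by
      intro i
      simp only [FiberForm.S0_eq, sum_mul, mul_sum]
      rw [sum_comm]
      exact sum_congr rfl fun i _ => sum_congr rfl fun j _ => by ring
    simp only [this]
    rw [sum_comm, FiberForm.t00, ← sum_neg_distrib]
    refine sum_congr rfl fun k _ => ?_
    have h2 : ∑ i, (R.form W).s i k * (smoothCalculus R.U W).y i = - (R.form W).sy k := by
      rw [FiberForm.sy, ← sum_neg_distrib]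
      exact sum_congr rfl fun i _ => by rw [FiberForm.s_antisymm]; ring
    rw [← sum_mul, h2]
    ring
  rw [e]; exact h

end LocalRanders

end
end RandersSoliton

namespace RandersSoliton
noncomputable section
open Set TopologicalSpace
open SmoothFun Finset

/-! ### The Ricci curvature in coordinates -/

/-- The Ricci curvature as the trace of the Riemann curvature. -/
theorem FiberCalculus.ric_eq {n : ℕ} {A : Type*} [CommRing A] [Algebra ℝ A]
    (K : FiberCalculus n A) (G : Fin n → A) :
    K.ric G = ∑ i, (2 * K.X i (G i) - ∑ j, K.X j (K.Y i (G i)) * K.y j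
      + 2 * ∑ j, G j * K.Y j (K.Y i (G i)) - ∑ j, K.Y j (G i) * K.Y i (G j)) := by
  simp only [ric, vtr, euler_apply, vert_apply, map_sum, sum_add_distrib, sum_sub_distrib, mul_sum]
  simp only [mul_comm (K.y _)]

theorem rep_ricci {n : ℕ} {U W : Opens (Coord n)} {F : Coord n → Coord n → ℝ}
    {G : Fin n → SmoothFun (prodOpens U W)} (h : ∀ i, Rep (geodCoeff F i) (G i)) :
    Rep (ricci F) ((smoothCalculus U W).ric G) := by
  rw [FiberCalculus.ric_eq]
  refine Rep.sum fun i => ?_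
  have h1 := ((((h i).dx i).smul 2).sub (Rep.sum (s := univ) fun j =>
    (((h i).dy i).dx j).mul (L' := fun _ y => y j) (f' := (smoothCalculus U W).y j)
      (fun _ => rfl))).add ((Rep.sum (s := univ) fun j =>
    (h j).mul (((h i).dy i).dy j)).smul 2) |>.sub (Rep.sum (s := univ) fun j =>
      ((h i).dy j).mul ((h j).dy i))
  intro p
  refine (h1 p).trans ?_
  congr 2

/-- The geodesic coefficients are the unique solution of the Euler–Lagrange equation of `F²` where the
fundamental tensor is nondegenerate. -/
theorem rep_geodCoeff {n : ℕ} {U W : Opens (Coord n)} {F : Coord n → Coord n → ℝ}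
    {E : SmoothFun (prodOpens U W)} (hE : Rep (energy F) E) {T : Fin n → SmoothFun (prodOpens U W)}
    (hT : ∀ l, 2 * (smoothCalculus U W).vert T ((smoothCalculus U W).Y l E)
      = (smoothCalculus U W).euler ((smoothCalculus U W).Y l E) - (smoothCalculus U W).X l E)
    (hdet : ∀ p : prodOpens U W, (fundTensor F p.1.1 p.1.2).det ≠ 0) (i : Fin n) :
    Rep (geodCoeff F i) (T i) := by
  intro p
  have hw : ∀ l, (∑ m, dx m (dy l (energy F)) p.1.1 p.1.2 * p.1.2 m) - dx l (energy F) p.1.1 p.1.2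
      = 4 * (fundTensor F p.1.1 p.1.2).mulVec (fun i => (T i).1 p) l := by
    intro l
    have e := congrFun (congrArg Subtype.val (hT l)) p
    have e1 : (∑ m, dx m (dy l (energy F)) p.1.1 p.1.2 * p.1.2 m)
        = ((smoothCalculus U W).euler ((smoothCalculus U W).Y l E)).1 p := by
      have := (Rep.sum (s := univ) fun m => ((hE.dy l).dx m).mul (L' := fun _ y => y m)
        (f' := (smoothCalculus U W).y m) (fun _ => rfl)) p
      refine this.trans ?_
      rw [FiberCalculus.euler_apply]
      simp only [mul_comm]
    have e2 : (fundTensor F p.1.1 p.1.2).mulVec (fun i => (T i).1 p) l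
        = (1 / 2) * ((smoothCalculus U W).vert T ((smoothCalculus U W).Y l E)).1 p := by
      rw [FiberCalculus.vert_apply]
      simp only [Matrix.mulVec, dotProduct, fundTensor, Matrix.of_apply]
      have : ∀ m, dy l (dy m (energy F)) p.1.1 p.1.2
          = ((smoothCalculus U W).Y m ((smoothCalculus U W).Y l E)).1 p := by
        intro m
        rw [((hE.dy m).dy l) p, (smoothCalculus U W).YY]
      simp only [this]
      simp only [val_sum, val_mul, mul_sum]
      exact sum_congr rfl fun m _ => by ring
    rw [e1, hE.dx l p, e2]
    have e3 : ((2 * (smoothCalculus U W).vert T ((smoothCalculus U W).Y l E) :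
      SmoothFun (prodOpens U W)).1 p) = 2 * ((smoothCalculus U W).vert T
        ((smoothCalculus U W).Y l E)).1 p := rfl
    rw [e3] at e
    have e4 : ((smoothCalculus U W).euler ((smoothCalculus U W).Y l E)).1 p
        - ((smoothCalculus U W).X l E).1 p = _ := e.symm
    rw [e4]; ring
  have hinv := Matrix.nonsing_inv_mul (fundTensor F p.1.1 p.1.2) (isUnit_iff_ne_zero.mpr (hdet p))
  have h := congrFun (Matrix.mulVec_mulVec (fun i => (T i).1 p) (fundTensor F p.1.1 p.1.2)⁻¹
    (fundTensor F p.1.1 p.1.2)) i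
  rw [hinv, Matrix.one_mulVec] at h
  simp only [geodCoeff, hw]
  rw [← h]
  simp only [Matrix.mulVec, dotProduct, mul_sum]
  exact sum_congr rfl fun l _ => sum_congr rfl fun m _ => by ring

/-- The fundamental tensor of a Randers metric, up to the factor `½`. -/
theorem FiberRanders.Y_Y_F_sq {n : ℕ} {A : Type*} [CommRing A] [Algebra ℝ A]
    {K : FiberCalculus n A} {g : FiberMetric K} (R : FiberRanders g) (i j : Fin n) :
    K.Y i (K.Y j (R.F ^ 2)) = 2 * (R.F * (R.αi * g.a j i
        - R.αi ^ 3 * (g.flat K.y i * g.flat K.y j))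
      + (R.αi * g.flat K.y i + R.b i) * (R.αi * g.flat K.y j + R.b j)) := by
  have hY : ∀ j, K.Y j R.F = R.αi * g.flat K.y j + R.b j := by
    intro j
    rw [FiberRanders.F, map_add, FiberRanders.Y_α, FiberForm.Y_β]
  rw [pow_two, Derivation.leibniz, smul_eq_mul, ← two_mul, derivation_two_mul,
    Derivation.leibniz, hY, hY, map_add, Derivation.leibniz, FiberRanders.derivation_αi,
    FiberRanders.Y_α, FiberMetric.Y_flat_y, R.b_basic j i]
  simp only [smul_eq_mul]
  ring

namespace LocalRanders
variable {n : ℕ} (R : LocalRanders n)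

theorem rep_energy_alpha (W : Opens (Coord n)) : Rep (energy R.alpha) (R.metric W).en := by
  intro p
  rw [← R.rep_en W p]
  exact Real.sq_sqrt (R.nonneg p.2.1 _)

theorem fundTensor_alpha {u : Coord n} (hu : u ∈ R.U) (y : Coord n) :
    fundTensor R.alpha u y = R.a u := by
  ext i j
  have h := ((R.rep_energy_alpha ⊤).dy j).dy i ⟨(u, y), hu, trivial⟩
  simp only [fundTensor, Matrix.of_apply]
  rw [h, (R.metric ⊤).Y_en, derivation_two_mul, (R.metric ⊤).Y_flat_y]
  change (1 / 2 : ℝ) * (2 * R.a u j i) = _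
  rw [R.symm u j i]; ring

/-- The Ricci curvature of the Riemannian metric, which is defined on the zero section too. -/
theorem rep_ricci_alpha (W : Opens (Coord n)) :
    Rep (ricci R.alpha) ((smoothCalculus R.U W).ric (R.metric W).spray) :=
  rep_ricci (rep_geodCoeff (R.rep_energy_alpha W) (R.metric W).spray_en fun p => by
    rw [R.fundTensor_alpha p.2.1]; exact (R.isUnit_det p.2.1).ne_zero)

/-- The complement of the origin in a fibre. -/
def punct (n : ℕ) : Opens (Coord n) := ⟨{0}ᶜ, isOpen_compl_singleton⟩

theorem smooth_en (W : Opens (Coord n)) : ContDiffOn ℝ ∞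
    (fun p : Coord n × Coord n => contr₂ (R.a p.1) p.2) (prodOpens R.U W) := by
  simp only [contr₂]
  refine ContDiffOn.sum fun i _ => ContDiffOn.sum fun j _ => ?_
  exact ((contDiffOn_base W (R.smooth_a i j)).mul (by fun_prop)).mul (by fun_prop)

theorem smooth_beta (W : Opens (Coord n)) : ContDiffOn ℝ ∞
    (fun p : Coord n × Coord n => R.beta p.1 p.2) (prodOpens R.U W) := by
  simp only [beta, contr]
  exact ContDiffOn.sum fun i _ => (contDiffOn_base W (R.smooth_b i)).mul (by fun_prop)

theorem alpha_pos {u y : Coord n} (hu : u ∈ R.U) (hy : y ≠ 0) : 0 < R.alpha u y :=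
  Real.sqrt_pos.mpr (R.pos u hu y hy)

theorem F_pos {u y : Coord n} (hu : u ∈ R.U) (hy : y ≠ 0) : 0 < R.F u y := by
  have := (abs_lt.mp (R.lt u hu y hy)).1
  rw [F, alpha, beta]; linarith

theorem smooth_alpha : ContDiffOn ℝ ∞ (fun p : Coord n × Coord n => R.alpha p.1 p.2)
    (prodOpens R.U (punct n)) :=
  (R.smooth_en _).sqrt fun _ hp => (R.pos _ hp.1 _ hp.2).ne'

/-- The Randers metric on the slit tangent bundle, where `α` and `F` are smooth and positive. -/
def randers : FiberRanders (R.metric (punct n)) where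
  toFiberForm := R.form (punct n)
  α := SmoothFun.mk _ R.smooth_alpha
  αi := SmoothFun.mk (fun p => (R.alpha p.1 p.2)⁻¹) (R.smooth_alpha.inv fun p hp => (R.alpha_pos hp.1 hp.2).ne')
  Fi := SmoothFun.mk (fun p => (R.alpha p.1 p.2 + R.beta p.1 p.2)⁻¹)
    ((R.smooth_alpha.add (R.smooth_beta _)).inv fun p hp => (R.F_pos hp.1 hp.2).ne')
  α_sq := by
    apply Subtype.ext; funext p
    rw [← R.rep_en (punct n) p]
    exact Real.mul_self_sqrt (R.nonneg p.2.1 _)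
  α_inv := by
    apply Subtype.ext; funext p
    exact mul_inv_cancel₀ (R.alpha_pos p.2.1 p.2.2).ne'
  F_inv := by
    apply Subtype.ext; funext p
    rw [val_mul, val_add, ← R.rep_beta (punct n) p]
    exact mul_inv_cancel₀ (R.F_pos p.2.1 p.2.2).ne'

theorem rep_alpha : Rep R.alpha R.randers.α := fun _ => rfl

theorem rep_F : Rep R.F R.randers.F := R.rep_alpha.add (R.rep_beta (punct n))

theorem rep_energy_F : Rep (energy R.F) (R.randers.F ^ 2) := by
  have := R.rep_F.mul R.rep_F
  rw [pow_two]
  intro p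
  rw [← this p]
  exact pow_two _

/-- The Cauchy–Schwarz inequality for `a`, with its case of equality. -/
theorem cauchy_schwarz {u : Coord n} (hu : u ∈ R.U) {y : Coord n} (hy : y ≠ 0) (v : Fin n → ℝ) :
    (∑ i, (∑ k, R.a u i k * y k) * v i) ^ 2 ≤ contr₂ (R.a u) y * ∑ i, ∑ j, R.a u i j * v i * v j ∧
    ((∑ i, (∑ k, R.a u i k * y k) * v i) ^ 2 = contr₂ (R.a u) y * ∑ i, ∑ j, R.a u i j * v i * v j →
      ∀ i, contr₂ (R.a u) y * v i = (∑ i, (∑ k, R.a u i k * y k) * v i) * y i) := by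
  set A := contr₂ (R.a u) y with hA
  set c := ∑ i, (∑ k, R.a u i k * y k) * v i with hc
  set N := ∑ i, ∑ j, R.a u i j * v i * v j with hN
  have hApos : 0 < A := R.pos u hu y hy
  -- `α²(y) v - a(y, v) y` is orthogonal to `y`; its norm is the defect of the inequality
  let z : Coord n := WithLp.toLp 2 (fun i => A * v i - c * y i)
  have hz : contr₂ (R.a u) z = A * (A * N - c ^ 2) := by
    have h1 : ∑ i, ∑ j, R.a u i j * v i * y j = c := by
      rw [hc]
      refine sum_congr rfl fun i _ => ?_
      rw [sum_mul]; exact sum_congr rfl fun j _ => by ring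
    have h2 : ∑ i, ∑ j, R.a u i j * y i * v j = c := by
      rw [← h1, sum_comm]
      exact sum_congr rfl fun i _ => sum_congr rfl fun j _ => by rw [R.symm u]; ring
    have h3 : contr₂ (R.a u) z = A ^ 2 * N - A * c * ∑ i, ∑ j, R.a u i j * v i * y j
        - A * c * ∑ i, ∑ j, R.a u i j * y i * v j + c ^ 2 * ∑ i, ∑ j, R.a u i j * y i * y j := by
      rw [hN]
      simp only [contr₂, mul_sum, ← sum_sub_distrib, ← sum_add_distrib]
      exact sum_congr rfl fun i _ => sum_congr rfl fun j _ => by simp only [z]; ring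
    rw [h3, h1, h2, show ∑ i, ∑ j, R.a u i j * y i * y j = A from rfl]; ring
  refine ⟨?_, fun h i => ?_⟩
  · have h0 := R.nonneg hu z
    rw [hz] at h0
    have := (mul_nonneg_iff_of_pos_left hApos).mp h0
    linarith
  · have hz0 : z = 0 := by
      by_contra hne
      have := R.pos u hu z hne
      rw [hz, h] at this
      simp at this
    have := congrArg (fun w : Coord n => w i) hz0
    simp only [z] at this
    simpa [sub_eq_zero] using this

/-- A Randers metric is strongly convex: `g(v, v) = F (α²a(v,v) - a(y,v)²)/α³ + (a(y,v)/α + b(v))²`. Both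
terms are nonnegative; if they vanish, then `v` is a multiple of `y` with `dF(v) = 0`, whence `v = 0`. -/
theorem det_fundTensor_F_ne_zero {u y : Coord n} (hu : u ∈ R.U) (hy : y ≠ 0) :
    (fundTensor R.F u y).det ≠ 0 := by
  intro h
  obtain ⟨v, hv, h0⟩ := Matrix.exists_mulVec_eq_zero_iff.mpr h
  let p : prodOpens R.U (punct n) := ⟨(u, y), hu, hy⟩
  set f : Fin n → ℝ := fun i => ∑ k, R.a u i k * y k with hf
  set al := R.alpha u y with hal
  have halpos : 0 < al := R.alpha_pos hu hy
  have hFpos : 0 < R.F u y := R.F_pos hu hy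
  have hg : ∀ i j, fundTensor R.F u y i j = R.F u y * (al⁻¹ * R.a u i j - al⁻¹ ^ 3 * (f i * f j))
      + (al⁻¹ * f i + R.b u i) * (al⁻¹ * f j + R.b u j) := by
    intro i j
    have e : dy i (dy j (energy R.F)) u y = (2 * (R.randers.F * (R.randers.αi *
          (R.metric (punct n)).a j i
          - R.randers.αi ^ 3 * ((R.metric (punct n)).flat (smoothCalculus R.U (punct n)).y i *
            (R.metric (punct n)).flat (smoothCalculus R.U (punct n)).y j))
        + (R.randers.αi * (R.metric (punct n)).flat (smoothCalculus R.U (punct n)).y i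
            + R.randers.b i)
          * (R.randers.αi * (R.metric (punct n)).flat (smoothCalculus R.U (punct n)).y j
            + R.randers.b j))).1 p := by
      rw [← R.randers.Y_Y_F_sq]
      exact ((R.rep_energy_F.dy j).dy i) p
    have hflat : ∀ i, ((R.metric (punct n)).flat (smoothCalculus R.U (punct n)).y i).1 p = f i := by
      intro i
      rw [FiberMetric.flat, val_sum]; rfl
    have hF' : R.randers.F.1 p = R.F u y := (R.rep_F p).symm
    have hα' : R.randers.αi.1 p = al⁻¹ := rfl
    have ha' : ((R.metric (punct n)).a j i).1 p = R.a u j i := rfl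
    have hb' : ∀ i, (R.randers.b i).1 p = R.b u i := fun _ => rfl
    simp only [fundTensor, Matrix.of_apply]
    rw [e]
    simp only [val_mul, val_add, val_sub, val_pow, val_two, hF', hα', ha', hb', hflat]
    rw [R.symm u j i]
    ring
  have hq : ∑ i, ∑ j, fundTensor R.F u y i j * v i * v j = 0 := by
    refine sum_eq_zero fun i _ => ?_
    have := congrFun h0 i
    simp only [Matrix.mulVec, dotProduct, Pi.zero_apply] at this
    calc _ = (∑ j, fundTensor R.F u y i j * v j) * v i := by
          rw [sum_mul]; exact sum_congr rfl fun j _ => by ring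
      _ = 0 := by rw [this, zero_mul]
  set N := ∑ i, ∑ j, R.a u i j * v i * v j with hN
  set c := ∑ i, f i * v i with hc
  set d := ∑ i, R.b u i * v i with hd
  have hq2 : ∑ i, ∑ j, fundTensor R.F u y i j * v i * v j
      = R.F u y * (al⁻¹ * N - al⁻¹ ^ 3 * c ^ 2) + (al⁻¹ * c + d) ^ 2 := by
    have e1 : c ^ 2 = ∑ i, ∑ j, (f i * v i) * (f j * v j) := by rw [pow_two, hc, sum_mul_sum]
    have e2 : (al⁻¹ * c + d) ^ 2 = ∑ i, ∑ j, ((al⁻¹ * f i + R.b u i) * v i) *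
        ((al⁻¹ * f j + R.b u j) * v j) := by
      rw [← sum_mul_sum, ← pow_two]
      congr 1
      rw [hc, hd, mul_sum, ← sum_add_distrib]
      exact sum_congr rfl fun i _ => by ring
    rw [e1, e2, hN]
    simp only [mul_sum, ← sum_sub_distrib, ← sum_add_distrib, hg]
    exact sum_congr rfl fun i _ => sum_congr rfl fun j _ => by ring
  rw [hq2] at hq
  obtain ⟨hcs, heq⟩ := R.cauchy_schwarz hu hy v
  have hal2 : al ^ 2 = contr₂ (R.a u) y := Real.sq_sqrt (R.nonneg hu y)
  rw [← hal2] at hcs heq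
  have e3 : al⁻¹ * N - al⁻¹ ^ 3 * c ^ 2 = al⁻¹ ^ 3 * (al ^ 2 * N - c ^ 2) := by
    field_simp
  have h1 : 0 ≤ R.F u y * (al⁻¹ * N - al⁻¹ ^ 3 * c ^ 2) := by
    rw [e3]
    have : 0 ≤ al ^ 2 * N - c ^ 2 := by linarith [hcs]
    positivity
  have h2 : al⁻¹ * c + d = 0 := by
    have := sq_nonneg (al⁻¹ * c + d)
    have h3 : (al⁻¹ * c + d) ^ 2 = 0 := by linarith
    exact pow_eq_zero_iff (two_ne_zero) |>.mp h3
  have h3 : c ^ 2 = al ^ 2 * N := by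
    rw [h2, e3] at hq
    have : R.F u y * (al⁻¹ ^ 3 * (al ^ 2 * N - c ^ 2)) = 0 := by linarith
    have hne : R.F u y ≠ 0 := hFpos.ne'
    have hne2 : al⁻¹ ^ 3 ≠ 0 := by positivity
    have := (mul_eq_zero.mp ((mul_eq_zero.mp this).resolve_left hne)).resolve_left hne2
    linarith
  have h4 := heq h3
  have hb : al ^ 2 * d = c * R.beta u y := by
    rw [hd, beta, contr, mul_sum, mul_sum]
    exact sum_congr rfl fun i _ => by linear_combination R.b u i * h4 i
  have hc0 : c = 0 := by
    have : c * R.F u y = 0 := by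
      have e5 : al * (al⁻¹ * c + d) * al = 0 := by rw [h2]; ring
      have e6 : al * al⁻¹ = 1 := mul_inv_cancel₀ halpos.ne'
      rw [F, ← hal]
      linear_combination e5 - c * al * e6 - hb
    exact (mul_eq_zero.mp this).resolve_right hFpos.ne'
  apply hv
  funext i
  have := h4 i
  rw [← hc, hc0, zero_mul] at this
  exact (mul_eq_zero.mp this).resolve_left (by positivity)

/-- The Ricci curvature of the Randers metric. -/
theorem rep_ricci_F : Rep (ricci R.F) ((smoothCalculus R.U (punct n)).ric R.randers.G) :=
  rep_ricci (rep_geodCoeff R.rep_energy_F R.randers.vert_G_Y_energy fun p =>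
    R.det_fundTensor_F_ne_zero p.2.1 p.2.2)

end LocalRanders

end
end RandersSoliton

namespace RandersSoliton
noncomputable section
open Set TopologicalSpace
open SmoothFun Finset

/-! ### The Lie derivative along the complete lift -/

/-- The bilinear form with matrix `m`, not necessarily symmetric. -/
def bil {n : ℕ} (m : Fin n → Fin n → ℝ) (x y : Coord n) : ℝ := ∑ i, ∑ j, m i j * x i * y j

theorem contr₂_smul_add {n : ℕ} (m : Fin n → Fin n → ℝ) (t : ℝ) (x y : Coord n) :
    contr₂ m (t • x + y) = contr₂ m x * t ^ 2 + (bil m x y + bil m y x) * t + contr₂ m y := by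
  simp only [contr₂, bil, sum_mul, ← sum_add_distrib]
  exact sum_congr rfl fun i _ => sum_congr rfl fun j _ => by simp; ring

theorem contr_smul_add {n : ℕ} (w : Fin n → ℝ) (t : ℝ) (x y : Coord n) :
    contr w (t • x + y) = contr w x * t + contr w y := by
  simp only [contr, sum_mul, ← sum_add_distrib]
  exact sum_congr rfl fun i _ => by simp; ring

theorem contr₂_single {n : ℕ} (m : Fin n → Fin n → ℝ) (i : Fin n) :
    contr₂ m (EuclideanSpace.single i 1) = m i i := by
  simp [contr₂]

theorem bil_single {n : ℕ} (m : Fin n → Fin n → ℝ) (i j : Fin n) :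
    bil m (EuclideanSpace.single i 1) (EuclideanSpace.single j 1) = m i j := by
  simp [bil]

theorem contr_single {n : ℕ} (m : Fin n → ℝ) (i : Fin n) :
    contr m (EuclideanSpace.single i 1) = m i := by
  simp [contr]

/-- Polarization. -/
theorem add_swap_eq_of_contr₂_eq {n : ℕ} {m m' : Fin n → Fin n → ℝ}
    (h : ∀ y, contr₂ m y = contr₂ m' y) (i j : Fin n) : m i j + m j i = m' i j + m' j i := by
  have h1 := h ((1 : ℝ) • EuclideanSpace.single i 1 + EuclideanSpace.single j 1)
  have h2 := h (EuclideanSpace.single i 1)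
  have h3 := h (EuclideanSpace.single j 1)
  rw [contr₂_smul_add, contr₂_smul_add] at h1
  simp only [bil_single, contr₂_single] at h1 h2 h3
  linarith

theorem contr₂_eq_of_add_swap_eq {n : ℕ} {m m' : Fin n → Fin n → ℝ}
    (h : ∀ i j, m i j + m j i = m' i j + m' j i) (y : Coord n) : contr₂ m y = contr₂ m' y := by
  have key : ∀ m : Fin n → Fin n → ℝ, contr₂ m y = (1 / 2) * contr₂ (fun i j => m i j + m j i) y := by
    intro m
    have h1 : contr₂ m y = ∑ i, ∑ j, m j i * y i * y j := by
      rw [contr₂, sum_comm]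
      exact sum_congr rfl fun i _ => sum_congr rfl fun j _ => by ring
    have h2 : contr₂ (fun i j => m i j + m j i) y = contr₂ m y + contr₂ m y := by
      nth_rewrite 2 [h1]
      simp only [contr₂, ← sum_add_distrib]
      exact sum_congr rfl fun i _ => sum_congr rfl fun j _ => by ring
    rw [h2]; ring
  rw [key m, key m']
  simp only [h]

section LieAt
variable {n : ℕ} {U W : Opens (Coord n)} (v : Coord n → Fin n → ℝ)

/-- The Lie derivative along the complete lift of `v` of a function on `U × W`, at a point. It is defined
pointwise because `v` is not assumed to be smooth. -/
def lieAt (p : prodOpens U W) (f : SmoothFun (prodOpens U W)) : ℝ :=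
  (∑ i, v p.1.1 i * ((smoothCalculus U W).X i f).1 p)
    + ∑ i, ∑ j, p.1.2 j * pd j (fun w => v w i) p.1.1 * ((smoothCalculus U W).Y i f).1 p

theorem lieLift_eq_lieAt {L : Coord n → Coord n → ℝ} {f : SmoothFun (prodOpens U W)} (h : Rep L f)
    (p : prodOpens U W) : lieLift v L p.1.1 p.1.2 = lieAt v p f := by
  simp only [lieLift, lieAt, fun i => h.dx i p, fun i => h.dy i p]

theorem lieAt_add (p : prodOpens U W) (f g : SmoothFun (prodOpens U W)) :
    lieAt v p (f + g) = lieAt v p f + lieAt v p g := by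
  simp only [lieAt, map_add, val_add, mul_add, sum_add_distrib]
  ring

theorem lieAt_mul (p : prodOpens U W) (f g : SmoothFun (prodOpens U W)) :
    lieAt v p (f * g) = f.1 p * lieAt v p g + g.1 p * lieAt v p f := by
  simp only [lieAt, Derivation.leibniz, val_add, val_mul, smul_eq_mul, mul_add, sum_add_distrib,
    mul_sum]
  simp only [mul_left_comm, mul_assoc]
  ring

end LieAt

namespace LocalRanders
variable {n : ℕ} (R : LocalRanders n) {v : Coord n → Fin n → ℝ}

theorem differentiableAt_a {u : Coord n} (hu : u ∈ R.U) (i j : Fin n) :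
    DifferentiableAt ℝ (fun w => R.a w i j) u :=
  ((R.smooth_a i j).contDiffAt (R.U.2.mem_nhds hu)).differentiableAt (by simp)

theorem covD_lower {u : Coord n} (hu : u ∈ R.U)
    (hv : ∀ i, DifferentiableAt ℝ (fun w => v w i) u) (i j : Fin n) :
    covD R.a (lower R.a v) u i j = ∑ l, (pd j (fun w => R.a w i l) u * v u l
      + R.a u i l * pd j (fun w => v w l) u
      - v u l * ((1 / 2) * (pd j (fun w => R.a w l i) u + pd i (fun w => R.a w l j) u
        - pd l (fun w => R.a w i j) u))) := by
  let p : prodOpens R.U ⊤ := ⟨(u, 0), hu, trivial⟩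
  have h1 : pd j (fun w => lower R.a v w i) u = ∑ l, (pd j (fun w => R.a w i l) u * v u l
      + R.a u i l * pd j (fun w => v w l) u) := by
    simp only [pd, lower]
    have hd : HasFDerivAt (fun w => ∑ l, R.a w i l * v w l) _ u :=
      HasFDerivAt.fun_sum (u := univ) fun l _ =>
        (R.differentiableAt_a hu i l).hasFDerivAt.fun_mul (hv l).hasFDerivAt
    rw [hd.fderiv, _root_.sum_apply]
    refine sum_congr rfl fun l _ => ?_
    simp
    ring
  have h2 : ∀ l, ∑ k, R.a u l k * christoffel R.a u k i j = (1 / 2) * (pd j (fun w => R.a w l i) u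
      + pd i (fun w => R.a w l j) u - pd l (fun w => R.a w i j) u) := by
    intro l
    have e := congrFun (congrArg Subtype.val ((R.metric ⊤).flat_chr l i j)) p
    have e1 : ((R.metric ⊤).chrL l i j).1 p = (1 / 2) * (pd j (fun w => R.a w l i) u
      + pd i (fun w => R.a w l j) u - pd l (fun w => R.a w i j) u) :=
      (((((R.rep_a ⊤ l i).dx j).add ((R.rep_a ⊤ l j).dx i)).sub
        ((R.rep_a ⊤ i j).dx l)).smul (1 / 2) p).symm
    rw [← e1, ← e, FiberMetric.flat, val_sum]
    exact sum_congr rfl fun k _ => by rw [val_mul, ← R.rep_chr ⊤ k i j p]; rfl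
  have h3 : ∑ k, christoffel R.a u k i j * lower R.a v u k
      = ∑ l, v u l * ((1 / 2) * (pd j (fun w => R.a w l i) u
        + pd i (fun w => R.a w l j) u - pd l (fun w => R.a w i j) u)) := by
    simp only [← h2, lower, mul_sum]
    rw [sum_comm]
    exact sum_congr rfl fun l _ => sum_congr rfl fun k _ => by rw [R.symm u l k]; ring
  rw [covD, h1, h3, ← sum_sub_distrib]

/-- `ℒ_{V̂}(α²) = 2 V_{0;0}`, the Lie derivative of the metric. -/
theorem lieAt_en {W : Opens (Coord n)} (p : prodOpens R.U W)
    (hv : ∀ i, DifferentiableAt ℝ (fun w => v w i) p.1.1) :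
    lieAt v p (R.metric W).en = 2 * contr₂ (covD R.a (lower R.a v) p.1.1) p.1.2 := by
  obtain ⟨⟨u, y⟩, hu, hy⟩ := p
  dsimp only at hv
  have hX : ∀ k, ((smoothCalculus R.U W).X k (R.metric W).en).1 ⟨(u, y), hu, hy⟩
      = ∑ i, ∑ j, pd k (fun w => R.a w i j) u * y i * y j := by
    intro k
    simp only [FiberMetric.en, FiberMetric.flat, sum_mul, map_sum, Derivation.leibniz, smul_eq_mul,
      (smoothCalculus R.U W).X_y, mul_zero, zero_add]
    rw [val_sum]
    refine sum_congr rfl fun i _ => ?_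
    rw [val_sum]
    refine sum_congr rfl fun j _ => ?_
    have := (R.rep_a W i j).dx k ⟨(u, y), hu, hy⟩
    rw [val_mul, val_mul, ← this]
    change y i * (y j * pd k _ u) = _
    ring
  have hY : ∀ k, ((smoothCalculus R.U W).Y k (R.metric W).en).1 ⟨(u, y), hu, hy⟩
      = 2 * ∑ l, R.a u k l * y l := by
    intro k
    rw [(R.metric W).Y_en, val_mul, val_two, FiberMetric.flat, val_sum]
    rfl
  rw [lieAt]
  simp only [hX, hY]
  have e1 : contr₂ (covD R.a (lower R.a v) u) y
      = (∑ i, ∑ j, ∑ l, pd j (fun w => R.a w l i) u * v u l * y i * y j)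
      + (∑ i, ∑ j, ∑ l, R.a u i l * pd j (fun w => v w l) u * y i * y j)
      - (1 / 2) * (∑ i, ∑ j, ∑ l, pd j (fun w => R.a w l i) u * v u l * y i * y j)
      - (1 / 2) * (∑ i, ∑ j, ∑ l, pd i (fun w => R.a w l j) u * v u l * y i * y j)
      + (1 / 2) * (∑ i, ∑ j, ∑ l, pd l (fun w => R.a w i j) u * v u l * y i * y j) := by
    simp only [contr₂, R.covD_lower hu hv, mul_sum, sum_mul, ← sum_add_distrib, ← sum_sub_distrib]
    refine sum_congr rfl fun i _ => sum_congr rfl fun j _ => sum_congr rfl fun l _ => ?_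
    simp only [R.symm _ i l]
    ring
  have e2 : (∑ i, ∑ j, ∑ l, pd i (fun w => R.a w l j) u * v u l * y i * y j)
      = ∑ i, ∑ j, ∑ l, pd j (fun w => R.a w l i) u * v u l * y i * y j := by
    rw [sum_comm]
    exact sum_congr rfl fun i _ => sum_congr rfl fun j _ => sum_congr rfl fun l _ => by ring
  have e3 : (∑ k, v u k * ∑ i, ∑ j, pd k (fun w => R.a w i j) u * y i * y j)
      = ∑ i, ∑ j, ∑ l, pd l (fun w => R.a w i j) u * v u l * y i * y j := by
    simp only [mul_sum]
    rw [sum_comm]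
    refine sum_congr rfl fun i _ => ?_
    rw [sum_comm]
    exact sum_congr rfl fun j _ => sum_congr rfl fun l _ => by ring
  have e4 : (∑ i, ∑ j, y j * pd j (fun w => v w i) u * (2 * ∑ l, R.a u i l * y l))
      = 2 * ∑ i, ∑ j, ∑ l, R.a u i l * pd j (fun w => v w l) u * y i * y j := by
    simp only [mul_sum]
    rw [sum_comm]
    have : ∀ j : Fin n, (∑ i, ∑ l, y j * pd j (fun w => v w i) u * (2 * (R.a u i l * y l)))
        = ∑ i, ∑ l, 2 * (R.a u i l * pd j (fun w => v w l) u * y i * y j) := by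
      intro j
      rw [sum_comm]
      exact sum_congr rfl fun i _ => sum_congr rfl fun l _ => by rw [R.symm u l i]; ring
    simp only [this]
    rw [sum_comm]
  rw [e1, e2, e3, e4]
  ring

/-- `ℒ_{V̂} β` as a 1-form. -/
theorem lieLift_beta {u : Coord n} (hu : u ∈ R.U) (y : Coord n) :
    lieLift v R.beta u y = contr (fun j => (∑ k, v u k * pd k (fun w => R.b w j) u)
      + ∑ i, R.b u i * pd j (fun w => v w i) u) y := by
  have h := lieLift_eq_lieAt v (R.rep_beta ⊤) ⟨(u, y), hu, trivial⟩
  refine h.trans ?_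
  have hX : ∀ k, ((smoothCalculus R.U ⊤).X k (R.form ⊤).β).1 ⟨(u, y), hu, trivial⟩
      = ∑ j, pd k (fun w => R.b w j) u * y j := by
    intro k
    simp only [FiberForm.β, map_sum, Derivation.leibniz, smul_eq_mul,
      (smoothCalculus R.U ⊤).X_y, mul_zero, zero_add]
    rw [val_sum]
    refine sum_congr rfl fun j _ => ?_
    rw [val_mul, ← (R.rep_b ⊤ j).dx k ⟨(u, y), hu, trivial⟩, mul_comm]
    rfl
  have hY : ∀ k, ((smoothCalculus R.U ⊤).Y k (R.form ⊤).β).1 ⟨(u, y), hu, trivial⟩ = R.b u k := by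
    intro k
    rw [(R.form ⊤).Y_β]; rfl
  rw [lieAt]
  simp only [hX, hY, contr, add_mul, sum_mul, sum_add_distrib, mul_sum]
  congr 1
  · rw [sum_comm]
    exact sum_congr rfl fun i _ => sum_congr rfl fun j _ => by ring
  · rw [sum_comm]
    exact sum_congr rfl fun i _ => sum_congr rfl fun j _ => by ring

/-- `ℒ_{V̂}(F²) = 2F (V_{0;0}/α + ℒ_{V̂} β)`, multiplied by `α`. -/
theorem lieLift_energy_F {u : Coord n} (hu : u ∈ R.U)
    (hv : ∀ i, DifferentiableAt ℝ (fun w => v w i) u) {y : Coord n} (hy : y ≠ 0) :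
    R.alpha u y * lieLift v (energy R.F) u y = 2 * R.F u y *
      (contr₂ (covD R.a (lower R.a v) u) y + R.alpha u y * lieLift v R.beta u y) := by
  let p : prodOpens R.U (punct n) := ⟨(u, y), hu, hy⟩
  have h1 : lieLift v (energy R.F) u y = lieAt v p (R.randers.F ^ 2) :=
    lieLift_eq_lieAt v R.rep_energy_F p
  have h2 : lieLift v R.beta u y = lieAt v p (R.form _).β := lieLift_eq_lieAt v (R.rep_beta _) p
  have h3 := R.lieAt_en p hv
  rw [← R.randers.α_sq, lieAt_mul] at h3
  rw [h1, h2, pow_two, lieAt_mul, FiberRanders.F, lieAt_add]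
  have hα : R.randers.α.1 p = R.alpha u y := rfl
  have hF : (R.randers.α + R.randers.β).1 p = R.F u y := (R.rep_F p).symm
  have hb : R.randers.β = (R.form (punct n)).β := rfl
  rw [hF, hb]
  rw [hα] at h3
  linear_combination R.F u y * h3

end LocalRanders

end
end RandersSoliton

namespace RandersSoliton
noncomputable section
open Set TopologicalSpace
open SmoothFun Finset

/-! ### Polynomials on a conic -/

section Conic
open Polynomial

/-- The ring of polynomial functions on the conic `z² = x² + 1`, with `z = √(x² + 1)` for real `x`. -/
abbrev ConicRing : Type := QuadraticAlgebra ℝ[X] (X ^ 2 + 1) 0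

/-- Evaluation at a complex point of the conic `z² = x² + 1`. -/
def conicEval (x z : ℂ) (h : z ^ 2 = x ^ 2 + 1) : ConicRing →+* ℂ where
  toFun r := aeval x r.re + z * aeval x r.im
  map_one' := by simp [QuadraticAlgebra.re_one, QuadraticAlgebra.im_one]
  map_zero' := by simp [QuadraticAlgebra.re_zero, QuadraticAlgebra.im_zero]
  map_add' r s := by
    simp only [QuadraticAlgebra.re_add, QuadraticAlgebra.im_add, map_add]; ring
  map_mul' r s := by
    simp only [QuadraticAlgebra.re_mul, QuadraticAlgebra.im_mul, map_add, map_mul, map_pow, aeval_X,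
      map_one, zero_mul, add_zero]
    linear_combination -(aeval x r.im * aeval x s.im) * h

theorem conicEval_algebraMap (x z : ℂ) (h : z ^ 2 = x ^ 2 + 1) (f : ℝ[X]) :
    conicEval x z h (algebraMap ℝ[X] ConicRing f) = aeval x f := by
  simp [conicEval]

theorem conicEval_root (x z : ℂ) (h : z ^ 2 = x ^ 2 + 1) : conicEval x z h ⟨0, 1⟩ = z := by
  simp [conicEval]

/-- The polynomial `x² + 1` has odd multiplicity at its root `i`, and is therefore not a square. -/
theorem eq_zero_of_sq_eq {f g : ℝ[X]} (h : f ^ 2 = (X ^ 2 + 1) * g ^ 2) : g = 0 := by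
  by_contra hg
  have hg' : g.map (algebraMap ℝ ℂ) ≠ 0 := by simpa using hg
  have e := congrArg (Polynomial.map (algebraMap ℝ ℂ)) h
  simp only [Polynomial.map_mul, Polynomial.map_pow, Polynomial.map_add, map_X,
    Polynomial.map_one] at e
  have e1 : (X ^ 2 + 1 : ℂ[X]) = (X - C Complex.I) * (X - C (-Complex.I)) := by
    have : (C Complex.I : ℂ[X]) ^ 2 = -1 := by rw [← C_pow, Complex.I_sq]; simp
    rw [C_neg]
    linear_combination this
  have hI : (X - C Complex.I : ℂ[X]) ≠ 0 := X_sub_C_ne_zero _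
  have hI' : (X - C (-Complex.I) : ℂ[X]) ≠ 0 := X_sub_C_ne_zero _
  have hne : Complex.I ≠ -Complex.I := by
    intro hh
    have := congrArg Complex.im hh
    norm_num at this
  have hf' : (f.map (algebraMap ℝ ℂ)) ^ 2 ≠ 0 := by
    rw [e, e1]
    exact mul_ne_zero (mul_ne_zero hI hI') (pow_ne_zero 2 hg')
  have hr := congrArg (rootMultiplicity Complex.I) e
  rw [e1, rootMultiplicity_mul (by rw [← e1, ← e]; exact hf'),
    rootMultiplicity_mul (mul_ne_zero hI hI'), rootMultiplicity_X_sub_C_self,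
    rootMultiplicity_X_sub_C, if_neg hne, pow_two, pow_two,
    rootMultiplicity_mul (by rw [← pow_two]; exact hf'),
    rootMultiplicity_mul (mul_ne_zero hg' hg')] at hr
  omega

/-- A polynomial expression in `x` and `√(x² + 1)` that vanishes for all real `x` vanishes at all complex
points of the conic. -/
theorem conicEval_eq_zero {P : ConicRing}
    (h : ∀ x : ℝ, P.re.eval x + √(x ^ 2 + 1) * P.im.eval x = 0) (x z : ℂ)
    (hz : z ^ 2 = x ^ 2 + 1) : conicEval x z hz P = 0 := by
  have h1 : P.re ^ 2 = (X ^ 2 + 1) * P.im ^ 2 := by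
    apply Polynomial.funext
    intro x
    have e := Real.sq_sqrt (show (0 : ℝ) ≤ x ^ 2 + 1 by positivity)
    simp only [eval_mul, eval_pow, eval_add, eval_X, eval_one]
    linear_combination (P.re.eval x - √(x ^ 2 + 1) * P.im.eval x) * h x + P.im.eval x ^ 2 * e
  have h2 := eq_zero_of_sq_eq h1
  have h3 : P.re = 0 := by
    rw [h2] at h1
    simpa using h1
  simp [conicEval, h2, h3]

/-- The almost Ricci soliton equation of a Randers metric, multiplied by `4αF²`, along the affine line
`x m + p` in a tangent space, where `m = b♯/‖b♯‖` and `p` is a unit vector orthogonal to `m`, so that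
`α² = x² + 1` and `β = k x` with `k = ‖β‖`. The other arguments stand for `N = n - 1`, `T = tⁱᵢ`,
`ρ = ᵅRic`, `D = sⁱ_{0;i}`, `t = t₀₀`, `e = e₀₀`, `s = s₀`, `e₁ = e_{00;0}`, `e₂ = sⁱ₀ ∂e₀₀/∂yⁱ`,
`s' = s_{0;0}`, `t' = t₀`, `V = V_{0;0}` and `l = ℒ_{V̂}β`. -/
def solitonPoly {A : Type*} [CommRing A] (N T κ k x α ρ D t e s e₁ e₂ s' t' V l : A) : A :=
  4 * α * (α + k * x) ^ 2 * (ρ + 2 * α * D - 2 * t - α ^ 2 * T)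
    + N * α * (3 * e ^ 2 - 8 * (α + k * x) * e * s + 4 * (α + k * x) ^ 2 * s ^ 2
      - 2 * (α + k * x) * (e₁ - 2 * α * e₂) + 4 * (α + k * x) ^ 2 * (s' - 2 * α * t'))
    + 4 * (α + k * x) ^ 3 * V + 4 * α * (α + k * x) ^ 3 * l - 4 * κ * α * (α + k * x) ^ 4

/-- The soliton equation along an affine line persists at all complex points of the conic
`α² = x² + 1`. -/
theorem solitonPoly_complex {N T κ k : ℝ} {ρ D t e s e₁ e₂ s' t' V l : ℝ[X]}
    (h : ∀ x : ℝ, solitonPoly N T κ k x √(x ^ 2 + 1) (ρ.eval x) (D.eval x) (t.eval x) (e.eval x)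
      (s.eval x) (e₁.eval x) (e₂.eval x) (s'.eval x) (t'.eval x) (V.eval x) (l.eval x) = 0)
    (x z : ℂ) (hz : z ^ 2 = x ^ 2 + 1) :
    solitonPoly (N : ℂ) T κ k x z (aeval x ρ) (aeval x D) (aeval x t) (aeval x e) (aeval x s)
      (aeval x e₁) (aeval x e₂) (aeval x s') (aeval x t') (aeval x V) (aeval x l) = 0 := by
  let a := algebraMap ℝ[X] ConicRing
  let P : ConicRing := solitonPoly (a (C N)) (a (C T)) (a (C κ)) (a (C k)) (a X) ⟨0, 1⟩
    (a ρ) (a D) (a t) (a e) (a s) (a e₁) (a e₂) (a s') (a t') (a V) (a l)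
  have hP : ∀ (x z : ℂ) (hz : z ^ 2 = x ^ 2 + 1), conicEval x z hz P
      = solitonPoly (N : ℂ) T κ k x z (aeval x ρ) (aeval x D) (aeval x t) (aeval x e) (aeval x s)
      (aeval x e₁) (aeval x e₂) (aeval x s') (aeval x t') (aeval x V) (aeval x l) := by
    intro x z hz
    simp only [P, solitonPoly, map_add, map_sub, map_mul, map_pow, map_ofNat, a,
      conicEval_algebraMap, conicEval_root, aeval_C, aeval_X]
    rfl
  rw [← hP x z hz]
  refine conicEval_eq_zero (fun x => ?_) x z hz
  have hx : (((√(x ^ 2 + 1) : ℝ) : ℂ)) ^ 2 = (x : ℂ) ^ 2 + 1 := by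
    rw [← Complex.ofReal_pow, Real.sq_sqrt (by positivity)]
    simp
  have h1 := hP x √(x ^ 2 + 1) hx
  have h2 := congrArg (fun r : ℝ => (r : ℂ)) (h x)
  have h3 : ∀ f : ℝ[X], aeval (x : ℂ) f = ((f.eval x : ℝ) : ℂ) := fun f =>
    aeval_algebraMap_apply_eq_algebraMap_eval x f
  simp only [h3] at h1
  have h4 : conicEval x √(x ^ 2 + 1) hx P = 0 := by
    rw [h1]
    simp only [solitonPoly] at h2 ⊢
    push_cast at h2
    exact h2
  simp only [conicEval, RingHom.coe_mk, MonoidHom.coe_mk, OneHom.coe_mk, h3] at h4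
  exact_mod_cast h4

/-- A real quadratic polynomial with the root `r i` is a multiple of `x² + r²`. -/
theorem quadratic_root_I {v₂ v₁ v₀ r : ℝ} (hr : r ≠ 0)
    (h : (v₂ : ℂ) * (r * Complex.I) ^ 2 + v₁ * (r * Complex.I) + v₀ = 0) :
    v₀ = v₂ * r ^ 2 ∧ v₁ = 0 := by
  rw [mul_pow, Complex.I_sq] at h
  have hre := congrArg Complex.re h
  have him := congrArg Complex.im h
  simp [← Complex.ofReal_pow] at hre him
  exact ⟨by linarith, him.resolve_right hr⟩

/-- At the complex points of the conic where `α = 0`, respectively `F = α + β = 0`, the soliton equation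
degenerates to `β³ V₀₀ = 0`, respectively `α e₀₀² = 0`. Thus `V₀₀` is a multiple of `α² = x² + 1`, and
`e₀₀` is a multiple of `α² - β² = (1 - k²) x² + 1`. -/
theorem solitonPoly_roots {N T κ k : ℝ} {ρ D t s e₁ e₂ s' t' l : ℝ[X]} {v₂ v₁ v₀ c₂ c₁ c₀ : ℝ}
    (hN : N ≠ 0) (hk : 0 < k) (hk1 : k < 1)
    (h : ∀ x : ℝ, solitonPoly N T κ k x √(x ^ 2 + 1) (ρ.eval x) (D.eval x) (t.eval x)
      (c₂ * x ^ 2 + c₁ * x + c₀)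
      (s.eval x) (e₁.eval x) (e₂.eval x) (s'.eval x) (t'.eval x) (v₂ * x ^ 2 + v₁ * x + v₀)
      (l.eval x) = 0) :
    (v₀ = v₂ ∧ v₁ = 0) ∧ (c₂ = (1 - k ^ 2) * c₀ ∧ c₁ = 0) := by
  let V : ℝ[X] := C v₂ * X ^ 2 + C v₁ * X + C v₀
  let e : ℝ[X] := C c₂ * X ^ 2 + C c₁ * X + C c₀
  have hV : ∀ x, V.eval x = v₂ * x ^ 2 + v₁ * x + v₀ := by intro x; simp [V]
  have he : ∀ x, e.eval x = c₂ * x ^ 2 + c₁ * x + c₀ := by intro x; simp [e]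
  simp only [← hV, ← he] at h
  have hc := solitonPoly_complex h
  constructor
  · -- the point `x = i` with `α = 0`
    have h1 := hc Complex.I 0 (by simp)
    have hkI : (k : ℂ) * Complex.I ≠ 0 := mul_ne_zero (by exact_mod_cast hk.ne') Complex.I_ne_zero
    have h2 : 4 * ((k : ℂ) * Complex.I) ^ 3 * aeval Complex.I V = 0 := by
      rw [← h1, solitonPoly]; ring
    have h3 := (mul_eq_zero.mp h2).resolve_left (mul_ne_zero (by norm_num) (pow_ne_zero 3 hkI))
    have := quadratic_root_I (v₂ := v₂) (v₁ := v₁) (v₀ := v₀) one_ne_zero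
      (by rw [← h3]; simp [V])
    simpa using this
  · -- the point `x = r i`, `α = -k x`, where `r² (1 - k²) = 1`; here `F = α + β = 0`
    have h0 : 0 < 1 - k ^ 2 := by nlinarith
    set r := (√(1 - k ^ 2))⁻¹ with hr
    have hr0 : 0 < r := by positivity
    have hr2 : r ^ 2 * (1 - k ^ 2) = 1 := by
      rw [hr, inv_pow, Real.sq_sqrt h0.le]; field_simp
    have hr2' : (r : ℂ) ^ 2 * (1 - (k : ℂ) ^ 2) = 1 := by exact_mod_cast hr2
    have h1 := hc (r * Complex.I) (-(k * (r * Complex.I))) (by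
      linear_combination ((k : ℂ) ^ 2 - 1) * (r : ℂ) ^ 2 * Complex.I_sq + hr2')
    have hz : (k : ℂ) * (r * Complex.I) ≠ 0 := mul_ne_zero (by exact_mod_cast hk.ne')
      (mul_ne_zero (by exact_mod_cast hr0.ne') Complex.I_ne_zero)
    have h2 : (-(N : ℂ) * 3) * ((k : ℂ) * (r * Complex.I)) * (aeval (r * Complex.I) e) ^ 2 = 0 := by
      rw [← h1, solitonPoly]; ring
    have hN' : (N : ℂ) ≠ 0 := by exact_mod_cast hN
    have h3 := pow_eq_zero_iff two_ne_zero |>.mp ((mul_eq_zero.mp h2).resolve_left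
      (mul_ne_zero (mul_ne_zero (neg_ne_zero.mpr hN') (by norm_num)) hz))
    have h4 := quadratic_root_I (v₂ := c₂) (v₁ := c₁) (v₀ := c₀) hr0.ne'
      (by rw [← h3]; simp [e])
    refine ⟨?_, h4.2⟩
    rw [h4.1]
    linear_combination -c₂ * hr2

end Conic

end
end RandersSoliton

namespace RandersSoliton
noncomputable section
open Set TopologicalSpace
open SmoothFun Finset

/-! ### Functions that are polynomial on the fibres -/

section FiberPolynomials
variable {n : ℕ} {U W : Opens (Coord n)}

variable (U W) in
/-- The functions that are polynomial in `y` with coefficients smooth in `x`. All tensorial quantities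
built from `a` and `b` lie in this algebra, in contrast to `α`. -/
def fiberPoly : Subalgebra ℝ (SmoothFun (prodOpens U W)) :=
  Algebra.adjoin ℝ ({f | ∃ w h, f = base W w h} ∪ range (smoothCalculus U W).y)

theorem base_mem (w : Coord n → ℝ) (h : ContDiffOn ℝ ∞ w U) : base W w h ∈ fiberPoly U W :=
  Algebra.subset_adjoin (Or.inl ⟨w, h, rfl⟩)

theorem y_mem (i : Fin n) : (smoothCalculus U W).y i ∈ fiberPoly U W :=
  Algebra.subset_adjoin (Or.inr ⟨i, rfl⟩)

theorem derivation_mem (d : Derivation ℝ (SmoothFun (prodOpens U W)) (SmoothFun (prodOpens U W)))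
    (h1 : ∀ w h, d (base W w h) ∈ fiberPoly U W)
    (h2 : ∀ i, d ((smoothCalculus U W).y i) ∈ fiberPoly U W) {f : SmoothFun (prodOpens U W)}
    (hf : f ∈ fiberPoly U W) : d f ∈ fiberPoly U W := by
  induction hf using Algebra.adjoin_induction with
  | mem f hf =>
    rcases hf with ⟨w, h, rfl⟩ | ⟨i, rfl⟩
    · exact h1 w h
    · exact h2 i
  | algebraMap r => simp
  | add f g _ _ hf hg => rw [map_add]; exact add_mem hf hg
  | mul f g hf' hg' hf hg =>
    rw [Derivation.leibniz, smul_eq_mul, smul_eq_mul]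
    exact add_mem (mul_mem hf' hg) (mul_mem hg' hf)

theorem contDiffOn_pd {w : Coord n → ℝ} (h : ContDiffOn ℝ ∞ w U) (k : Fin n) :
    ContDiffOn ℝ ∞ (pd k w) U :=
  (h.fderiv_of_isOpen U.2 (m := ∞) (by simp)).clm_apply contDiffOn_const

theorem X_base (w : Coord n → ℝ) (h : ContDiffOn ℝ ∞ w U) (k : Fin n) :
    (smoothCalculus U W).X k (base W w h) = base W (pd k w) (contDiffOn_pd h k) :=
  Subtype.ext (funext fun p => ((rep_base W w h).dx k p).symm)

theorem X_mem {f : SmoothFun (prodOpens U W)} (hf : f ∈ fiberPoly U W) (k : Fin n) :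
    (smoothCalculus U W).X k f ∈ fiberPoly U W :=
  derivation_mem _ (fun w h => by rw [X_base]; exact base_mem _ _)
    (fun i => by rw [(smoothCalculus U W).X_y]; exact zero_mem _) hf

theorem Y_mem {f : SmoothFun (prodOpens U W)} (hf : f ∈ fiberPoly U W) (k : Fin n) :
    (smoothCalculus U W).Y k f ∈ fiberPoly U W :=
  derivation_mem _ (fun w h => by rw [isBasic_of_rep (rep_base W w h)]; exact zero_mem _)
    (fun i => by
      rw [(smoothCalculus U W).Y_y]
      split_ifs
      exacts [one_mem _, zero_mem _]) hf

theorem vert_mem {Z : Fin n → SmoothFun (prodOpens U W)} (hZ : ∀ i, Z i ∈ fiberPoly U W)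
    {f : SmoothFun (prodOpens U W)} (hf : f ∈ fiberPoly U W) :
    (smoothCalculus U W).vert Z f ∈ fiberPoly U W := by
  rw [FiberCalculus.vert_apply]
  exact sum_mem fun i _ => mul_mem (hZ i) (Y_mem hf i)

theorem euler_mem {f : SmoothFun (prodOpens U W)} (hf : f ∈ fiberPoly U W) :
    (smoothCalculus U W).euler f ∈ fiberPoly U W := by
  rw [FiberCalculus.euler_apply]
  exact sum_mem fun i _ => mul_mem (y_mem i) (X_mem hf i)

theorem vtr_mem {Z : Fin n → SmoothFun (prodOpens U W)} (hZ : ∀ i, Z i ∈ fiberPoly U W) :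
    (smoothCalculus U W).vtr Z ∈ fiberPoly U W :=
  sum_mem fun i _ => Y_mem (hZ i) i

theorem two_mul_mem' {f : SmoothFun (prodOpens U W)} (hf : f ∈ fiberPoly U W) :
    2 * f ∈ fiberPoly U W := by
  rw [two_mul]; exact add_mem hf hf

theorem ric_mem {Z : Fin n → SmoothFun (prodOpens U W)} (hZ : ∀ i, Z i ∈ fiberPoly U W) :
    (smoothCalculus U W).ric Z ∈ fiberPoly U W := by
  rw [FiberCalculus.ric]
  exact sub_mem (add_mem (sub_mem (two_mul_mem' (sum_mem fun i _ => X_mem (hZ i) i))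
    (euler_mem (vtr_mem hZ))) (two_mul_mem' (vert_mem hZ (vtr_mem hZ))))
    (sum_mem fun i _ => sum_mem fun j _ => mul_mem (Y_mem (hZ i) j) (Y_mem (hZ j) i))

/-- Along an affine line in a fibre, the functions in `fiberPoly` are polynomials. -/
theorem exists_polynomial {f : SmoothFun (prodOpens U W)} (hf : f ∈ fiberPoly U W) {u : Coord n}
    (hu : u ∈ U) (m p : Coord n) (hW : ∀ x : ℝ, x • m + p ∈ W) :
    ∃ P : Polynomial ℝ, ∀ x : ℝ, f.1 ⟨(u, x • m + p), hu, hW x⟩ = P.eval x := by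
  induction hf using Algebra.adjoin_induction with
  | mem f hf =>
    rcases hf with ⟨w, h, rfl⟩ | ⟨i, rfl⟩
    · exact ⟨Polynomial.C (w u), fun x => by simp [base]⟩
    · refine ⟨Polynomial.C (m i) * Polynomial.X + Polynomial.C (p i), fun x => ?_⟩
      change (x • m + p) i = _
      simp
      ring
  | algebraMap r => exact ⟨Polynomial.C r, fun x => by rw [val_algebraMap]; simp⟩
  | add f g _ _ hf hg =>
    obtain ⟨P, hP⟩ := hf
    obtain ⟨Q, hQ⟩ := hg
    exact ⟨P + Q, fun x => by rw [val_add, hP, hQ, Polynomial.eval_add]⟩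
  | mul f g _ _ hf hg =>
    obtain ⟨P, hP⟩ := hf
    obtain ⟨Q, hQ⟩ := hg
    exact ⟨P * Q, fun x => by rw [val_mul, hP, hQ, Polynomial.eval_mul]⟩

end FiberPolynomials

namespace LocalRanders
variable {n : ℕ} (R : LocalRanders n) {W : Opens (Coord n)}

theorem a_mem (i j : Fin n) : (R.metric W).a i j ∈ fiberPoly R.U W :=
  base_mem _ (R.smooth_a i j)
theorem ai_mem (i j : Fin n) : (R.metric W).ai i j ∈ fiberPoly R.U W :=
  base_mem _ (R.smooth_inv i j)
theorem b_mem (i : Fin n) : (R.form W).b i ∈ fiberPoly R.U W :=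
  base_mem _ (R.smooth_b i)

theorem sharp_mem {w : Fin n → SmoothFun (prodOpens R.U W)} (hw : ∀ i, w i ∈ fiberPoly R.U W)
    (i : Fin n) : (R.metric W).sharp w i ∈ fiberPoly R.U W :=
  sum_mem fun k _ => mul_mem (R.ai_mem i k) (hw k)

theorem chr_mem (k i j : Fin n) : (R.metric W).chr k i j ∈ fiberPoly R.U W :=
  R.sharp_mem (fun _ => (fiberPoly R.U W).smul_mem ((fiberPoly R.U W).sub_mem
    ((fiberPoly R.U W).add_mem (X_mem (R.a_mem _ _) _) (X_mem (R.a_mem _ _) _))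
    (X_mem (R.a_mem _ _) _)) _) k

theorem conn_mem (i j : Fin n) : (R.metric W).conn i j ∈ fiberPoly R.U W :=
  sum_mem fun l _ => mul_mem (R.chr_mem _ _ _) (y_mem l)

theorem spray_mem (i : Fin n) : (R.metric W).spray i ∈ fiberPoly R.U W :=
  Subalgebra.smul_mem _ (sum_mem fun l _ => mul_mem (R.conn_mem _ _) (y_mem l)) _

theorem hor_mem {f : SmoothFun (prodOpens R.U W)} (hf : f ∈ fiberPoly R.U W) (k : Fin n) :
    (R.metric W).hor k f ∈ fiberPoly R.U W :=
  sub_mem (X_mem hf k) (vert_mem (fun i => R.conn_mem i k) hf)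

theorem geo_mem {f : SmoothFun (prodOpens R.U W)} (hf : f ∈ fiberPoly R.U W) :
    (R.metric W).geo f ∈ fiberPoly R.U W := by
  rw [FiberMetric.geo_apply]
  exact sum_mem fun k _ => mul_mem (y_mem k) (R.hor_mem hf k)

theorem hdiv_mem {Z : Fin n → SmoothFun (prodOpens R.U W)} (hZ : ∀ i, Z i ∈ fiberPoly R.U W) :
    (R.metric W).hdiv Z ∈ fiberPoly R.U W :=
  sum_mem fun i _ => add_mem (R.hor_mem (hZ i) i)
    (sum_mem fun j _ => mul_mem (R.chr_mem _ _ _) (hZ j))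

theorem s_mem (i j : Fin n) : (R.form W).s i j ∈ fiberPoly R.U W :=
  (fiberPoly R.U W).smul_mem
    ((fiberPoly R.U W).sub_mem (X_mem (R.b_mem _) _) (X_mem (R.b_mem _) _)) _

theorem sy_mem (i : Fin n) : (R.form W).sy i ∈ fiberPoly R.U W :=
  sum_mem fun j _ => mul_mem (R.s_mem i j) (y_mem j)

theorem S0_mem (i : Fin n) : (R.form W).S0 i ∈ fiberPoly R.U W := R.sharp_mem R.sy_mem i

theorem β_mem : (R.form W).β ∈ fiberPoly R.U W := sum_mem fun i _ => mul_mem (R.b_mem i) (y_mem i)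

theorem s0_mem : (R.form W).s0 ∈ fiberPoly R.U W :=
  sum_mem fun j _ => mul_mem (sum_mem fun i _ => mul_mem (R.sharp_mem R.b_mem i) (R.s_mem i j))
    (y_mem j)

theorem e00_mem : (R.form W).e00 ∈ fiberPoly R.U W := by
  rw [FiberForm.e00, mul_assoc]
  exact add_mem (R.geo_mem R.β_mem) (two_mul_mem' (mul_mem R.β_mem R.s0_mem))

theorem t00_mem : (R.form W).t00 ∈ fiberPoly R.U W :=
  neg_mem (sum_mem fun k _ => mul_mem (R.sy_mem k) (R.S0_mem k))

end LocalRanders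

/-- The Ricci curvature of a Randers metric, multiplied by `4F²` to remove the denominators of `P`. -/
theorem FiberRanders.four_F_sq_mul_ric {n : ℕ} {A : Type*} [CommRing A] [Algebra ℝ A]
    {K : FiberCalculus n A} {g : FiberMetric K} (η : FiberRanders g) :
    4 * η.F ^ 2 * K.ric η.G = 4 * η.F ^ 2 * (K.ric g.spray + 2 * η.α * g.hdiv η.S0 - 2 * η.t00
        - g.en * η.ttr) + ((n : A) - 1) * (3 * η.e00 ^ 2 - 8 * η.F * η.e00 * η.s0
        + 4 * η.F ^ 2 * η.s0 ^ 2 - 2 * η.F * (g.geo η.e00 - 2 * η.α * K.vert η.S0 η.e00)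
        + 4 * η.F ^ 2 * (η.s00 - 2 * η.α * η.t0)) := by
  have h := η.four_F_sq_mul
  rw [η.rgeo_apply η.e00] at h
  rw [η.ric_G]
  linear_combination ((n : A) - 1) * h

/-- Evaluation of an identity of the form of `four_F_sq_mul_ric` at a point, stated for generic
elements so that the evaluation does not unfold them. -/
theorem SmoothFun.val_ric {E : Type*} [NormedAddCommGroup E] [NormedSpace ℝ E] {Ω : Opens E}
    (p : Ω) {F r ρ α D t en T e s e₁ e₂ s' t' : SmoothFun Ω} {n : ℕ} {F₀ r₀ α₀ en₀ T₀ e₀ : ℝ}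
    (h : 4 * F ^ 2 * r = 4 * F ^ 2 * (ρ + 2 * α * D - 2 * t - en * T)
      + ((n : SmoothFun Ω) - 1) * (3 * e ^ 2 - 8 * F * e * s + 4 * F ^ 2 * s ^ 2
        - 2 * F * (e₁ - 2 * α * e₂) + 4 * F ^ 2 * (s' - 2 * α * t')))
    (hF : F₀ = F.1 p) (hr : r₀ = r.1 p) (hα : α₀ = α.1 p) (hen : en₀ = en.1 p) (hT : T₀ = T.1 p)
    (he : e₀ = e.1 p) :
    4 * F₀ ^ 2 * r₀ = 4 * F₀ ^ 2 * (ρ.1 p + 2 * α₀ * D.1 p - 2 * t.1 p - en₀ * T₀)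
      + ((n : ℝ) - 1) * (3 * e₀ ^ 2 - 8 * F₀ * e₀ * s.1 p + 4 * F₀ ^ 2 * s.1 p ^ 2
        - 2 * F₀ * (e₁.1 p - 2 * α₀ * e₂.1 p) + 4 * F₀ ^ 2 * (s'.1 p - 2 * α₀ * t'.1 p)) := by
  subst hF hr hα hen hT he
  have h8 : (8 : SmoothFun Ω).1 p = 8 := rfl
  have := congrFun (congrArg Subtype.val h) p
  simpa only [val_mul, val_sub, val_add, val_pow, val_two, val_three, val_four, val_natCast,
    val_one, h8] using this

namespace LocalRanders
variable {n : ℕ} (R : LocalRanders n)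

/-- The Ricci curvature of a Randers metric in coordinates, multiplied by `4F²`. -/
theorem four_F_sq_mul_ricci {u y : Coord n} (hu : u ∈ R.U) (hy : y ∈ punct n) :
    4 * R.F u y ^ 2 * ricci R.F u y = 4 * R.F u y ^ 2 *
      (((smoothCalculus R.U (punct n)).ric (R.metric _).spray).1 ⟨(u, y), hu, hy⟩
        + 2 * R.alpha u y * ((R.metric (punct n)).hdiv (R.form _).S0).1 ⟨(u, y), hu, hy⟩
        - 2 * (R.form (punct n)).t00.1 ⟨(u, y), hu, hy⟩ - R.alpha u y ^ 2 * tTrace R.a R.b u)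
      + ((n : ℝ) - 1) * (3 * contr₂ (eT R.a R.b u) y ^ 2
        - 8 * R.F u y * contr₂ (eT R.a R.b u) y * (R.form (punct n)).s0.1 ⟨(u, y), hu, hy⟩
        + 4 * R.F u y ^ 2 * (R.form (punct n)).s0.1 ⟨(u, y), hu, hy⟩ ^ 2
        - 2 * R.F u y * (((R.metric (punct n)).geo (R.form _).e00).1 ⟨(u, y), hu, hy⟩
          - 2 * R.alpha u y * ((smoothCalculus R.U (punct n)).vert (R.form _).S0
            (R.form _).e00).1 ⟨(u, y), hu, hy⟩)
        + 4 * R.F u y ^ 2 * ((R.form (punct n)).s00.1 ⟨(u, y), hu, hy⟩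
          - 2 * R.alpha u y * (R.form (punct n)).t0.1 ⟨(u, y), hu, hy⟩)) := by
  let p : prodOpens R.U (punct n) := ⟨(u, y), hu, hy⟩
  exact SmoothFun.val_ric p R.randers.four_F_sq_mul_ric (R.rep_F p) (R.rep_ricci_F p)
    (R.rep_alpha p) (R.rep_energy_alpha (punct n) p) (R.rep_ttr (punct n) p)
    (R.rep_e00 (punct n) p)

end LocalRanders

end
end RandersSoliton

namespace RandersSoliton
noncomputable section
open Set TopologicalSpace
open SmoothFun Finset

/-! ### The soliton equation where `β ≠ 0` -/

theorem bil_smul_left {n : ℕ} (m : Fin n → Fin n → ℝ) (t : ℝ) (x y : Coord n) :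
    bil m (t • x) y = t * bil m x y := by
  simp only [bil, mul_sum]
  exact sum_congr rfl fun i _ => sum_congr rfl fun j _ => by simp; ring

theorem bil_smul_right {n : ℕ} (m : Fin n → Fin n → ℝ) (t : ℝ) (x y : Coord n) :
    bil m x (t • y) = t * bil m x y := by
  simp only [bil, mul_sum]
  exact sum_congr rfl fun i _ => sum_congr rfl fun j _ => by simp; ring

theorem contr₂_smul {n : ℕ} (m : Fin n → Fin n → ℝ) (t : ℝ) (x : Coord n) :
    contr₂ m (t • x) = t ^ 2 * contr₂ m x := by
  simp only [contr₂, mul_sum]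
  exact sum_congr rfl fun i _ => sum_congr rfl fun j _ => by simp; ring

theorem contr_smul {n : ℕ} (m : Fin n → ℝ) (t : ℝ) (x : Coord n) :
    contr m (t • x) = t * contr m x := by
  simp only [contr, mul_sum]
  exact sum_congr rfl fun i _ => by simp; ring

namespace LocalRanders
variable {n : ℕ} (R : LocalRanders n)

/-- The metric at `u` as a function of two indices, the type of argument that `bil` and `contr₂` expect. -/
def a₂ (u : Coord n) : Fin n → Fin n → ℝ := fun i j => R.a u i j

theorem pos₂ {u : Coord n} (hu : u ∈ R.U) {y : Coord n} (hy : y ≠ 0) : 0 < contr₂ (R.a₂ u) y :=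
  R.pos u hu y hy

theorem a₂_symm (u : Coord n) (i j : Fin n) : R.a₂ u i j = R.a₂ u j i := R.symm u i j

theorem alpha_eq (u y : Coord n) : R.alpha u y = √(contr₂ (R.a₂ u) y) := rfl

theorem bil_comm (u x y : Coord n) : bil (R.a₂ u) x y = bil (R.a₂ u) y x := by
  rw [bil, bil, sum_comm]
  exact sum_congr rfl fun i _ => sum_congr rfl fun j _ => by rw [R.a₂_symm u]; ring

/-- The vector `b♯`, with components `bⁱ = a^{ij} bⱼ`. -/
def sharpVec (u : Coord n) : Coord n := WithLp.toLp 2 (raise R.a R.b u)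

theorem sum_a_sharpVec {u : Coord n} (hu : u ∈ R.U) (i : Fin n) :
    ∑ j, R.a₂ u i j * R.sharpVec u j = R.b u i := by
  simp only [sharpVec, raise, mul_sum, a₂]
  rw [sum_comm]
  have : ∀ k, ∑ j, R.a u i j * ((R.a u)⁻¹ j k * R.b u k) = if i = k then R.b u k else 0 := by
    intro k
    simp only [← mul_assoc, ← sum_mul, R.a_mul_inv hu]
    simp
  simp [this]

theorem bil_sharpVec {u : Coord n} (hu : u ∈ R.U) (y : Coord n) :
    bil (R.a₂ u) (R.sharpVec u) y = R.beta u y := by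
  rw [bil, sum_comm, beta, contr]
  refine sum_congr rfl fun j _ => ?_
  rw [← R.sum_a_sharpVec hu j, sum_mul]
  exact sum_congr rfl fun i _ => by rw [R.a₂_symm u i j]

theorem contr₂_sharpVec {u : Coord n} (hu : u ∈ R.U) :
    contr₂ (R.a₂ u) (R.sharpVec u) = R.beta u (R.sharpVec u) := R.bil_sharpVec hu _

/-- `‖β‖² < 1`. -/
theorem normSq_lt_one {u : Coord n} (hu : u ∈ R.U) : R.beta u (R.sharpVec u) < 1 := by
  by_cases h : R.sharpVec u = 0
  · rw [h, beta, contr_zero]; exact one_pos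
  · have h1 : |R.beta u (R.sharpVec u)| < √(contr₂ (R.a₂ u) (R.sharpVec u)) := R.lt u hu _ h
    have h2 := R.pos₂ hu h
    rw [R.contr₂_sharpVec hu] at h1 h2
    rw [abs_of_pos h2] at h1
    have h3 := Real.sq_sqrt h2.le
    have h4 := Real.sqrt_pos.mpr h2
    nlinarith

theorem normSq_pos {u : Coord n} (hu : u ∈ R.U) (hb : R.b u ≠ 0) :
    0 < R.beta u (R.sharpVec u) := by
  rw [← R.contr₂_sharpVec hu]
  refine R.pos₂ hu fun h => hb ?_
  funext i
  rw [← R.sum_a_sharpVec hu, h]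
  simp

/-- Let `m = b♯/‖b♯‖` and `k = ‖β‖`. A quadratic form that takes the value `μ` on all unit vectors `p`
orthogonal to `m`, vanishes on the pairs `(m, p)`, and takes the value `l μ` on `m`, is
`μ (α² - (1 - l) β²/k²)`. -/
theorem contr₂_eq_of_split {u : Coord n} (hu : u ∈ R.U) {m : Coord n} {k : ℝ}
    (hk : k ≠ 0) (hm1 : contr₂ (R.a₂ u) m = 1) (hmy : ∀ y, R.beta u y = k * bil (R.a₂ u) m y)
    {M : Fin n → Fin n → ℝ} {μ l : ℝ} (hm : contr₂ M m = l * μ)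
    (hp : ∀ p, R.beta u p = 0 → contr₂ (R.a₂ u) p = 1 →
      contr₂ M p = μ ∧ bil M m p + bil M p m = 0) (y : Coord n) :
    contr₂ M y = μ * (contr₂ (R.a₂ u) y - (1 - l) * (R.beta u y / k) ^ 2) := by
  set t := R.beta u y / k with ht
  set w := y - t • m with hw
  have hy : y = t • m + w := by rw [hw]; abel
  have hbm : R.beta u m = k := by
    have := hmy m
    rw [show bil (R.a₂ u) m m = contr₂ (R.a₂ u) m from rfl, hm1, mul_one] at this
    exact this
  have hbw : R.beta u w = 0 := by
    have h1 : R.beta u y = R.beta u m * t + R.beta u w := by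
      rw [beta, beta, beta, ← contr_smul_add, ← hy]
    rw [hbm, ht, mul_div_cancel₀ _ hk] at h1
    linarith
  have hmw : bil (R.a₂ u) m w = 0 := by
    have := hmy w
    rw [hbw] at this
    exact (mul_eq_zero.mp this.symm).resolve_left hk
  have hwm : bil (R.a₂ u) w m = 0 := by rw [R.bil_comm, hmw]
  have e1 : contr₂ (R.a₂ u) y = t ^ 2 + contr₂ (R.a₂ u) w := by
    have h := contr₂_smul_add (R.a₂ u) t m w
    rw [← hy, hmw, hwm, hm1] at h
    linarith
  have e2 : contr₂ M y = l * μ * t ^ 2 + μ * contr₂ (R.a₂ u) w := by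
    have h := contr₂_smul_add M t m w
    rw [← hy, hm] at h
    by_cases hw0 : w = 0
    · rw [h, hw0]
      rw [contr₂_zero, contr₂_zero]
      simp [bil]
    · have hpos := R.pos₂ hu hw0
      set r := √(contr₂ (R.a₂ u) w) with hr
      have hr0 : r ≠ 0 := (Real.sqrt_pos.mpr hpos).ne'
      have hr2 : r ^ 2 = contr₂ (R.a₂ u) w := Real.sq_sqrt hpos.le
      obtain ⟨h1, h2⟩ := hp (r⁻¹ • w) (by rw [beta, contr_smul]; rw [beta] at hbw; rw [hbw, mul_zero])
        (by rw [contr₂_smul, ← hr2]; field_simp)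
      rw [contr₂_smul] at h1
      rw [bil_smul_left, bil_smul_right, ← mul_add] at h2
      have h3 := (mul_eq_zero.mp h2).resolve_left (inv_ne_zero hr0)
      rw [h, h3, ← hr2, ← h1]
      field_simp
      ring
  rw [e1, e2]
  ring

/-- At a point where `β ≠ 0`, the soliton equation makes `V` infinitesimally conformal and gives
`e₀₀ = 2σ(α² - β²)`: along the lines `x m + p` it is a polynomial identity in `x` and
`α = √(x² + 1)`, to which `solitonPoly_roots` applies. -/
theorem conformal_and_isotropic (hn : 2 ≤ n) {u : Coord n} (hu : u ∈ R.U) (hb : R.b u ≠ 0)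
    {v : Coord n → Fin n → ℝ} (hv : ∀ i, DifferentiableAt ℝ (fun w => v w i) u) {κ : ℝ}
    (hsol : ∀ y : Coord n, y ≠ 0 → 2 * ricci R.F u y + lieLift v (energy R.F) u y
      = 2 * κ * R.F u y ^ 2) :
    (∃ c, ∀ y, contr₂ (covD R.a (lower R.a v) u) y = 2 * c * contr₂ (R.a₂ u) y) ∧
    ∃ σ, ∀ y, contr₂ (eT R.a R.b u) y = 2 * σ * (contr₂ (R.a₂ u) y - R.beta u y ^ 2) := by
  set q := R.beta u (R.sharpVec u) with hq
  have hq0 : 0 < q := R.normSq_pos hu hb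
  have hq1 : q < 1 := R.normSq_lt_one hu
  set k := √q with hk
  have hk0 : 0 < k := Real.sqrt_pos.mpr hq0
  have hk2 : k ^ 2 = q := Real.sq_sqrt hq0.le
  have hk1 : k < 1 := by nlinarith
  set m := k⁻¹ • R.sharpVec u with hm
  have hm1 : contr₂ (R.a₂ u) m = 1 := by
    rw [hm, contr₂_smul, R.contr₂_sharpVec hu, ← hq, ← hk2]; field_simp
  have hmy : ∀ y, R.beta u y = k * bil (R.a₂ u) m y := by
    intro y
    rw [hm, bil_smul_left, R.bil_sharpVec hu]; field_simp
  have hbm : R.beta u m = k := by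
    have := hmy m
    rwa [show bil (R.a₂ u) m m = contr₂ (R.a₂ u) m from rfl, hm1, mul_one] at this
  set MV := covD R.a (lower R.a v) u with hMV
  set Me := eT R.a R.b u with hMe
  have hN : ((n : ℝ) - 1) ≠ 0 := by
    have : (2 : ℝ) ≤ n := by exact_mod_cast hn
    linarith
  -- the two quadratic forms on the span of `m` and a unit vector `p` orthogonal to `m`
  have key : ∀ p, R.beta u p = 0 → contr₂ (R.a₂ u) p = 1 →
      (contr₂ MV p = contr₂ MV m ∧ bil MV m p + bil MV p m = 0) ∧
      (contr₂ Me m = (1 - k ^ 2) * contr₂ Me p ∧ bil Me m p + bil Me p m = 0) := by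
    intro p hbp hp1
    have hpm : bil (R.a₂ u) m p = 0 := by
      have := hmy p
      rw [hbp] at this
      exact (mul_eq_zero.mp this.symm).resolve_left hk0.ne'
    have hmp : bil (R.a₂ u) p m = 0 := by rw [R.bil_comm, hpm]
    have hen : ∀ x : ℝ, contr₂ (R.a₂ u) (x • m + p) = x ^ 2 + 1 := by
      intro x
      rw [contr₂_smul_add, hm1, hpm, hmp, hp1]; ring
    have hne : ∀ x : ℝ, x • m + p ∈ punct n := by
      intro x h0
      have h1 := hen x
      rw [show x • m + p = 0 from h0, contr₂_zero] at h1
      nlinarith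
    have hα : ∀ x : ℝ, R.alpha u (x • m + p) = √(x ^ 2 + 1) := fun x => by rw [alpha_eq, hen]
    have hβ : ∀ x : ℝ, R.beta u (x • m + p) = k * x := fun x => by
      rw [beta, contr_smul_add]
      rw [beta] at hbm hbp
      rw [hbm, hbp, add_zero]
    obtain ⟨ρ, hρ⟩ := exists_polynomial (ric_mem (R.spray_mem (W := punct n))) hu m p hne
    obtain ⟨D, hD⟩ := exists_polynomial (R.hdiv_mem (R.S0_mem (W := punct n))) hu m p hne
    obtain ⟨t, ht⟩ := exists_polynomial (R.t00_mem (W := punct n)) hu m p hne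
    obtain ⟨s, hs⟩ := exists_polynomial (R.s0_mem (W := punct n)) hu m p hne
    obtain ⟨e₁, he₁⟩ := exists_polynomial (R.geo_mem (R.e00_mem (W := punct n))) hu m p hne
    obtain ⟨e₂, he₂⟩ := exists_polynomial (vert_mem R.S0_mem (R.e00_mem (W := punct n))) hu m p hne
    obtain ⟨s', hs'⟩ := exists_polynomial (R.geo_mem (R.s0_mem (W := punct n))) hu m p hne
    obtain ⟨t', ht'⟩ := exists_polynomial (vert_mem R.S0_mem (R.s0_mem (W := punct n))) hu m p hne
    let l₁ : Fin n → ℝ := fun j => (∑ k, v u k * pd k (fun w => R.b w j) u)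
      + ∑ i, R.b u i * pd j (fun w => v w i) u
    let l : Polynomial ℝ := Polynomial.C (contr l₁ m) * Polynomial.X + Polynomial.C (contr l₁ p)
    have hl : ∀ x : ℝ, lieLift v R.beta u (x • m + p) = l.eval x := by
      intro x
      rw [R.lieLift_beta hu, contr_smul_add]
      simp [l, l₁]
    have hV : ∀ x : ℝ, contr₂ MV (x • m + p)
        = contr₂ MV m * x ^ 2 + (bil MV m p + bil MV p m) * x + contr₂ MV p :=
      fun x => contr₂_smul_add _ _ _ _
    have hE : ∀ x : ℝ, contr₂ Me (x • m + p)
        = contr₂ Me m * x ^ 2 + (bil Me m p + bil Me p m) * x + contr₂ Me p :=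
      fun x => contr₂_smul_add _ _ _ _
    have hroots := solitonPoly_roots (N := (n : ℝ) - 1) (T := tTrace R.a R.b u) (κ := κ) (k := k)
      (ρ := ρ) (D := D) (t := t) (s := s) (e₁ := e₁) (e₂ := e₂) (s' := s') (t' := t') (l := l)
      (v₂ := contr₂ MV m) (v₁ := bil MV m p + bil MV p m) (v₀ := contr₂ MV p)
      (c₂ := contr₂ Me m) (c₁ := bil Me m p + bil Me p m) (c₀ := contr₂ Me p)
      hN hk0 hk1 (fun x => by
        have h1 := R.four_F_sq_mul_ricci hu (hne x)
        have h2 := R.lieLift_energy_F hu hv (hne x)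
        have h3 := hsol _ (hne x)
        have hF : R.F u (x • m + p) = √(x ^ 2 + 1) + k * x := by rw [F, hα, hβ]
        rw [hρ x, hD x, ht x, hs x, he₁ x, he₂ x, hF, hα x,
          show (R.form (punct n)).s00.1 _ = _ from hs' x,
          show (R.form (punct n)).t0.1 _ = _ from ht' x, hE x] at h1
        rw [hF, hα, hl, hV] at h2
        rw [hF] at h3
        rw [solitonPoly]
        linear_combination √(x ^ 2 + 1) * (-h1)
          + 2 * √(x ^ 2 + 1) * (√(x ^ 2 + 1) + k * x) ^ 2 * h3
          - 2 * (√(x ^ 2 + 1) + k * x) ^ 2 * h2)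
    exact ⟨hroots.1, hroots.2⟩
  refine ⟨⟨contr₂ MV m / 2, fun y => ?_⟩, ⟨contr₂ Me m / (1 - k ^ 2) / 2, fun y => ?_⟩⟩
  · rw [R.contr₂_eq_of_split hu hk0.ne' hm1 hmy (μ := contr₂ MV m) (l := 1) (by ring)
      (fun p h1 h2 => (key p h1 h2).1) y]
    ring
  · have h1k : 1 - k ^ 2 ≠ 0 := by rw [hk2]; linarith
    rw [R.contr₂_eq_of_split hu hk0.ne' hm1 hmy (M := Me) (μ := contr₂ Me m / (1 - k ^ 2))
      (l := 1 - k ^ 2) (by field_simp) (fun p h1 h2 => ?_) y]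
    · field_simp
      ring
    · refine ⟨?_, (key p h1 h2).2.2⟩
      rw [(key p h1 h2).2.1]; field_simp

end LocalRanders

end
end RandersSoliton

namespace RandersSoliton
noncomputable section
open Set TopologicalSpace
open SmoothFun Finset

/-! ### Parity in `y` -/

section Parity
variable {n : ℕ}

theorem contr_neg (w : Fin n → ℝ) (y : Coord n) : contr w (-y) = - contr w y := by
  simp [contr]

theorem contr₂_neg (m : Fin n → Fin n → ℝ) (y : Coord n) : contr₂ m (-y) = contr₂ m y := by
  simp [contr₂]

theorem pd_comp_neg (i : Fin n) (f : Coord n → ℝ) (y : Coord n) :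
    pd i (fun w => f (-w)) y = - pd i f (-y) := by
  have h := fderiv_comp_smul (𝕜 := ℝ) (f := f) (x := y) (-1)
  simp only [neg_one_smul] at h
  rw [pd, h]
  rfl

theorem dy_even {L : Coord n → Coord n → ℝ} (h : ∀ u y, L u (-y) = L u y) (i : Fin n)
    (u y : Coord n) : dy i L u (-y) = - dy i L u y := by
  have h1 : pd i (fun w => L u (-w)) y = pd i (L u) y := by simp only [h]
  rw [pd_comp_neg] at h1
  simp only [dy, ← h1, neg_neg]

theorem dy_odd {L : Coord n → Coord n → ℝ} (h : ∀ u y, L u (-y) = - L u y) (i : Fin n)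
    (u y : Coord n) : dy i L u (-y) = dy i L u y := by
  have h1 : pd i (fun w => L u (-w)) y = - pd i (L u) y := by
    simp only [h, pd, fderiv_fun_neg]
    rfl
  rw [pd_comp_neg] at h1
  simpa [dy] using h1

theorem dx_even {L : Coord n → Coord n → ℝ} (h : ∀ u y, L u (-y) = L u y) (i : Fin n)
    (u y : Coord n) : dx i L u (-y) = dx i L u y := by
  simp only [dx, h]

theorem dx_odd {L : Coord n → Coord n → ℝ} (h : ∀ u y, L u (-y) = - L u y) (i : Fin n)
    (u y : Coord n) : dx i L u (-y) = - dx i L u y := by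
  simp only [dx, h, pd, fderiv_fun_neg]
  rfl

/-- The Ricci curvature of a reversible Finsler metric is even in `y`. -/
theorem ricci_neg {F : Coord n → Coord n → ℝ} (h : ∀ u y, F u (-y) = F u y) (u y : Coord n) :
    ricci F u (-y) = ricci F u y := by
  have hE : ∀ u y, energy F u (-y) = energy F u y := fun u y => by simp only [energy, h]
  have hg : ∀ u y, fundTensor F u (-y) = fundTensor F u y := fun u y => by
    ext i j
    simp only [fundTensor, Matrix.of_apply, dy_odd (dy_even hE j)]
  have hG : ∀ i u y, geodCoeff F i u (-y) = geodCoeff F i u y := fun i u y => by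
    simp [geodCoeff, hg, dx_odd (dy_even hE _), dx_even hE]
  simp [ricci, riemann, dx_even (hG _), dx_odd (dy_even (hG _) _), hG, dy_odd (dy_even (hG _) _),
    dy_even (hG _)]

end Parity

section Linear
variable {n : ℕ} {U W : Opens (Coord n)}

/-- The function `wᵢ yⁱ` with constant coefficients `wᵢ`. -/
def linElt (w : Fin n → ℝ) : SmoothFun (prodOpens U W) :=
  ∑ j, algebraMap ℝ _ (w j) * (smoothCalculus U W).y j

theorem linElt_val (w : Fin n → ℝ) (p : prodOpens U W) :
    (linElt w).1 p = contr w p.1.2 := by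
  rw [linElt, val_sum]; rfl

theorem vert_linElt (Z : Fin n → SmoothFun (prodOpens U W)) (w : Fin n → ℝ) :
    (smoothCalculus U W).vert Z (linElt w) = ∑ j, algebraMap ℝ _ (w j) * Z j := by
  simp [linElt, Derivation.leibniz, FiberCalculus.vert_y]

/-- Fibre derivatives at a point depend only on the restriction to its fibre. -/
theorem vert_congr {u : Coord n} {f f' : SmoothFun (prodOpens U W)}
    (h : ∀ p : prodOpens U W, p.1.1 = u → f.1 p = f'.1 p) (Z : Fin n → SmoothFun (prodOpens U W))
    {p : prodOpens U W} (hp : p.1.1 = u) :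
    ((smoothCalculus U W).vert Z f).1 p = ((smoothCalculus U W).vert Z f').1 p := by
  have key : ∀ i, ((smoothCalculus U W).Y i f).1 p = ((smoothCalculus U W).Y i f').1 p := by
    intro i
    have r : ∀ g : SmoothFun (prodOpens U W), Rep (fun u y => ext g (u, y)) g :=
      fun g p => ext_apply g p
    rw [← (r f).dy i p, ← (r f').dy i p]
    simp only [dy, pd]
    have : (fun y => ext f (p.1.1, y)) =ᶠ[nhds p.1.2] fun y => ext f' (p.1.1, y) := by
      filter_upwards [W.2.mem_nhds p.2.2] with y hy
      have := h ⟨(p.1.1, y), p.2.1, hy⟩ hp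
      rwa [← ext_apply, ← ext_apply] at this
    rw [this.fderiv_eq]
  simp only [FiberCalculus.vert_apply, val_sum, val_mul, key]

end Linear

/-- The divergence of `wⁱⱼ yʲ` is linear in `y`. -/
theorem FiberMetric.hdiv_linear {n : ℕ} {A : Type*} [CommRing A] [Algebra ℝ A]
    {K : FiberCalculus n A} (g : FiberMetric K) {w : Fin n → Fin n → A}
    (hw : ∀ i j, K.IsBasic (w i j)) :
    g.hdiv (fun i => ∑ j, w i j * K.y j) = ∑ l, (∑ i, (K.X i (w i l)
      - ∑ j, w i j * g.chr j i l + ∑ k, g.chr i i k * w k l)) * K.y l := by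
  simp only [FiberMetric.hdiv, map_sum, Derivation.leibniz, smul_eq_mul, g.hor_y, g.hor_basic (hw _ _),
    FiberMetric.conn]
  simp only [sum_mul]
  rw [sum_comm (f := fun l i => _)]
  refine sum_congr rfl fun i _ => ?_
  simp only [add_mul, sub_mul, sum_add_distrib, sum_sub_distrib, mul_neg, sum_neg_distrib, mul_sum,
    sum_mul]
  rw [sum_comm (f := fun l j => w i j * g.chr j i l * K.y l),
    sum_comm (f := fun l k => g.chr i i k * w k l * K.y l)]
  simp only [mul_assoc, mul_comm (K.y _)]
  ring

namespace LocalRanders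
variable {n : ℕ} (R : LocalRanders n) (W : Opens (Coord n))

/-- The coefficients of the 1-form `sⁱ_{0;i}`, the divergence of `sⁱⱼ`. -/
def divS0 (u : Coord n) (l : Fin n) : ℝ :=
  ∑ i, (pd i (fun w => ∑ k, (R.a w)⁻¹ i k * sT R.a R.b w k l) u
    - ∑ j, (∑ k, (R.a u)⁻¹ i k * sT R.a R.b u k j) * christoffel R.a u j i l
    + ∑ j, christoffel R.a u i i j * ∑ k, (R.a u)⁻¹ j k * sT R.a R.b u k l)

theorem rep_hdiv_S0 : Rep (fun u y => contr (R.divS0 u) y) ((R.metric W).hdiv (R.form W).S0) := by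
  have e : (R.form W).S0 = fun i => ∑ j, (R.form W).sm i j * (smoothCalculus R.U W).y j :=
    funext fun i => (R.form W).S0_eq i
  rw [e, FiberMetric.hdiv_linear _ (R.form W).sm_basic]
  refine R.rep_contr fun l => Rep.sum fun i => ?_
  exact (((R.rep_sm W i l).dx i).sub (Rep.sum fun j => (R.rep_sm W i j).mul (R.rep_chr W j i l))).add
    (Rep.sum fun j => (R.rep_chr W i i j).mul (R.rep_sm W j l))

/-- The coefficients `sᵢ sⁱₗ` of `t₀`. -/
def t0Vec (u : Coord n) (l : Fin n) : ℝ :=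
  ∑ i, sV R.a R.b u i * ∑ k, (R.a u)⁻¹ i k * sT R.a R.b u k l

theorem rep_t0 : Rep (fun u y => contr (R.t0Vec u) y) (R.form W).t0 := by
  have e : (R.form W).t0 = ∑ l, (∑ i, (R.form W).s1 i * (R.form W).sm i l)
      * (smoothCalculus R.U W).y l := by
    rw [FiberForm.t0, FiberForm.vert_s0]
    simp only [FiberForm.S0_eq, mul_sum, sum_mul]
    rw [sum_comm]
    exact sum_congr rfl fun _ _ => sum_congr rfl fun _ _ => by ring
  rw [e]
  exact R.rep_contr fun l => Rep.sum fun i => (R.rep_s1 W i).mul (R.rep_sm W i l)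

theorem rep_geo_base {σ : Coord n → ℝ} (hσ : ContDiffOn ℝ ∞ σ R.U) :
    Rep (fun u y => contr (fun i => pd i σ u) y) ((R.metric W).geo (base W σ hσ)) := by
  have e : (R.metric W).geo (base W σ hσ)
      = ∑ i, base W (pd i σ) (contDiffOn_pd hσ i) * (smoothCalculus R.U W).y i := by
    rw [FiberMetric.geo_apply]
    refine sum_congr rfl fun i _ => ?_
    rw [(R.metric W).hor_basic (isBasic_of_rep (rep_base W σ hσ)), X_base, mul_comm]
  rw [e]
  exact R.rep_contr fun i => rep_base W _ _

theorem smooth_normSq : ContDiffOn ℝ ∞ (fun u => R.beta u (R.sharpVec u)) R.U := by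
  simp only [beta, contr, sharpVec, raise]
  exact ContDiffOn.sum fun i _ => (R.smooth_b i).mul
    (ContDiffOn.sum fun j _ => (R.smooth_inv i j).mul (R.smooth_b j))

theorem rep_q : Rep (fun u _ => R.beta u (R.sharpVec u)) (R.form W).q :=
  fun p => Rep.sum (s := univ) (fun i => (R.rep_b W i).mul (R.rep_B W i)) p

/-- The condition `e₀₀ = 2σ(α² - β²)` at all points of `U`. -/
def Isotropic (σ : Coord n → ℝ) : Prop :=
  ∀ u ∈ R.U, ∀ y, contr₂ (eT R.a R.b u) y = 2 * σ u * (contr₂ (R.a u) y - R.beta u y ^ 2)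

variable {R} in
/-- The data `(a, b, σ)` with `e₀₀ = 2σ(α² - β²)`, in the calculus of smooth functions on `U × W`. -/
def Isotropic.fiber {σ : Coord n → ℝ} (hE : R.Isotropic σ) (hσ : ContDiffOn ℝ ∞ σ R.U) :
    FiberIsotropic (R.metric W) where
  toFiberForm := R.form W
  σ := base W σ hσ
  qi := base W (fun u => (1 - R.beta u (R.sharpVec u))⁻¹) ((contDiffOn_const.sub R.smooth_normSq).inv
    fun u hu => (sub_pos.mpr (R.normSq_lt_one hu)).ne')
  σ_basic := isBasic_of_rep (rep_base W σ hσ)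
  q_inv := by
    apply Subtype.ext; funext p
    rw [val_mul, val_sub, ← R.rep_q W p]
    exact mul_inv_cancel₀ (sub_pos.mpr (R.normSq_lt_one p.2.1)).ne'
  e00_eq := by
    apply Subtype.ext; funext p
    have h1 : contr₂ (R.a p.1.1) p.1.2 = _ := R.rep_en W p
    refine (R.rep_e00 W p).symm.trans ((hE _ p.2.1 _).trans ?_)
    rw [h1, R.rep_beta W p]
    rfl

end LocalRanders

/-- Evaluation of an identity of the form of `IsotropicS.ric_G` at a point, stated for generic elements
so that the evaluation does not unfold them. -/
theorem SmoothFun.val_ric_isotropic {E : Type*} [NormedAddCommGroup E] [NormedSpace ℝ E]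
    {Ω : Opens E} (p : Ω) {r ρ α β D t en T σ s σ' s' t' : SmoothFun Ω} {n : ℕ}
    {r₀ ρ₀ α₀ β₀ D₀ t₀ en₀ T₀ σ₀ s₀ σ₀' s₀' t₀' : ℝ}
    (h : r = (ρ - 2 * t - en * T + ((n : SmoothFun Ω) - 1) * (σ ^ 2 * (3 * en - β ^ 2) + s ^ 2
      + σ' * β + s')) + α * (2 * D + ((n : SmoothFun Ω) - 1) *
        (-2 * σ ^ 2 * β - 4 * σ * s - σ' - 2 * t')))
    (hr : r₀ = r.1 p) (hρ : ρ₀ = ρ.1 p) (hα : α₀ = α.1 p) (hβ : β₀ = β.1 p) (hD : D₀ = D.1 p)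
    (ht : t₀ = t.1 p) (hen : en₀ = en.1 p) (hT : T₀ = T.1 p) (hσ : σ₀ = σ.1 p) (hs : s₀ = s.1 p)
    (hσ' : σ₀' = σ'.1 p) (hs' : s₀' = s'.1 p) (ht' : t₀' = t'.1 p) :
    r₀ = (ρ₀ - 2 * t₀ - en₀ * T₀ + ((n : ℝ) - 1) * (σ₀ ^ 2 * (3 * en₀ - β₀ ^ 2) + s₀ ^ 2
      + σ₀' * β₀ + s₀')) + α₀ * (2 * D₀ + ((n : ℝ) - 1) *
        (-2 * σ₀ ^ 2 * β₀ - 4 * σ₀ * s₀ - σ₀' - 2 * t₀')) := by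
  subst hr hρ hα hβ hD ht hen hT hσ hs hσ' hs' ht'
  have := congrFun (congrArg Subtype.val h) p
  simpa only [val_mul, val_sub, val_add, val_pow, val_neg, val_two, val_three, val_four,
    val_natCast, val_one] using this

namespace LocalRanders
variable {n : ℕ} {R : LocalRanders n} {σ : Coord n → ℝ}

/-- The Ricci curvature of a Randers metric with `e₀₀ = 2σ(α² - β²)` is the sum of a function even in `y`
and of `α` times an odd one. -/
theorem Isotropic.ricci_F (hE : R.Isotropic σ) (hσ : ContDiffOn ℝ ∞ σ R.U) {u y : Coord n}
    (hu : u ∈ R.U) (hy : y ≠ 0) :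
    ricci R.F u y = (ricci R.alpha u y - 2 * contr₂ (tT R.a R.b u) y
      - contr₂ (R.a u) y * tTrace R.a R.b u + ((n : ℝ) - 1) *
        (σ u ^ 2 * (3 * contr₂ (R.a u) y - R.beta u y ^ 2) + contr (sV R.a R.b u) y ^ 2
        + contr (fun i => pd i σ u) y * R.beta u y + contr₂ (covD R.a (sV R.a R.b) u) y))
      + R.alpha u y * (2 * contr (R.divS0 u) y + ((n : ℝ) - 1) * (-2 * σ u ^ 2 * R.beta u y
        - 4 * σ u * contr (sV R.a R.b u) y - contr (fun i => pd i σ u) y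
        - 2 * contr (R.t0Vec u) y)) := by
  let p : prodOpens R.U (punct n) := ⟨(u, y), hu, hy⟩
  have hS : R.randers.IsotropicS (base (punct n) σ hσ) := (hE.fiber (punct n) hσ).e00_eq
  exact SmoothFun.val_ric_isotropic p (hS.ric_G (isBasic_of_rep (rep_base _ σ hσ)))
    (R.rep_ricci_F p) (R.rep_ricci_alpha _ p) (R.rep_alpha p) (R.rep_beta _ p)
    (R.rep_hdiv_S0 _ p) (R.rep_t00 _ p) (R.rep_en _ p) (R.rep_ttr _ p)
    (rep_base _ σ hσ p) (R.rep_s0 _ p) (R.rep_geo_base _ hσ p) (R.rep_s00 _ p) (R.rep_t0 _ p)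

end LocalRanders

end
end RandersSoliton

namespace RandersSoliton
noncomputable section
open Set TopologicalSpace
open SmoothFun Finset

/-! ### The soliton equation and the equations for `ᵅRic` and `dσ` -/

namespace LocalRanders
variable {n : ℕ} (R : LocalRanders n)

/-- The right-hand side of the Ricci equation at a point, with `l = κ - 2c`, `s = σ` and `σ₀ = τᵢ yⁱ`. -/
def ricRhs (l s : ℝ) (τ : Fin n → ℝ) (u y : Coord n) : ℝ :=
  l * (R.alpha u y ^ 2 + R.beta u y ^ 2) + tTrace R.a R.b u * R.alpha u y ^ 2
    + 2 * contr₂ (tT R.a R.b u) y - ((n : ℝ) - 1) * s ^ 2 * (3 * R.alpha u y ^ 2 - R.beta u y ^ 2)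
    + 2 * ((n : ℝ) - 1) * contr τ y * R.beta u y
    - ((n : ℝ) - 1) * (contr (sV R.a R.b u) y ^ 2 + contr₂ (covD R.a (sV R.a R.b) u) y)

variable {R} {σ : Coord n → ℝ}

theorem rep_fiber_ricRhs (hE : R.Isotropic σ) (hσ : ContDiffOn ℝ ∞ σ R.U) (l : ℝ)
    (W : Opens (Coord n)) :
    Rep (fun u y => R.ricRhs l (σ u) (fun i => pd i σ u) u y) ((hE.fiber W hσ).ricRhs l) := by
  intro p
  have h1 : R.alpha p.1.1 p.1.2 ^ 2 = (R.metric W).en.1 p := R.rep_energy_alpha W p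
  have h2 := R.rep_beta W p
  have h3 := R.rep_ttr W p
  have h4 := R.rep_t00 W p
  have h5 := R.rep_s0 W p
  have h6 := R.rep_s00 W p
  have h7 := R.rep_geo_base W hσ p
  dsimp only at h2 h3 h4 h5 h6 h7 ⊢
  rw [LocalRanders.ricRhs, h1, h2, h3, h4, h5, h6, h7]
  simp only [FiberIsotropic.ricRhs, val_add, val_sub, val_mul, val_pow, val_two, val_three,
    val_natCast, val_one, val_algebraMap]
  rw [mul_assoc (2 * ((n : ℝ) - 1)), mul_assoc ((n : ℝ) - 1)]
  rfl

/-- The divergence `sⁱ_{0;i}` minus the value that it takes for a soliton; a 1-form. -/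
def divDefect (R : LocalRanders n) (σ : Coord n → ℝ) (l : ℝ) (u : Coord n) (j : Fin n) : ℝ :=
  R.divS0 u j - (l * R.b u j + ((n : ℝ) - 1) * (σ u ^ 2 * R.b u j + 2 * (σ u * sV R.a R.b u j)
    + 2 * pd j σ u + R.t0Vec u j))

theorem contr_divDefect (l : ℝ) (u y : Coord n) : contr (R.divDefect σ l u) y
    = contr (R.divS0 u) y - (l * R.beta u y + ((n : ℝ) - 1) * (σ u ^ 2 * R.beta u y
      + 2 * (σ u * contr (sV R.a R.b u) y) + 2 * contr (fun i => pd i σ u) y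
      + contr (R.t0Vec u) y)) := by
  simp only [contr, divDefect, beta, mul_sum, ← sum_add_distrib, ← sum_sub_distrib]
  exact sum_congr rfl fun i _ => by ring

theorem rep_fiber_divDefect (hE : R.Isotropic σ) (hσ : ContDiffOn ℝ ∞ σ R.U) (l : ℝ)
    (W : Opens (Coord n)) : Rep (fun u y => contr (R.divDefect σ l u) y)
      ((R.metric W).hdiv (R.form W).S0 - (hE.fiber W hσ).divRhs l) := by
  intro p
  have h1 := R.rep_hdiv_S0 W p
  have h2 := R.rep_beta W p
  have h5 := R.rep_s0 W p
  have h6 := R.rep_t0 W p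
  have h7 := R.rep_geo_base W hσ p
  dsimp only at h1 h2 h5 h6 h7 ⊢
  rw [contr_divDefect, h1, h2, h5, h6, h7]
  simp only [FiberIsotropic.divRhs, val_add, val_sub, val_mul, val_pow, val_two,
    val_natCast, val_one, val_algebraMap]
  rfl

/-- The divergence identity on a fibre on which `ᵅRic` differs from the right-hand side of the Ricci
equation by `-β(y) z(y)` for some covector `z`. -/
theorem divDefect_eq (hE : R.Isotropic σ) (hσ : ContDiffOn ℝ ∞ σ R.U) {l : ℝ} {u : Coord n}
    (hu : u ∈ R.U) {z : Fin n → ℝ} (h : ∀ y, y ≠ 0 → ricci R.alpha u y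
      - R.ricRhs l (σ u) (fun i => pd i σ u) u y = - (R.beta u y * contr z y)) {y : Coord n} (hy : y ≠ 0) :
    2 * (contr (R.divDefect σ l u) y + R.beta u y * contr (R.divDefect σ l u) (R.sharpVec u))
      = - (R.beta u (R.sharpVec u) * contr z y + R.beta u y * contr z (R.sharpVec u)) := by
  let p : prodOpens R.U (punct n) := ⟨(u, y), hu, hy⟩
  let K := smoothCalculus R.U (punct n)
  let η := hE.fiber (punct n) hσ
  have hid := congrFun (congrArg Subtype.val (η.divergence_identity l)) p
  have hB : ∀ w : Fin n → ℝ, (K.vert η.B (linElt w)).1 p = contr w (R.sharpVec u) := by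
    intro w
    rw [vert_linElt, val_sum, contr]
    refine sum_congr rfl fun j _ => ?_
    rw [val_mul, val_algebraMap]
    exact congrArg (w j * ·) (R.rep_B (punct n) j p).symm
  have h1 : (K.vert η.B ((R.metric (punct n)).hdiv (R.form (punct n)).S0 - η.divRhs l)).1 p
      = contr (R.divDefect σ l u) (R.sharpVec u) := by
    rw [← hB]
    refine vert_congr (u := u) (fun p' hp' => ?_) _ rfl
    rw [← rep_fiber_divDefect hE hσ l _ p', linElt_val, hp']
  have h2 : (K.vert η.B (K.ric (R.metric (punct n)).spray - η.ricRhs l)).1 p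
      = - (R.beta u (R.sharpVec u) * contr z y + R.beta u y * contr z (R.sharpVec u)) := by
    have : (K.vert η.B (K.ric (R.metric (punct n)).spray - η.ricRhs l)).1 p
        = (K.vert η.B (-((R.form (punct n)).β * linElt z))).1 p := by
      refine vert_congr (u := u) (fun p' hp' => ?_) _ rfl
      have e := h p'.1.2 p'.2.2
      rw [val_sub, ← R.rep_ricci_alpha _ p', ← rep_fiber_ricRhs hE hσ l _ p', val_neg, val_mul,
        ← R.rep_beta _ p', linElt_val, hp']
      exact e
    rw [this, map_neg, Derivation.leibniz, val_neg, val_add, smul_eq_mul, smul_eq_mul, val_mul,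
      val_mul, hB, linElt_val, ← R.rep_beta _ p]
    have hq : (K.vert η.B (R.form (punct n)).β).1 p = R.beta u (R.sharpVec u) := by
      refine Eq.trans (congrArg (fun f : SmoothFun (prodOpens R.U (punct n)) => f.1 p) η.vert_B_β) ?_
      exact (R.rep_q (punct n) p).symm
    rw [hq]
    ring
  have h3 : contr (R.divDefect σ l u) y = _ := rep_fiber_divDefect hE hσ l (punct n) p
  have h4 : R.beta u y = _ := R.rep_beta (punct n) p
  rw [← h2, ← h1, h3, h4]
  exact hid

variable {v : Coord n → Fin n → ℝ}

/-- The 1-form `ℒ_{V̂} β - 2cβ + 3(n - 1)dσ`, which vanishes for solitons. -/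
def lieDefect (R : LocalRanders n) (σ : Coord n → ℝ) (v : Coord n → Fin n → ℝ) (c : ℝ) (u : Coord n)
    (j : Fin n) : ℝ :=
  ((∑ k, v u k * pd k (fun w => R.b w j) u) + ∑ i, R.b u i * pd j (fun w => v w i) u)
    - 2 * c * R.b u j + 3 * ((n : ℝ) - 1) * pd j σ u

theorem contr_lieDefect (c : ℝ) {u : Coord n} (hu : u ∈ R.U) (y : Coord n) :
    contr (R.lieDefect σ v c u) y = lieLift v R.beta u y - 2 * c * R.beta u y
      + 3 * ((n : ℝ) - 1) * contr (fun i => pd i σ u) y := by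
  rw [R.lieLift_beta hu]
  simp only [contr, lieDefect, beta, mul_sum, ← sum_add_distrib, ← sum_sub_distrib]
  exact sum_congr rfl fun i _ => by ring

/-- The soliton equation is `E + β Z + α (2D + Z) = 0`, where `E`, `D` and `Z` are the defects of the Ricci
equation, of the equation for `sⁱ_{0;i}`, and of the equation for `dσ`. The part without `α` is even in
`y`, and the factor of `α` is odd. -/
theorem soliton_split (hE : R.Isotropic σ) (hσ : ContDiffOn ℝ ∞ σ R.U) {u : Coord n}
    (hu : u ∈ R.U) (hv : ∀ i, DifferentiableAt ℝ (fun w => v w i) u) {c κ : ℝ}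
    (hc : ∀ y, contr₂ (covD R.a (lower R.a v) u) y = 2 * c * contr₂ (R.a u) y)
    {y : Coord n} (hy : y ≠ 0) :
    2 * ricci R.F u y + lieLift v (energy R.F) u y - 2 * κ * R.F u y ^ 2
      = 2 * ((ricci R.alpha u y - R.ricRhs (κ - 2 * c) (σ u) (fun i => pd i σ u) u y
          + R.beta u y * contr (R.lieDefect σ v c u) y)
        + R.alpha u y * (2 * contr (R.divDefect σ (κ - 2 * c) u) y
          + contr (R.lieDefect σ v c u) y)) := by
  have h1 := hE.ricci_F hσ hu hy
  have h2 := R.lieLift_energy_F hu hv hy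
  have hα : R.alpha u y ^ 2 = contr₂ (R.a u) y := Real.sq_sqrt (R.nonneg hu y)
  have hα0 : R.alpha u y ≠ 0 := (R.alpha_pos hu hy).ne'
  rw [hc, ← hα] at h2
  rw [← hα] at h1
  have h3 : lieLift v (energy R.F) u y
      = 2 * R.F u y * (2 * c * R.alpha u y + lieLift v R.beta u y) := by
    apply mul_left_cancel₀ hα0
    rw [h2]; ring
  rw [h1, h3, contr_divDefect, contr_lieDefect c hu, LocalRanders.ricRhs, F]
  ring

/-- For a soliton, parity gives `E = -βZ` and `2D = -Z`. The divergence identity, which computes `D` from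
`E`, then reads `(1 - ‖β‖²) Z = 0`. -/
theorem lieDefect_eq_zero (hE : R.Isotropic σ) (hσ : ContDiffOn ℝ ∞ σ R.U) {u : Coord n}
    (hu : u ∈ R.U) (hv : ∀ i, DifferentiableAt ℝ (fun w => v w i) u) {c κ : ℝ}
    (hc : ∀ y, contr₂ (covD R.a (lower R.a v) u) y = 2 * c * contr₂ (R.a u) y)
    (hsol : ∀ y : Coord n, y ≠ 0 → 2 * ricci R.F u y + lieLift v (energy R.F) u y
      = 2 * κ * R.F u y ^ 2) {y : Coord n} (hy : y ≠ 0) :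
    contr (R.lieDefect σ v c u) y = 0 ∧
      ricci R.alpha u y = R.ricRhs (κ - 2 * c) (σ u) (fun i => pd i σ u) u y := by
  have key : ∀ y, y ≠ 0 → (ricci R.alpha u y - R.ricRhs (κ - 2 * c) (σ u) (fun i => pd i σ u) u y
          + R.beta u y * contr (R.lieDefect σ v c u) y) = 0 ∧
      2 * contr (R.divDefect σ (κ - 2 * c) u) y + contr (R.lieDefect σ v c u) y = 0 := by
    intro y hy
    have h1 := soliton_split hE hσ hu hv hc hy (κ := κ)
    have h2 := soliton_split hE hσ hu hv hc (neg_ne_zero.mpr hy) (κ := κ)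
    rw [hsol y hy, sub_self] at h1
    rw [hsol (-y) (neg_ne_zero.mpr hy), sub_self] at h2
    have hα : ∀ u y, R.alpha u (-y) = R.alpha u y := fun u y => by
      rw [alpha_eq, alpha_eq, contr₂_neg]
    have hβ : R.beta u (-y) = - R.beta u y := by rw [beta, beta, contr_neg]
    have hR : R.ricRhs (κ - 2 * c) (σ u) (fun i => pd i σ u) u (-y)
        = R.ricRhs (κ - 2 * c) (σ u) (fun i => pd i σ u) u y := by
      simp only [LocalRanders.ricRhs, hα, hβ, contr_neg, contr₂_neg]
      ring
    rw [ricci_neg hα, hR, hα, hβ, contr_neg, contr_neg] at h2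
    have hα0 : R.alpha u y ≠ 0 := (R.alpha_pos hu hy).ne'
    -- half the sum and half the difference of the equations at `y` and `-y`
    refine ⟨by linarith, mul_left_cancel₀ hα0 ?_⟩
    linarith
  have hz : ∀ y, y ≠ 0 → contr (R.lieDefect σ v c u) y = 0 := by
    intro y hy
    have h1 := divDefect_eq hE hσ (l := κ - 2 * c) hu (z := R.lieDefect σ v c u)
      (fun y hy => by linarith [(key y hy).1]) hy
    have hq := R.normSq_lt_one hu
    -- the relation `2D = -Z` at `b♯`, which is trivial where `b♯ = 0`
    have h2 : 2 * contr (R.divDefect σ (κ - 2 * c) u) (R.sharpVec u)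
        + contr (R.lieDefect σ v c u) (R.sharpVec u) = 0 := by
      by_cases hB : R.sharpVec u = 0
      · rw [hB, contr_zero, contr_zero]; ring
      · exact (key _ hB).2
    have h3 := (key y hy).2
    have h4 : (1 - R.beta u (R.sharpVec u)) * contr (R.lieDefect σ v c u) y = 0 := by
      linear_combination -h1 + h3 + R.beta u y * h2
    exact (mul_eq_zero.mp h4).resolve_left (by linarith)
  refine ⟨hz y hy, ?_⟩
  have := (key y hy).1
  rw [hz y hy] at this
  linarith

/-- The Ricci equation extends to `y = 0`, since both of its sides are homogeneous quadratic polynomials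
along lines through the origin. -/
theorem ricci_alpha_zero (hn : 0 < n) {u : Coord n} (hu : u ∈ R.U) {l s : ℝ} {τ : Fin n → ℝ}
    (h : ∀ y, y ≠ 0 → ricci R.alpha u y = R.ricRhs l s τ u y) (y : Coord n) :
    ricci R.alpha u y = R.ricRhs l s τ u y := by
  by_cases hy : y = 0
  swap
  · exact h y hy
  subst hy
  let e : Coord n := EuclideanSpace.single ⟨0, hn⟩ 1
  have he : e ≠ 0 := by simp [e]
  obtain ⟨P, hP⟩ := exists_polynomial (ric_mem (R.spray_mem (W := ⊤))) hu e 0 fun _ => trivial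
  have hscale : ∀ x : ℝ, R.ricRhs l s τ u (x • e) = x ^ 2 * R.ricRhs l s τ u e := by
    intro x
    have hα : R.alpha u (x • e) ^ 2 = x ^ 2 * R.alpha u e ^ 2 := by
      rw [alpha, Real.sq_sqrt (R.nonneg hu _), alpha, Real.sq_sqrt (R.nonneg hu _)]
      exact contr₂_smul (R.a₂ u) x e
    simp only [LocalRanders.ricRhs, hα, beta, contr_smul]
    rw [show ∀ m : Fin n → Fin n → ℝ, contr₂ m (x • e) = x ^ 2 * contr₂ m e from
      fun m => contr₂_smul m x e, contr₂_smul]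
    ring
  have hPx : ∀ x : ℝ, ricci R.alpha u (x • e) = P.eval x := by
    intro x
    rw [← hP x, ← R.rep_ricci_alpha ⊤]
    simp
  have hPeq : P = Polynomial.X ^ 2 * Polynomial.C (R.ricRhs l s τ u e) := by
    apply Polynomial.eq_of_infinite_eval_eq
    refine Set.Infinite.mono (fun x hx => ?_) (Set.Ioi_infinite (0 : ℝ))
    have hx0 : x • e ≠ 0 := smul_ne_zero (ne_of_gt hx) he
    simp only [Set.mem_ofPred_eq, Polynomial.eval_mul, Polynomial.eval_pow, Polynomial.eval_X,
      Polynomial.eval_C]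
    rw [← hPx, h _ hx0, hscale]
  have h0 := hPx 0
  have h1 := hscale 0
  rw [zero_smul] at h0 h1
  rw [h0, h1, hPeq]
  simp

/-- The soliton equation implies the Ricci equation and the equation for `dσ`. -/
theorem equations_of_soliton (hn : 0 < n) (hE : R.Isotropic σ) (hσ : ContDiffOn ℝ ∞ σ R.U) {u : Coord n}
    (hu : u ∈ R.U) (hv : ∀ i, DifferentiableAt ℝ (fun w => v w i) u) {c κ : ℝ}
    (hc : ∀ y, contr₂ (covD R.a (lower R.a v) u) y = 2 * c * contr₂ (R.a u) y)
    (hsol : ∀ y : Coord n, y ≠ 0 → 2 * ricci R.F u y + lieLift v (energy R.F) u y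
      = 2 * κ * R.F u y ^ 2) (y : Coord n) :
    ricci R.alpha u y = R.ricRhs (κ - 2 * c) (σ u) (fun i => pd i σ u) u y ∧
    3 * ((n : ℝ) - 1) * contr (fun i => pd i σ u) y = 2 * c * R.beta u y - lieLift v R.beta u y := by
  refine ⟨ricci_alpha_zero hn hu (fun y hy => (lieDefect_eq_zero hE hσ hu hv hc hsol hy).2) y, ?_⟩
  have h : contr (R.lieDefect σ v c u) y = 0 := by
    by_cases hy : y = 0
    · rw [hy, contr_zero]
    · exact (lieDefect_eq_zero hE hσ hu hv hc hsol hy).1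
  rw [contr_lieDefect c hu] at h
  linarith

/-- Conversely, the Ricci equation `E = 0` and the divergence identity give `D = 0`; with `Z = 0` this makes
the soliton equation hold. -/
theorem soliton_of_equations (hE : R.Isotropic σ) (hσ : ContDiffOn ℝ ∞ σ R.U) {u : Coord n}
    (hu : u ∈ R.U) (hv : ∀ i, DifferentiableAt ℝ (fun w => v w i) u) {c κ : ℝ}
    (hc : ∀ y, contr₂ (covD R.a (lower R.a v) u) y = 2 * c * contr₂ (R.a u) y)
    (hric : ∀ y, ricci R.alpha u y = R.ricRhs (κ - 2 * c) (σ u) (fun i => pd i σ u) u y)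
    (hlie : ∀ y, 3 * ((n : ℝ) - 1) * contr (fun i => pd i σ u) y
      = 2 * c * R.beta u y - lieLift v R.beta u y) {y : Coord n} (hy : y ≠ 0) :
    2 * ricci R.F u y + lieLift v (energy R.F) u y = 2 * κ * R.F u y ^ 2 := by
  have hz : ∀ y, contr (R.lieDefect σ v c u) y = 0 := fun y => by
    rw [contr_lieDefect c hu, hlie]; ring
  have hd : ∀ y, y ≠ 0 → contr (R.divDefect σ (κ - 2 * c) u) y
      + R.beta u y * contr (R.divDefect σ (κ - 2 * c) u) (R.sharpVec u) = 0 := by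
    intro y hy
    have := divDefect_eq hE hσ (l := κ - 2 * c) hu (z := fun _ => 0)
      (fun y _ => by rw [hric]; simp [contr]) hy
    simp only [contr, zero_mul, sum_const_zero, mul_zero, add_zero, neg_zero] at this
    exact (mul_eq_zero.mp this).resolve_left two_ne_zero
  have hd0 : contr (R.divDefect σ (κ - 2 * c) u) (R.sharpVec u) = 0 := by
    by_cases hB : R.sharpVec u = 0
    · rw [hB, contr_zero]
    · have h1 := hd _ hB
      have hq : 0 < R.beta u (R.sharpVec u) := by
        rw [← R.contr₂_sharpVec hu]; exact R.pos₂ hu hB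
      have h2 : (1 + R.beta u (R.sharpVec u)) *
          contr (R.divDefect σ (κ - 2 * c) u) (R.sharpVec u) = 0 := by
        linear_combination h1
      exact (mul_eq_zero.mp h2).resolve_left (by linarith)
  have h1 := soliton_split hE hσ hu hv hc hy (κ := κ)
  have h2 := hd y hy
  rw [hd0, mul_zero, add_zero] at h2
  rw [hz, h2, hric] at h1
  linarith

end LocalRanders

end
end RandersSoliton

namespace RandersSoliton
noncomputable section
open Set TopologicalSpace
open SmoothFun Finset

/-! ### Points where `β` vanishes -/

theorem Rep.contDiffOn {n : ℕ} {U : Opens (Coord n)} {L : Coord n → Coord n → ℝ}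
    {f : SmoothFun (prodOpens U ⊤)} (h : Rep L f) (y : Coord n) :
    ContDiffOn ℝ ∞ (fun u => L u y) U := by
  have h1 : ContDiffOn ℝ ∞ (fun u : Coord n => ext f (u, y)) U :=
    (ext_contDiffOn f).comp (by fun_prop) fun u hu => ⟨hu, trivial⟩
  refine h1.congr fun u hu => ?_
  exact (h ⟨(u, y), hu, trivial⟩).trans (ext_apply f ⟨(u, y), hu, trivial⟩).symm

/-- A continuous function that vanishes where `b ≠ 0` and in the interior of `{b = 0}` vanishes
everywhere, since these two sets have a dense union. -/
theorem eq_zero_of_eq_zero_dense {X Y : Type*} [TopologicalSpace X] [Zero Y] {U : Set X}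
    (hU : IsOpen U) {b : X → Y} {g : X → ℝ} (hg : ContinuousOn g U)
    (h1 : ∀ u ∈ U, b u ≠ 0 → g u = 0)
    (h2 : ∀ u ∈ U, (∀ᶠ w in nhds u, b w = 0) → g u = 0) {u : X} (hu : u ∈ U) : g u = 0 := by
  by_contra h
  refine h (h2 u hu ?_)
  have hc := (hg.continuousAt (hU.mem_nhds hu)).eventually_ne h
  filter_upwards [hc, hU.mem_nhds hu] with w hw hwU
  by_contra hb
  exact hw (h1 w hwU hb)

namespace LocalRanders
variable {n : ℕ} (R : LocalRanders n)

/-- The only possible value of `σ` in `e₀₀ = 2σ(α² - β²)`, by evaluation at a fixed vector `y ≠ 0`. This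
expression is smooth, also at the zeros of `β`. -/
def sigma (y : Coord n) (u : Coord n) : ℝ :=
  contr₂ (eT R.a R.b u) y / (2 * (contr₂ (R.a u) y - R.beta u y ^ 2))

/-- The only possible value of the conformal factor of `V`, by evaluation at a fixed vector `y ≠ 0`. -/
def confFactor (v : Coord n → Fin n → ℝ) (y : Coord n) (u : Coord n) : ℝ :=
  contr₂ (covD R.a (lower R.a v) u) y / (2 * contr₂ (R.a u) y)

theorem en_sub_sq_pos {u y : Coord n} (hu : u ∈ R.U) (hy : y ≠ 0) :
    0 < contr₂ (R.a u) y - R.beta u y ^ 2 := by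
  have h1 : |R.beta u y| < √(contr₂ (R.a u) y) := R.lt u hu y hy
  have h2 := Real.sq_sqrt (R.nonneg hu y)
  have h3 : |R.beta u y| ^ 2 < √(contr₂ (R.a u) y) ^ 2 :=
    pow_lt_pow_left₀ h1 (abs_nonneg _) two_ne_zero
  rw [sq_abs, h2] at h3
  linarith

theorem smooth_contr₂_a (y : Coord n) : ContDiffOn ℝ ∞ (fun u => contr₂ (R.a u) y) R.U :=
  (R.rep_en ⊤).contDiffOn y

theorem smooth_beta_left (y : Coord n) : ContDiffOn ℝ ∞ (fun u => R.beta u y) R.U :=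
  (R.rep_beta ⊤).contDiffOn y

theorem smooth_contr₂_eT (y : Coord n) : ContDiffOn ℝ ∞ (fun u => contr₂ (eT R.a R.b u) y) R.U :=
  (R.rep_e00 ⊤).contDiffOn y

theorem smooth_sigma {y : Coord n} (hy : y ≠ 0) : ContDiffOn ℝ ∞ (R.sigma y) R.U :=
  (R.smooth_contr₂_eT y).div (contDiffOn_const.mul ((R.smooth_contr₂_a y).sub
    ((R.smooth_beta_left y).pow 2))) fun u hu => by
      have := R.en_sub_sq_pos hu hy; positivity

theorem sigma_eq {y : Coord n} (hy : y ≠ 0) {u : Coord n} (hu : u ∈ R.U) {s : ℝ}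
    (h : ∀ y, contr₂ (eT R.a R.b u) y = 2 * s * (contr₂ (R.a u) y - R.beta u y ^ 2)) :
    R.sigma y u = s := by
  have := R.en_sub_sq_pos hu hy
  rw [sigma, h]; field_simp

theorem confFactor_eq {v : Coord n → Fin n → ℝ} {y : Coord n} (hy : y ≠ 0) {u : Coord n}
    (hu : u ∈ R.U) {c : ℝ}
    (h : ∀ y, contr₂ (covD R.a (lower R.a v) u) y = 2 * c * contr₂ (R.a u) y) :
    R.confFactor v y u = c := by
  have := R.pos u hu y hy
  rw [confFactor, h]; field_simp

theorem pd_b_eq_zero {u : Coord n} (h : ∀ᶠ w in nhds u, R.b w = 0) (i j : Fin n) :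
    pd j (fun w => R.b w i) u = 0 := by
  have : (fun w => R.b w i) =ᶠ[nhds u] fun _ => 0 := by
    filter_upwards [h] with w hw
    rw [hw]; rfl
  rw [pd, this.fderiv_eq]
  simp

theorem eT_eq_zero {u : Coord n} (h : ∀ᶠ w in nhds u, R.b w = 0) : eT R.a R.b u = 0 := by
  have hb : R.b u = 0 := h.self_of_nhds
  have hc : ∀ i j, covD R.a R.b u i j = 0 := fun i j => by
    simp [covD, R.pd_b_eq_zero h, hb]
  funext i j
  simp [eT, rT, sV, sT, hc]

theorem sigma_eq_zero (y : Coord n) {u : Coord n} (h : ∀ᶠ w in nhds u, R.b w = 0) :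
    R.sigma y u = 0 := by
  rw [sigma, R.eT_eq_zero h]
  simp [contr₂]

variable {v : Coord n → Fin n → ℝ} {κ : Coord n → ℝ}

/-- For a soliton, `e₀₀ = 2σ(α² - β²)` on all of `U`: where `β` vanishes on an open set, both sides are
zero. -/
theorem isotropic_sigma (hn : 2 ≤ n) (hv : ∀ i, DifferentiableOn ℝ (fun w => v w i) R.U)
    (hsol : ∀ u ∈ R.U, ∀ y : Coord n, y ≠ 0 → 2 * ricci R.F u y + lieLift v (energy R.F) u y
      = 2 * κ u * R.F u y ^ 2) {y₁ : Coord n} (hy₁ : y₁ ≠ 0) : R.Isotropic (R.sigma y₁) := by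
  intro u hu y
  have := eq_zero_of_eq_zero_dense R.U.2 (b := R.b) (g := fun u => contr₂ (eT R.a R.b u) y
      - 2 * R.sigma y₁ u * (contr₂ (R.a u) y - R.beta u y ^ 2))
    ((R.smooth_contr₂_eT y).continuousOn.sub ((continuousOn_const.mul
      (R.smooth_sigma hy₁).continuousOn).mul ((R.smooth_contr₂_a y).continuousOn.sub
        ((R.smooth_beta_left y).continuousOn.pow 2)))) ?_ ?_ hu
  · linarith
  · intro u hu hb
    obtain ⟨s, hs⟩ := (R.conformal_and_isotropic hn hu hb
      (fun i => (hv i).differentiableAt (R.U.2.mem_nhds hu)) (hsol u hu)).2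
    rw [R.sigma_eq hy₁ hu hs, hs]
    exact sub_self _
  · intro u _ hb
    rw [R.sigma_eq_zero y₁ hb, R.eT_eq_zero hb]
    simp [contr₂]

theorem continuousOn_pd {f : Coord n → ℝ} {U : Opens (Coord n)} (hf : ContDiffOn ℝ 1 f U)
    (k : Fin n) : ContinuousOn (pd k f) U :=
  (hf.continuousOn_fderiv_of_isOpen U.2 le_rfl).clm_apply continuousOn_const

theorem continuousOn_contr₂_covD_lower (hv : ∀ i, ContDiffOn ℝ 1 (fun w => v w i) R.U)
    (y : Coord n) : ContinuousOn (fun u => contr₂ (covD R.a (lower R.a v) u) y) R.U := by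
  have hd : ∀ i, DifferentiableOn ℝ (fun w => v w i) R.U := fun i => (hv i).differentiableOn one_ne_zero
  refine ContinuousOn.congr (f := fun u => contr₂ (fun i j => ∑ l, (pd j (fun w => R.a w i l) u * v u l
      + R.a u i l * pd j (fun w => v w l) u
      - v u l * ((1 / 2) * (pd j (fun w => R.a w l i) u + pd i (fun w => R.a w l j) u
        - pd l (fun w => R.a w i j) u)))) y) ?_ fun u hu => ?_
  · have h1 : ∀ i j k, ContinuousOn (pd k (fun w => R.a w i j)) R.U :=
      fun i j k => (contDiffOn_pd (R.smooth_a i j) k).continuousOn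
    have h2 : ∀ i k, ContinuousOn (pd k (fun w => v w i)) R.U := fun i k => continuousOn_pd (hv i) k
    have h3 : ∀ i, ContinuousOn (fun w => v w i) R.U := fun i => (hv i).continuousOn
    have h4 : ∀ i j, ContinuousOn (fun w => R.a w i j) R.U := fun i j => (R.smooth_a i j).continuousOn
    refine continuousOn_finsetSum _ fun i _ => continuousOn_finsetSum _ fun j _ =>
      ContinuousOn.mul (ContinuousOn.mul (continuousOn_finsetSum _ fun l _ => ?_)
        continuousOn_const) continuousOn_const
    exact (((h1 _ _ _).mul (h3 _)).add ((h4 _ _).mul (h2 _ _))).sub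
      ((h3 _).mul (continuousOn_const.mul (((h1 _ _ _).add (h1 _ _ _)).sub (h1 _ _ _))))
  · simp only [R.covD_lower hu fun i => (hd i).differentiableAt (R.U.2.mem_nhds hu), contr₂]

theorem continuousOn_confFactor (hv : ∀ i, ContDiffOn ℝ 1 (fun w => v w i) R.U) {y : Coord n}
    (hy : y ≠ 0) : ContinuousOn (R.confFactor v y) R.U :=
  (R.continuousOn_contr₂_covD_lower hv y).div
    (continuousOn_const.mul (R.smooth_contr₂_a y).continuousOn) fun u hu => by
      have := R.pos u hu y hy; positivity

theorem continuousOn_lieLift_beta (hv : ∀ i, ContDiffOn ℝ 1 (fun w => v w i) R.U) (y : Coord n) :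
    ContinuousOn (fun u => lieLift v R.beta u y) R.U := by
  refine ContinuousOn.congr (f := fun u => contr (fun j => (∑ k, v u k * pd k (fun w => R.b w j) u)
      + ∑ i, R.b u i * pd j (fun w => v w i) u) y) ?_ fun u hu => R.lieLift_beta hu y
  have h1 : ∀ i k, ContinuousOn (pd k (fun w => R.b w i)) R.U :=
    fun i k => (contDiffOn_pd (R.smooth_b i) k).continuousOn
  have h2 : ∀ i k, ContinuousOn (pd k (fun w => v w i)) R.U := fun i k => continuousOn_pd (hv i) k
  have h3 : ∀ i, ContinuousOn (fun w => v w i) R.U := fun i => (hv i).continuousOn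
  have h4 : ∀ i, ContinuousOn (fun w => R.b w i) R.U := fun i => (R.smooth_b i).continuousOn
  exact continuousOn_finsetSum _ fun j _ => ContinuousOn.mul ((continuousOn_finsetSum _ fun k _ =>
    (h3 _).mul (h1 _ _)).add (continuousOn_finsetSum _ fun i _ => (h4 _).mul (h2 _ _)))
    continuousOn_const

/-- The equation for `dσ` on all of `U`: where `β` vanishes on an open set, so do `σ` and
all terms. In contrast to this, `V` need not be conformal there. -/
theorem dsigma_eq (hn : 2 ≤ n) (hv : ∀ i, ContDiffOn ℝ 1 (fun w => v w i) R.U)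
    (hsol : ∀ u ∈ R.U, ∀ y : Coord n, y ≠ 0 → 2 * ricci R.F u y + lieLift v (energy R.F) u y
      = 2 * κ u * R.F u y ^ 2) {y₁ : Coord n} (hy₁ : y₁ ≠ 0) {u : Coord n} (hu : u ∈ R.U)
    (y : Coord n) : 3 * ((n : ℝ) - 1) * contr (fun i => pd i (R.sigma y₁) u) y
      = 2 * R.confFactor v y₁ u * R.beta u y - lieLift v R.beta u y := by
  have hd : ∀ i, DifferentiableOn ℝ (fun w => v w i) R.U := fun i => (hv i).differentiableOn one_ne_zero
  have hE := R.isotropic_sigma hn hd hsol hy₁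
  have hσ := R.smooth_sigma hy₁
  have := eq_zero_of_eq_zero_dense R.U.2 (b := R.b)
    (g := fun u => 3 * ((n : ℝ) - 1) * contr (fun i => pd i (R.sigma y₁) u) y
      - (2 * R.confFactor v y₁ u * R.beta u y - lieLift v R.beta u y))
    ((continuousOn_const.mul (continuousOn_finsetSum _ fun i _ =>
        (contDiffOn_pd hσ i).continuousOn.mul continuousOn_const)).sub
      (((continuousOn_const.mul (R.continuousOn_confFactor hv hy₁)).mul
        (R.smooth_beta_left y).continuousOn).sub (R.continuousOn_lieLift_beta hv y))) ?_ ?_ hu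
  · linarith
  · intro u hu hb
    have hdu : ∀ i, DifferentiableAt ℝ (fun w => v w i) u :=
      fun i => (hd i).differentiableAt (R.U.2.mem_nhds hu)
    obtain ⟨c, hc⟩ := (R.conformal_and_isotropic hn hu hb hdu (hsol u hu)).1
    rw [R.confFactor_eq hy₁ hu hc, (equations_of_soliton (by omega) hE hσ hu hdu hc (hsol u hu) y).2,
      sub_self]
  · intro u hu hb
    have h1 : ∀ i, pd i (R.sigma y₁) u = 0 := by
      intro i
      have : R.sigma y₁ =ᶠ[nhds u] fun _ => 0 := by
        filter_upwards [hb.eventually_nhds] with w hw using R.sigma_eq_zero y₁ hw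
      rw [pd, this.fderiv_eq]
      simp
    have h2 : R.b u = 0 := hb.self_of_nhds
    rw [R.lieLift_beta hu]
    simp [h1, h2, R.pd_b_eq_zero hb, contr, beta]

end LocalRanders

end
end RandersSoliton

namespace RandersSoliton
noncomputable section
open Set TopologicalSpace
open SmoothFun Finset Asymptotics

/-! ### Unique continuation for `β` -/

theorem hasDerivAt_line {n : ℕ} {f : Coord n → ℝ} {u w : Coord n} {t : ℝ}
    (hf : DifferentiableAt ℝ f (u + t • w)) :
    HasDerivAt (fun t : ℝ => f (u + t • w)) (∑ k, w k * pd k f (u + t • w)) t := by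
  have h1 : HasDerivAt (fun t : ℝ => u + t • w) w t := by
    simpa using ((hasDerivAt_id t).smul_const w).const_add u
  have h2 := hf.hasFDerivAt.comp_hasDerivAt t h1
  have h3 : fderiv ℝ f (u + t • w) w = ∑ k, w k * pd k f (u + t • w) := by
    have hw : w = ∑ k, w k • EuclideanSpace.single k (1 : ℝ) := by
      ext i
      simp [Pi.single_apply]
    have hφ : ∀ φ : Coord n →L[ℝ] ℝ, φ w = ∑ k, w k * φ (EuclideanSpace.single k 1) := by
      intro φ
      conv_lhs => rw [hw]
      simp [map_sum]
    exact hφ _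
  rw [← h3]
  exact h2

/-- A tuple of functions whose partial derivatives are bounded by the tuple itself vanishes near each of
its zeros: the Grönwall inequality on the segments that start at the zero. -/
theorem eventually_eq_zero_of_pd_isBigO {n : ℕ} {ι : Type*} [Fintype ι] {U : Opens (Coord n)}
    {X : Coord n → ι → ℝ} (hX : ∀ i, ∀ u ∈ U, DifferentiableAt ℝ (fun u => X u i) u) {u₀ : Coord n}
    (hu₀ : u₀ ∈ U) (hO : ∀ i k, (pd k fun u => X u i) =O[nhds u₀] X) (h0 : X u₀ = 0) :
    ∀ᶠ u in nhds u₀, X u = 0 := by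
  have hO' : ∀ k, (fun u i => pd k (fun u => X u i) u) =O[nhds u₀] X :=
    fun k => isBigO_pi.mpr fun i => hO i k
  choose C hC using fun k => (hO' k).bound
  obtain ⟨r, hr, hball⟩ := Metric.eventually_nhds_iff_ball.mp
    ((Filter.eventually_all.mpr hC).and (U.2.mem_nhds hu₀))
  filter_upwards [Metric.ball_mem_nhds u₀ hr] with u hu
  set w := u - u₀ with hw
  have hmem : ∀ t ∈ Set.Icc (0 : ℝ) 1, u₀ + t • w ∈ Metric.ball u₀ r := by
    intro t ht
    rw [mem_ball_iff_norm, add_sub_cancel_left, norm_smul, Real.norm_eq_abs, abs_of_nonneg ht.1]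
    have : ‖w‖ < r := by rw [hw]; exact mem_ball_iff_norm.mp hu
    nlinarith [norm_nonneg w, ht.2]
  have hd : ∀ t ∈ Set.Icc (0 : ℝ) 1, HasDerivAt (fun t : ℝ => X (u₀ + t • w))
      (fun i => ∑ k, w k * pd k (fun u => X u i) (u₀ + t • w)) t := by
    intro t ht
    rw [hasDerivAt_pi]
    exact fun i => hasDerivAt_line (hX i _ (hball _ (hmem t ht)).2)
  have key := eq_zero_of_abs_deriv_le_mul_abs_self_of_eq_zero_right (a := 0) (b := 1)
    (f := fun t : ℝ => X (u₀ + t • w)) (K := ∑ k, |w k| * C k)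
    (f' := fun t i => ∑ k, w k * pd k (fun u => X u i) (u₀ + t • w))
    (fun t ht => (hd t ht).continuousAt.continuousWithinAt)
    (fun t ht => (hd t ⟨ht.1, ht.2.le⟩).hasDerivWithinAt) (by simpa using h0) (fun t ht => by
      have ht' : t ∈ Set.Icc (0 : ℝ) 1 := ⟨ht.1, ht.2.le⟩
      have e : (fun i => ∑ k, w k * pd k (fun u => X u i) (u₀ + t • w))
          = ∑ k, w k • fun i => pd k (fun u => X u i) (u₀ + t • w) := by
        funext i; simp
      rw [e, sum_mul]
      refine (norm_sum_le _ _).trans (sum_le_sum fun k _ => ?_)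
      rw [norm_smul, Real.norm_eq_abs, mul_assoc]
      exact mul_le_mul_of_nonneg_left ((hball _ (hmem t ht')).1 k) (abs_nonneg _)) 1 (by simp)
  simpa [hw] using key

theorem isBigO_mul_left {n : ℕ} {u₀ : Coord n} {E : Type*} [NormedAddCommGroup E] {X : Coord n → E}
    {f g : Coord n → ℝ} (hf : ContinuousAt f u₀) (hg : g =O[nhds u₀] X) :
    (fun u => f u * g u) =O[nhds u₀] X := by
  have h1 : f =O[nhds u₀] fun _ => (1 : ℝ) := hf.isBigO_one ℝ
  have := h1.mul hg.norm_right
  simpa using this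

/-- Elements of the ideal generated by functions of order `O(X)` are of order `O(X)`. Functions of `x` are
read off from functions on `U × ⊤` by restriction to `y = 0`. -/
theorem isBigO_of_mem_span {n : ℕ} {U : Opens (Coord n)} {u₀ : Coord n} (hu₀ : u₀ ∈ U)
    {E : Type*} [NormedAddCommGroup E] {X : Coord n → E} {S : Set (SmoothFun (prodOpens U ⊤))}
    (hS : ∀ f ∈ S, (fun u => ext f (u, 0)) =O[nhds u₀] X) {f : SmoothFun (prodOpens U ⊤)}
    (hf : f ∈ Ideal.span S) : (fun u => ext f (u, 0)) =O[nhds u₀] X := by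
  have hev : ∀ f : SmoothFun (prodOpens U ⊤), ∀ h : Coord n → ℝ,
      (∀ u (hu : u ∈ U), f.1 ⟨(u, 0), hu, trivial⟩ = h u) →
      (fun u => ext f (u, 0)) =ᶠ[nhds u₀] h := by
    intro f h hh
    filter_upwards [U.2.mem_nhds hu₀] with u hu
    rw [← hh u hu]
    exact ext_apply f ⟨(u, 0), hu, trivial⟩
  induction hf using Submodule.span_induction with
  | mem f hf => exact hS f hf
  | zero => exact (hev 0 (fun _ => 0) fun u hu => rfl).trans_isBigO (isBigO_zero _ _)
  | add f g _ _ hf hg =>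
    refine (hev (f + g) (fun u => ext f (u, 0) + ext g (u, 0)) fun u hu => ?_).trans_isBigO
      (hf.add hg)
    rw [val_add, ← ext_apply f, ← ext_apply g]
  | smul a f _ hf =>
    refine (hev (a • f) (fun u => ext a (u, 0) * ext f (u, 0)) fun u hu => ?_).trans_isBigO
      (isBigO_mul_left ?_ hf)
    · rw [smul_eq_mul, val_mul, ← ext_apply a, ← ext_apply f]
    · have h1 : ContinuousAt (ext a) (u₀, (0 : Coord n)) :=
        (ext_differentiableAt a ⟨(u₀, 0), hu₀, trivial⟩).continuousAt
      exact h1.comp (f := fun u : Coord n => (u, (0 : Coord n))) (by fun_prop)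

/-- If the symmetrized derivative `∂ⱼbᵢ + ∂ᵢbⱼ` is expressed through `b` and `s`, then the second
derivatives of `b` are combinations of `b`, `∂b`, `s` and `∂s`. As for Killing fields, `2∂ₖ∂ⱼbᵢ` is a
combination of the derivatives of `∂ⱼbᵢ + ∂ᵢbⱼ`, `∂ₖbᵢ + ∂ᵢbₖ` and `∂ₖbⱼ + ∂ⱼbₖ`. -/
theorem FiberCalculus.XX_mem_span {n : ℕ} {A : Type*} [CommRing A] [Algebra ℝ A]
    (K : FiberCalculus n A) {b w : Fin n → A} {s : A} {Γ : Fin n → Fin n → Fin n → A}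
    {a : Fin n → Fin n → A} (h : ∀ i j, K.X j (b i) + K.X i (b j) = 2 * ∑ k, Γ k i j * b k
      + 4 * (s * (a i j - b i * b j)) - 2 * (b i * w j + b j * w i)) (i j k : Fin n) :
    K.X k (K.X j (b i)) ∈ Ideal.span (range b ∪ range (fun q : Fin n × Fin n => K.X q.2 (b q.1))
      ∪ {s} ∪ range fun k => K.X k s) := by
  set J := Ideal.span (range b ∪ range (fun q : Fin n × Fin n => K.X q.2 (b q.1))
      ∪ {s} ∪ range fun k => K.X k s) with hJ
  have hb : ∀ i, b i ∈ J := fun i => Ideal.subset_span (Or.inl (Or.inl (Or.inl ⟨i, rfl⟩)))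
  have hXb : ∀ i k, K.X k (b i) ∈ J :=
    fun i k => Ideal.subset_span (Or.inl (Or.inl (Or.inr ⟨(i, k), rfl⟩)))
  have hs : s ∈ J := Ideal.subset_span (Or.inl (Or.inr rfl))
  have hXs : ∀ k, K.X k s ∈ J := fun k => Ideal.subset_span (Or.inr ⟨k, rfl⟩)
  have hprod : ∀ {f : A} (g : A) (k), f ∈ J → K.X k f ∈ J → K.X k (f * g) ∈ J := by
    intro f g k h1 h2
    rw [Derivation.leibniz, smul_eq_mul, smul_eq_mul]
    exact J.add_mem (J.mul_mem_right _ h1) (J.mul_mem_left _ h2)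
  have hX2 : ∀ {f : A} (k), K.X k f ∈ J → K.X k (2 * f) ∈ J := by
    intro f k h
    rw [derivation_two_mul]
    exact J.mul_mem_left _ h
  have hQ : ∀ i j k, K.X k (K.X j (b i) + K.X i (b j)) ∈ J := by
    intro i j k
    have h4 : (4 : A) = 2 * 2 := by norm_num
    rw [h, map_sub, map_add, h4, mul_assoc]
    refine J.sub_mem (J.add_mem (hX2 k ?_) (hX2 k (hX2 k (hprod _ k hs (hXs k))))) (hX2 k ?_)
    · rw [map_sum]
      refine J.sum_mem fun l _ => ?_
      rw [mul_comm]
      exact hprod _ k (hb l) (hXb l k)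
    · rw [map_add]
      exact J.add_mem (hprod _ k (hb i) (hXb i k)) (hprod _ k (hb j) (hXb j k))
  have e : 2 * K.X k (K.X j (b i)) = K.X k (K.X j (b i) + K.X i (b j))
      + K.X j (K.X k (b i) + K.X i (b k)) - K.X i (K.X k (b j) + K.X j (b k)) := by
    simp only [map_add]
    rw [K.XX j k, K.XX i k, K.XX i j]
    ring
  have h2 : K.X k (K.X j (b i)) = (1 / 2 : ℝ) • (2 * K.X k (K.X j (b i))) := by algebra
  rw [h2, e, Algebra.smul_def]
  exact J.mul_mem_left _ (J.sub_mem (J.add_mem (hQ i j k) (hQ i k j)) (hQ j k i))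

namespace LocalRanders
variable {n : ℕ} (R : LocalRanders n) {σ : Coord n → ℝ}

/-- The right-hand side of `∂ⱼbᵢ + ∂ᵢbⱼ = 2Γᵏᵢⱼbₖ + 4σ(a_{ij} - bᵢbⱼ) - 2(bᵢsⱼ + bⱼsᵢ)`, which is the equation
`e_{ij} = 2σ(a_{ij} - bᵢbⱼ)`. -/
def killing (hσ : ContDiffOn ℝ ∞ σ R.U) (i j : Fin n) : SmoothFun (prodOpens R.U ⊤) :=
  2 * ∑ k, (R.metric ⊤).chr k i j * (R.form ⊤).b k
    + 4 * (base ⊤ σ hσ * ((R.metric ⊤).a i j - (R.form ⊤).b i * (R.form ⊤).b j))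
    - 2 * ((R.form ⊤).b i * (R.form ⊤).s1 j + (R.form ⊤).b j * (R.form ⊤).s1 i)

variable {R} in
theorem Isotropic.eT_eq (hE : R.Isotropic σ) {u : Coord n} (hu : u ∈ R.U) (i j : Fin n) :
    eT R.a R.b u i j = 2 * σ u * (R.a u i j - R.b u i * R.b u j) := by
  have hsymm : ∀ i j, eT R.a R.b u i j = eT R.a R.b u j i := fun i j => by simp only [eT, rT]; ring
  have h := add_swap_eq_of_contr₂_eq (m := eT R.a R.b u)
    (m' := fun i j => 2 * σ u * (R.a u i j - R.b u i * R.b u j)) (fun y => ?_) i j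
  · rw [hsymm j i, R.symm u j i] at h
    linarith
  · rw [hE u hu]
    have : R.beta u y ^ 2 = ∑ i, ∑ j, (R.b u i * y i) * (R.b u j * y j) := by
      rw [pow_two, beta, contr, sum_mul_sum]
    rw [this]
    simp only [contr₂, mul_sum, ← sum_sub_distrib]
    exact sum_congr rfl fun i _ => sum_congr rfl fun j _ => by ring

variable {R} in
theorem Isotropic.X_b_add (hE : R.Isotropic σ) (hσ : ContDiffOn ℝ ∞ σ R.U) (i j : Fin n) :
    (smoothCalculus R.U ⊤).X j ((R.form ⊤).b i) + (smoothCalculus R.U ⊤).X i ((R.form ⊤).b j)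
      = R.killing hσ i j := by
  apply Subtype.ext; funext p
  have h1 := hE.eT_eq p.2.1 i j
  have h2 := (R.rep_covD (R.rep_b ⊤) i j) p
  have h3 := (R.rep_covD (R.rep_b ⊤) j i) p
  have h4 := R.rep_s1 ⊤ i p
  have h5 := R.rep_s1 ⊤ j p
  dsimp only at h2 h3 h4 h5
  rw [eT, rT, h2, h3, h4, h5] at h1
  have h6 : ((R.form ⊤).b i).1 p = R.b p.1.1 i := rfl
  have h7 : ((R.form ⊤).b j).1 p = R.b p.1.1 j := rfl
  have h8 : ((R.metric ⊤).a i j).1 p = R.a p.1.1 i j := rfl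
  have h9 : (base ⊤ σ hσ).1 p = σ p.1.1 := rfl
  simp only [covForm, (R.metric ⊤).chr_symm _ j i] at h1
  rw [val_sub, val_sub] at h1
  simp only [killing, val_add, val_sub, val_mul, val_two, val_four, h6, h7, h8, h9]
  linear_combination 2 * h1

variable {R} in
theorem Isotropic.XX_b_mem (hE : R.Isotropic σ) (hσ : ContDiffOn ℝ ∞ σ R.U) (i j k : Fin n) :
    (smoothCalculus R.U ⊤).X k ((smoothCalculus R.U ⊤).X j ((R.form ⊤).b i)) ∈
      Ideal.span (range (R.form ⊤).b ∪ range (fun q : Fin n × Fin n => (smoothCalculus R.U ⊤).X q.2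
        ((R.form ⊤).b q.1)) ∪ {base ⊤ σ hσ} ∪ range fun k => (smoothCalculus R.U ⊤).X k (base ⊤ σ hσ)) :=
  (smoothCalculus R.U ⊤).XX_mem_span (hE.X_b_add hσ) i j k

/-- The functions `bᵢ`, `∂ⱼbᵢ` and `σ`, for which the equations of a soliton form a closed system. -/
def jet (σ : Coord n → ℝ) (u : Coord n) : Fin n ⊕ (Fin n × Fin n) ⊕ Unit → ℝ
  | .inl i => R.b u i
  | .inr (.inl q) => pd q.2 (fun w => R.b w q.1) u
  | .inr (.inr _) => σ u

variable {v : Coord n → Fin n → ℝ} {c : Coord n → ℝ}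

variable {R} in
/-- Unique continuation: `b` vanishes near every zero of `(b, ∂b, σ)`. The second derivatives of `b` are
controlled by `XX_mem_span`, and `dσ` by the equation `3(n - 1)dσ = 2cβ - ℒ_{V̂}β`. -/
theorem Isotropic.eventually_b_eq_zero (hE : R.Isotropic σ) (hσ : ContDiffOn ℝ ∞ σ R.U)
    (hn : 2 ≤ n) (hv : ∀ i, ContDiffOn ℝ 1 (fun w => v w i) R.U) (hc : ContinuousOn c R.U)
    (hlie : ∀ u ∈ R.U, ∀ y, 3 * ((n : ℝ) - 1) * contr (fun i => pd i σ u) y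
      = 2 * c u * R.beta u y - lieLift v R.beta u y) {u₀ : Coord n} (hu₀ : u₀ ∈ R.U)
    (h0 : R.jet σ u₀ = 0) : ∀ᶠ u in nhds u₀, R.b u = 0 := by
  have hmem := R.U.2.mem_nhds hu₀
  have hN : 3 * ((n : ℝ) - 1) ≠ 0 := by
    have : (2 : ℝ) ≤ n := by exact_mod_cast hn
    exact mul_ne_zero three_ne_zero (by linarith)
  have hb : ∀ i, (fun u => R.b u i) =O[nhds u₀] R.jet σ := fun i =>
    IsBigO.of_bound' (Filter.Eventually.of_forall fun u => norm_le_pi_norm (R.jet σ u) (.inl i))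
  have hdb : ∀ i j, (pd j fun w => R.b w i) =O[nhds u₀] R.jet σ := fun i j =>
    IsBigO.of_bound' (Filter.Eventually.of_forall fun u => norm_le_pi_norm (R.jet σ u) (.inr (.inl (i, j))))
  have hs : σ =O[nhds u₀] R.jet σ :=
    IsBigO.of_bound' (Filter.Eventually.of_forall fun u => norm_le_pi_norm (R.jet σ u) (.inr (.inr ())))
  have hds : ∀ k, pd k σ =O[nhds u₀] R.jet σ := by
    intro k
    have e : pd k σ =ᶠ[nhds u₀] fun u => (3 * ((n : ℝ) - 1))⁻¹ * ((2 * c u) * R.b u k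
        - ((∑ m, v u m * pd m (fun w => R.b w k) u)
          + ∑ i, pd k (fun w => v w i) u * R.b u i)) := by
      filter_upwards [hmem] with u hu
      have := hlie u hu (EuclideanSpace.single k 1)
      rw [R.lieLift_beta hu, contr_single, contr_single, beta, contr_single] at this
      simp only [mul_comm (pd k _ u)]
      rw [← this, inv_mul_cancel_left₀ hN]
    refine e.trans_isBigO (isBigO_mul_left continuousAt_const (IsBigO.sub
      (isBigO_mul_left (continuousAt_const.mul (hc.continuousAt hmem)) (hb k)) (IsBigO.add
        (IsBigO.fun_sum fun m _ => isBigO_mul_left ((hv m).continuousOn.continuousAt hmem) (hdb k m))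
        (IsBigO.fun_sum fun i _ => isBigO_mul_left
          ((continuousOn_pd (hv i) k).continuousAt hmem) (hb i)))))
  have hext : ∀ {L : Coord n → Coord n → ℝ} {f : SmoothFun (prodOpens R.U ⊤)}, Rep L f →
      (fun u => ext f (u, 0)) =ᶠ[nhds u₀] fun u => L u 0 := by
    intro L f h
    filter_upwards [hmem] with u hu
    exact (ext_apply f ⟨(u, 0), hu, trivial⟩).trans (h ⟨(u, 0), hu, trivial⟩).symm
  have hddb : ∀ i j k, (pd k (pd j fun w => R.b w i)) =O[nhds u₀] R.jet σ := by
    intro i j k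
    refine (hext (((R.rep_b ⊤ i).dx j).dx k)).symm.trans_isBigO
      (isBigO_of_mem_span hu₀ ?_ (hE.XX_b_mem hσ i j k))
    rintro f (((⟨l, rfl⟩ | ⟨⟨l, m⟩, rfl⟩) | rfl) | ⟨l, rfl⟩)
    · exact (hext (R.rep_b ⊤ l)).trans_isBigO (hb l)
    · exact (hext ((R.rep_b ⊤ l).dx m)).trans_isBigO (hdb l m)
    · exact (hext (rep_base ⊤ σ hσ)).trans_isBigO hs
    · exact (hext ((rep_base ⊤ σ hσ).dx l)).trans_isBigO (hds l)
  have hdiff : ∀ {f : Coord n → ℝ}, ContDiffOn ℝ ∞ f R.U → ∀ u ∈ R.U, DifferentiableAt ℝ f u :=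
    fun hf u hu => (hf.contDiffAt (R.U.2.mem_nhds hu)).differentiableAt (by simp)
  have := eventually_eq_zero_of_pd_isBigO (X := R.jet σ) (U := R.U) ?_ hu₀ ?_ h0
  · filter_upwards [this] with u hu
    funext i
    exact congrFun hu (.inl i)
  · rintro (i | ⟨i, j⟩ | _)
    · exact hdiff (R.smooth_b i)
    · exact hdiff (contDiffOn_pd (R.smooth_b i) j)
    · exact hdiff hσ
  · rintro (i | ⟨i, j⟩ | _) k
    · exact hdb i k
    · exact hddb i j k
    · exact hds k

end LocalRanders

end
end RandersSoliton

namespace RandersSoliton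
noncomputable section
open Set TopologicalSpace
open Finset

/-! ### Randers metrics in charts -/

variable {n : ℕ} {M : Type*} [TopologicalSpace M] [ChartedSpace (Coord n) M]
variable {e e' : OpenPartialHomeomorph M (Coord n)}

theorem mdifferentiable_of_mem_maximalAtlas (he : e ∈ IsManifold.maximalAtlas (𝓡 n) ∞ M) :
    e.MDifferentiable (𝓡 n) (𝓡 n) :=
  ⟨(contMDiffOn_of_mem_maximalAtlas he).mdifferentiableOn (by simp),
    (contMDiffOn_symm_of_mem_maximalAtlas he).mdifferentiableOn (by simp)⟩

theorem tangentVec_eq_sum (e : OpenPartialHomeomorph M (Coord n)) (u y : Coord n) :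
    tangentVec e u y = ∑ i, y i • tangentVec e u (EuclideanSpace.single i 1) := by
  have h : y = ∑ i, y i • EuclideanSpace.single i (1 : ℝ) := by
    have := (EuclideanSpace.basisFun (Fin n) ℝ).sum_repr y
    simpa using this.symm
  conv_lhs => rw [h]
  exact (map_sum (mfderiv (𝓡 n) (𝓡 n) e.symm u) _ _).trans
    (sum_congr rfl fun i _ => map_smul (mfderiv (𝓡 n) (𝓡 n) e.symm u) _ _)

variable [IsManifold (𝓡 n) ∞ M]

/-- The chart sends the tangent vector `yⁱ ∂/∂xⁱ` to `y`. -/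
theorem mfderiv_tangentVec (he : e ∈ IsManifold.maximalAtlas (𝓡 n) ∞ M) {u : Coord n}
    (hu : u ∈ e.target) (y : Coord n) :
    mfderiv (𝓡 n) (𝓡 n) e (e.symm u) (tangentVec e u y) = y := by
  have h := (mdifferentiable_of_mem_maximalAtlas he).comp_symm_deriv hu
  exact congrArg (fun f => f y) h

/-- A vector field is `Vⁱ ∂/∂xⁱ`. -/
theorem tangentVec_vecComp (he : e ∈ IsManifold.maximalAtlas (𝓡 n) ∞ M)
    (V : ∀ x : M, TangentSpace (𝓡 n) x) {u : Coord n} (hu : u ∈ e.target) :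
    tangentVec e u (WithLp.toLp 2 (vecComp e V u)) = V (e.symm u) := by
  have h := (mdifferentiable_of_mem_maximalAtlas he).symm_comp_deriv (e.map_target hu)
  rw [e.right_inv hu] at h
  exact congrArg (fun f => f (V (e.symm u))) h

theorem tangentVec_injective (he : e ∈ IsManifold.maximalAtlas (𝓡 n) ∞ M) {u : Coord n}
    (hu : u ∈ e.target) : Function.Injective (tangentVec e u) := fun y z h => by
  rw [← mfderiv_tangentVec he hu y, h, mfderiv_tangentVec he hu z]

theorem tangentVec_ne_zero (he : e ∈ IsManifold.maximalAtlas (𝓡 n) ∞ M) {u : Coord n}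
    (hu : u ∈ e.target) {y : Coord n} (hy : y ≠ 0) : tangentVec e u y ≠ 0 := fun h =>
  hy (tangentVec_injective he hu (h.trans (map_zero (mfderiv (𝓡 n) (𝓡 n) e.symm u)).symm))

/-- The coordinate vector fields of a chart are smooth. -/
theorem contMDiffOn_tangentVec (he : e ∈ IsManifold.maximalAtlas (𝓡 n) ∞ M) (y : Coord n) :
    ContMDiffOn (𝓡 n) (𝓡 n).tangent ∞
      (fun u => (⟨e.symm u, tangentVec e u y⟩ : TangentBundle (𝓡 n) M)) e.target := by
  have h1 := (contMDiffOn_symm_of_mem_maximalAtlas he).contMDiffOn_tangentMapWithin (m := ∞)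
    (by simp) e.open_target.uniqueMDiffOn
  have h2 : ContMDiffOn (𝓡 n) (𝓡 n).tangent ∞
      (fun u : Coord n => (⟨u, y⟩ : TangentBundle (𝓡 n) (Coord n))) e.target :=
    contMDiffOn_vectorSpace_iff_contDiffOn.2 contDiffOn_const
  refine (h1.comp h2 fun u hu => hu).congr fun u hu => ?_
  simp only [Function.comp, tangentMapWithin, tangentVec]
  rw [mfderivWithin_of_isOpen e.open_target hu]

/-- The components of a vector field inherit its smoothness. -/
theorem contDiffOn_vecComp (he : e ∈ IsManifold.maximalAtlas (𝓡 n) ∞ M)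
    {V : ∀ x : M, TangentSpace (𝓡 n) x}
    (hV : ContMDiff (𝓡 n) (𝓡 n).tangent 2 (fun x => (⟨x, V x⟩ : TangentBundle (𝓡 n) M)))
    (i : Fin n) : ContDiffOn ℝ 2 (fun u => vecComp e V u i) e.target := by
  have h1 := (contMDiffOn_of_mem_maximalAtlas he).contMDiffOn_tangentMapWithin (m := 2)
    (show ((2 : ℕ∞) : WithTop ℕ∞) + ((1 : ℕ∞) : WithTop ℕ∞) ≤ ∞ by exact_mod_cast le_top) e.open_source.uniqueMDiffOn
  have h2 := hV.comp_contMDiffOn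
    ((contMDiffOn_symm_of_mem_maximalAtlas he).of_le (show ((2 : ℕ∞) : WithTop ℕ∞) ≤ ∞ by exact_mod_cast le_top))
  have h3 : ContMDiffOn (𝓡 n) (𝓡 n).tangent 2
      (fun u : Coord n => (⟨u, WithLp.toLp 2 (vecComp e V u)⟩ : TangentBundle (𝓡 n) (Coord n)))
      e.target := by
    refine (h1.comp h2 fun u hu => e.map_target hu).congr fun u hu => ?_
    simp only [Function.comp, tangentMapWithin]
    rw [mfderivWithin_of_isOpen e.open_source (e.map_target hu), e.right_inv hu]
    rfl
  have h4 := contMDiffOn_vectorSpace_iff_contDiffOn.1 h3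
  exact (EuclideanSpace.proj (𝕜 := ℝ) i).contDiff.comp_contDiffOn h4

namespace RandersMetric
variable (R : RandersMetric n M)

theorem contr₂_aMat (e : OpenPartialHomeomorph M (Coord n)) (u y : Coord n) :
    contr₂ (R.aMat e u) y = R.a.inner (e.symm u) (tangentVec e u y) (tangentVec e u y) := by
  rw [tangentVec_eq_sum e u y]
  simp only [map_sum, map_smul, _root_.sum_apply, _root_.smul_apply,
    smul_eq_mul, contr₂, aMat, Matrix.of_apply, mul_sum]
  rw [sum_comm]
  exact sum_congr rfl fun i _ => sum_congr rfl fun j _ => by ring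

theorem contr_bVec (e : OpenPartialHomeomorph M (Coord n)) (u y : Coord n) :
    contr (R.bVec e u) y = R.β (e.symm u) (tangentVec e u y) := by
  rw [tangentVec_eq_sum e u y]
  simp only [map_sum, map_smul, smul_eq_mul, contr, bVec, mul_comm]

theorem contDiffOn_aMat (he : e ∈ IsManifold.maximalAtlas (𝓡 n) ∞ M) (i j : Fin n) :
    ContDiffOn ℝ ∞ (fun u => R.aMat e u i j) e.target := by
  have h0 := R.a.contMDiff.comp_contMDiffOn (contMDiffOn_symm_of_mem_maximalAtlas he)
  have h1 : ContMDiffOn (𝓡 n) ((𝓡 n).prod 𝓘(ℝ, ℝ)) ∞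
      (fun u => (⟨e.symm u, R.aMat e u i j⟩ : Bundle.TotalSpace ℝ (Bundle.Trivial M ℝ)))
      e.target :=
    ContMDiffOn.clm_bundle_apply₂ (F₁ := Coord n) (F₂ := Coord n) h0
      (contMDiffOn_tangentVec he _) (contMDiffOn_tangentVec he _)
  intro u hu
  have h2 := (Bundle.contMDiffWithinAt_totalSpace.1 (h1 u hu)).2
  exact h2.contDiffWithinAt

theorem contDiffOn_bVec (he : e ∈ IsManifold.maximalAtlas (𝓡 n) ∞ M) (i : Fin n) :
    ContDiffOn ℝ ∞ (fun u => R.bVec e u i) e.target := by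
  have h0 := R.contMDiff_β.comp_contMDiffOn (contMDiffOn_symm_of_mem_maximalAtlas he)
  have h1 : ContMDiffOn (𝓡 n) ((𝓡 n).prod 𝓘(ℝ, ℝ)) ∞
      (fun u => (⟨e.symm u, R.bVec e u i⟩ : Bundle.TotalSpace ℝ (Bundle.Trivial M ℝ)))
      e.target :=
    ContMDiffOn.clm_bundle_apply (F₁ := Coord n) (F₂ := ℝ) h0 (contMDiffOn_tangentVec he _)
  intro u hu
  have h2 := (Bundle.contMDiffWithinAt_totalSpace.1 (h1 u hu)).2
  exact h2.contDiffWithinAt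

/-- The expression of a Randers metric in a chart. -/
def toLocal (he : e ∈ IsManifold.maximalAtlas (𝓡 n) ∞ M) : LocalRanders n where
  U := ⟨e.target, e.open_target⟩
  a := R.aMat e
  b := R.bVec e
  smooth_a := R.contDiffOn_aMat he
  smooth_b := R.contDiffOn_bVec he
  symm u i j := R.a.symm _ _ _
  pos u hu y hy := by
    rw [R.contr₂_aMat]
    exact R.a.pos _ _ (tangentVec_ne_zero he hu hy)
  lt u hu y hy := by
    rw [R.contr₂_aMat, R.contr_bVec]
    exact R.norm_β_lt_one _ _ (tangentVec_ne_zero he hu hy)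

variable (he : e ∈ IsManifold.maximalAtlas (𝓡 n) ∞ M)

theorem inChart_α : inChart e R.α = (R.toLocal he).alpha := by
  funext u y
  exact congrArg Real.sqrt (R.contr₂_aMat e u y).symm

theorem inChart_β : inChart e (fun x v => R.β x v) = (R.toLocal he).beta := by
  funext u y
  exact (R.contr_bVec e u y).symm

theorem inChart_F : inChart e R.F = (R.toLocal he).F := by
  funext u y
  exact congrArg₂ (· + ·) (congrFun (congrFun (R.inChart_α he) u) y)
    (congrFun (congrFun (R.inChart_β he) u) y)

end RandersMetric

end
end RandersSoliton

namespace RandersSoliton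
noncomputable section
open Set TopologicalSpace
open Finset

/-! ### Change of charts -/

theorem contr_pd {n : ℕ} (f : Coord n → ℝ) (u y : Coord n) :
    contr (fun i => pd i f u) y = fderiv ℝ f u y := by
  have h : y = ∑ i, y i • EuclideanSpace.single i (1 : ℝ) := by
    have := (EuclideanSpace.basisFun (Fin n) ℝ).sum_repr y
    simpa using this.symm
  conv_rhs => rw [h]
  simp only [map_sum, map_smul, contr, pd, smul_eq_mul, mul_comm]

/-- The complete lift of `v` at `(u, y)` is the vector `(v u, Dv_u y)`. -/
theorem lieLift_eq_fderiv {n : ℕ} {v : Coord n → Fin n → ℝ} {L : Coord n → Coord n → ℝ}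
    {u y : Coord n} (hL : DifferentiableAt ℝ (fun p : Coord n × Coord n => L p.1 p.2) (u, y))
    (hv : DifferentiableAt ℝ (fun w => (WithLp.toLp 2 (v w) : Coord n)) u) :
    lieLift v L u y = fderiv ℝ (fun p : Coord n × Coord n => L p.1 p.2) (u, y)
      ((WithLp.toLp 2 (v u) : Coord n), fderiv ℝ (fun w => (WithLp.toLp 2 (v w) : Coord n)) u y) := by
  set D := fderiv ℝ (fun p : Coord n × Coord n => L p.1 p.2) (u, y) with hD
  have h1 : ∀ z, fderiv ℝ (fun w => L w y) u z = D (z, 0) := fun z => by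
    have h := (hL.hasFDerivAt.comp (f := fun w => (w, y)) u (hasFDerivAt_prodMk_left u y)).fderiv
    exact congrArg (fun f => f z) h
  have h2 : ∀ z, fderiv ℝ (L u) y z = D (0, z) := fun z => by
    have h := (hL.hasFDerivAt.comp (f := fun w => (u, w)) y (hasFDerivAt_prodMk_right u y)).fderiv
    exact congrArg (fun f => f z) h
  have h3 : ∀ i, fderiv ℝ (fun w => (WithLp.toLp 2 (v w) : Coord n)) u y i
      = ∑ j, y j * pd j (fun w => v w i) u := fun i => by
    have h := ((EuclideanSpace.proj (𝕜 := ℝ) i).hasFDerivAt.comp u hv.hasFDerivAt).fderiv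
    rw [show (∑ j, y j * pd j (fun w => v w i) u) = contr (fun j => pd j (fun w => v w i) u) y from
      sum_congr rfl fun j _ => mul_comm _ _, contr_pd]
    exact (congrArg (fun f => f y) h).symm
  have h4 : ∀ z z' : Coord n, D (z, z') = D (z, 0) + D (0, z') := fun z z' => by
    rw [← map_add]; simp
  rw [h4, ← h1, ← h2, ← contr_pd, ← contr_pd]
  simp only [contr, h3, lieLift, mul_comm (pd _ _ u)]
  congr 1
  exact sum_congr rfl fun i _ => by rw [mul_comm, sum_mul]; rfl

/-- The derivative along the complete lift does not depend on the coordinates. -/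
theorem lieLift_comp {n : ℕ} {v v' : Coord n → Fin n → ℝ} {L L' : Coord n → Coord n → ℝ}
    {φ : Coord n → Coord n} {u y : Coord n} (hφ : ContDiffAt ℝ ∞ φ u)
    (hL' : DifferentiableAt ℝ (fun p : Coord n × Coord n => L' p.1 p.2) (φ u, fderiv ℝ φ u y))
    (hv : DifferentiableAt ℝ (fun w => (WithLp.toLp 2 (v w) : Coord n)) u)
    (hv' : DifferentiableAt ℝ (fun w => (WithLp.toLp 2 (v' w) : Coord n)) (φ u))
    (hvv : ∀ᶠ w in nhds u, WithLp.toLp 2 (v' (φ w)) = fderiv ℝ φ w (WithLp.toLp 2 (v w)))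
    (hLL : ∀ᶠ w in nhds u, ∀ z, L w z = L' (φ w) (fderiv ℝ φ w z)) :
    lieLift v L u y = lieLift v' L' (φ u) (fderiv ℝ φ u y) := by
  have hd : DifferentiableAt ℝ φ u := hφ.differentiableAt (by simp)
  have hd2 : DifferentiableAt ℝ (fderiv ℝ φ) u :=
    (hφ.fderiv_right (m := 1)
      (show ((1 : ℕ∞) : WithTop ℕ∞) + ((1 : ℕ∞) : WithTop ℕ∞) ≤ ∞ by exact_mod_cast le_top)).differentiableAt one_ne_zero
  have hsymm : ∀ a b, fderiv ℝ (fderiv ℝ φ) u a b = fderiv ℝ (fderiv ℝ φ) u b a := by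
    intro a b
    exact (hφ.isSymmSndFDerivAt (by
      rw [minSmoothness_of_isRCLikeNormedField]
      exact show ((2 : ℕ∞) : WithTop ℕ∞) ≤ ∞ by exact_mod_cast le_top)) a b
  let Φ : Coord n × Coord n → Coord n × Coord n := fun p => (φ p.1, fderiv ℝ φ p.1 p.2)
  have hfst : HasFDerivAt (fun p : Coord n × Coord n => p.1) (ContinuousLinearMap.fst ℝ _ _) (u, y) :=
    hasFDerivAt_fst
  have hΦ : HasFDerivAt Φ _ (u, y) :=
    (hd.hasFDerivAt.comp (f := fun p : Coord n × Coord n => p.1) (u, y) hfst).prodMk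
      ((hd2.hasFDerivAt.comp (f := fun p : Coord n × Coord n => p.1) (u, y) hfst).clm_apply
        hasFDerivAt_snd)
  have hLe : (fun p : Coord n × Coord n => L p.1 p.2)
      =ᶠ[nhds (u, y)] (fun p : Coord n × Coord n => L' p.1 p.2) ∘ Φ := by
    have := (continuous_fst.tendsto (u, y)).eventually hLL
    filter_upwards [this] with p hp using hp p.2
  have hcomp := hL'.hasFDerivAt.comp (u, y) hΦ
  have hL := hcomp.congr_of_eventuallyEq hLe
  have hvd : fderiv ℝ (fun w => (WithLp.toLp 2 (v' w) : Coord n)) (φ u) (fderiv ℝ φ u y)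
      = fderiv ℝ (fderiv ℝ φ) u y (WithLp.toLp 2 (v u))
        + fderiv ℝ φ u (fderiv ℝ (fun w => (WithLp.toLp 2 (v w) : Coord n)) u y) := by
    have h1 := hv'.hasFDerivAt.comp u hd.hasFDerivAt
    have h2 := (hd2.hasFDerivAt.clm_apply hv.hasFDerivAt).congr_of_eventuallyEq hvv
    have h3 := congrArg (fun f => f y) (h1.unique h2)
    simp only [ContinuousLinearMap.comp_apply] at h3
    rw [h3]
    simp [add_comm]
  rw [lieLift_eq_fderiv hL.differentiableAt hv, lieLift_eq_fderiv hL' hv', hL.fderiv, hvd,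
    hvv.self_of_nhds, hsymm]
  simp [add_comm]

variable {n : ℕ} {M : Type*} [TopologicalSpace M] {e e' : OpenPartialHomeomorph M (Coord n)}

/-- The part of the target of `e` that corresponds to points in the domain of `e'` too. -/
def overlap (e e' : OpenPartialHomeomorph M (Coord n)) : Opens (Coord n) :=
  ⟨e.target ∩ e.symm ⁻¹' e'.source, e.isOpen_inter_preimage_symm e'.open_source⟩

/-- The change of charts `e' ∘ e⁻¹`, meaningful on `overlap e e'`. -/
def trans (e e' : OpenPartialHomeomorph M (Coord n)) (u : Coord n) : Coord n := e' (e.symm u)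

theorem trans_mem_target {u : Coord n} (hu : u ∈ overlap e e') : trans e e' u ∈ e'.target :=
  e'.map_source hu.2

theorem symm_trans {u : Coord n} (hu : u ∈ overlap e e') : e'.symm (trans e e' u) = e.symm u :=
  e'.left_inv hu.2

variable [ChartedSpace (Coord n) M]

/-- Congruence for functions on the tangent bundle. All tangent spaces are definitionally the model
space `Coord n`, so that vectors at different points can be compared. -/
theorem apply_congr_point (F : ∀ x : M, TangentSpace (𝓡 n) x → ℝ) {x x' : M} (h : x = x')
    {v v' : Coord n} (hv : v = v') : F x v = F x' v' := by
  subst h hv; rfl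

variable [IsManifold (𝓡 n) ∞ M]

section Transition
variable (he : e ∈ IsManifold.maximalAtlas (𝓡 n) ∞ M) (he' : e' ∈ IsManifold.maximalAtlas (𝓡 n) ∞ M)
include he he'

theorem contDiffAt_trans {u : Coord n} (hu : u ∈ overlap e e') : ContDiffAt ℝ ∞ (trans e e') u :=
  contMDiffAt_iff_contDiffAt.1 ((contMDiffAt_of_mem_maximalAtlas he' hu.2).comp u
    (contMDiffAt_symm_of_mem_maximalAtlas he hu.1))

theorem fderiv_trans {u : Coord n} (hu : u ∈ overlap e e') (y : Coord n) :
    fderiv ℝ (trans e e') u y = mfderiv (𝓡 n) (𝓡 n) e' (e.symm u) (tangentVec e u y) := by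
  rw [← mfderiv_eq_fderiv]
  have h := mfderiv_comp (I := 𝓡 n) (I' := 𝓡 n) (I'' := 𝓡 n) u
    ((mdifferentiable_of_mem_maximalAtlas he').mdifferentiableAt hu.2)
    ((mdifferentiable_of_mem_maximalAtlas he).mdifferentiableAt_symm hu.1)
  exact congrArg (fun f => f y) h

theorem tangentVec_trans {u : Coord n} (hu : u ∈ overlap e e') (y : Coord n) :
    (tangentVec e' (trans e e' u) (fderiv ℝ (trans e e') u y) : Coord n) = tangentVec e u y := by
  rw [fderiv_trans he he' hu]
  have h := (mdifferentiable_of_mem_maximalAtlas he').symm_comp_deriv hu.2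
  exact congrArg (fun f => f (tangentVec e u y)) h

theorem inChart_trans (F : ∀ x : M, TangentSpace (𝓡 n) x → ℝ) {u : Coord n}
    (hu : u ∈ overlap e e') (y : Coord n) :
    inChart e F u y = inChart e' F (trans e e' u) (fderiv ℝ (trans e e') u y) :=
  apply_congr_point F (symm_trans hu).symm (tangentVec_trans he he' hu y).symm

theorem vecComp_trans (V : ∀ x : M, TangentSpace (𝓡 n) x) {u : Coord n} (hu : u ∈ overlap e e') :
    (WithLp.toLp 2 (vecComp e' V (trans e e' u)) : Coord n)
      = fderiv ℝ (trans e e') u (WithLp.toLp 2 (vecComp e V u)) := by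
  rw [fderiv_trans he he' hu, tangentVec_vecComp he V hu.1]
  change mfderiv (𝓡 n) (𝓡 n) e' (e'.symm (trans e e' u)) (V (e'.symm (trans e e' u))) = _
  rw [symm_trans hu]

theorem fderiv_trans_surjective {u : Coord n} (hu : u ∈ overlap e e') :
    Function.Surjective (fderiv ℝ (trans e e') u) := by
  refine LinearMap.surjective_of_injective (f := (fderiv ℝ (trans e e') u).toLinearMap) fun y z h => ?_
  apply tangentVec_injective he hu.1
  have h1 := tangentVec_trans he he' hu y
  have h2 := tangentVec_trans he he' hu z
  have h3 : fderiv ℝ (trans e e') u y = fderiv ℝ (trans e e') u z := h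
  rw [h3] at h1
  exact h1.symm.trans h2

end Transition

end
end RandersSoliton

namespace RandersSoliton
noncomputable section
open Set TopologicalSpace
open Finset

/-! ### Independence of `σ` and `V_{0;0}` from the chart -/

theorem bil_add_swap {n : ℕ} (m : Fin n → Fin n → ℝ) (x y : Coord n) :
    bil m x y + bil m y x = contr₂ m (x + y) - contr₂ m x - contr₂ m y := by
  have := contr₂_smul_add m 1 x y
  rw [one_smul] at this
  rw [this]; ring

namespace LocalRanders
variable {n : ℕ} (R : LocalRanders n)

/-- `‖β‖²` as a function of the point: `β(b♯)`. -/
def normSq (u : Coord n) : ℝ := R.beta u (R.sharpVec u)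

/-- The vector `b♯` is determined by `a(b♯, ·) = β`. -/
theorem eq_sharpVec {u : Coord n} (hu : u ∈ R.U) {s : Coord n}
    (h : ∀ y, bil (R.a₂ u) s y = R.beta u y) : s = R.sharpVec u := by
  by_contra hne
  have hne' : s - R.sharpVec u ≠ 0 := sub_ne_zero.mpr hne
  have h1 := R.pos₂ hu hne'
  have h2 : ∀ y, bil (R.a₂ u) (s - R.sharpVec u) y = 0 := fun y => by
    have : bil (R.a₂ u) (s - R.sharpVec u) y = bil (R.a₂ u) s y - bil (R.a₂ u) (R.sharpVec u) y := by
      simp only [bil, ← sum_sub_distrib]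
      exact sum_congr rfl fun i _ => sum_congr rfl fun j _ => by simp; ring
    rw [this, h, R.bil_sharpVec hu, sub_self]
  have h3 : contr₂ (R.a₂ u) (s - R.sharpVec u) = bil (R.a₂ u) (s - R.sharpVec u) (s - R.sharpVec u) := rfl
  rw [h3, h2] at h1
  exact lt_irrefl _ h1

variable {R} in
/-- `d‖β‖²(b♯) = 4 ‖β‖² (1 - ‖β‖²) σ`; this expresses `σ` through invariant objects. -/
theorem Isotropic.fderiv_normSq_sharpVec {σ : Coord n → ℝ} (hE : R.Isotropic σ)
    (hσ : ContDiffOn ℝ ∞ σ R.U) {u : Coord n} (hu : u ∈ R.U) :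
    fderiv ℝ R.normSq u (R.sharpVec u) = 4 * R.normSq u * (1 - R.normSq u) * σ u := by
  let η := hE.fiber ⊤ hσ
  have h1 : ∑ i, (smoothCalculus R.U ⊤).X i η.q * η.B i
      = 2 * (1 - η.q) * (2 * η.σ * η.q) := by
    have e : ∀ i, (smoothCalculus R.U ⊤).X i η.q * η.B i
      = 2 * (1 - η.q) * (2 * η.σ) * (η.b i * η.B i) + 2 * (1 - η.q) * (η.s1 i * η.B i) := by
      intro i; rw [η.X_q]; ring
    have e1 : ∑ i, η.b i * η.B i = η.q := rfl
    simp only [e, sum_add_distrib, ← mul_sum, η.sum_s1_B, e1]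
    ring
  have h2 : Rep (fun u _ => ∑ i, pd i R.normSq u * R.sharpVec u i)
      (∑ i, (smoothCalculus R.U ⊤).X i η.q * η.B i) :=
    Rep.sum (s := univ) fun i => ((R.rep_q ⊤).dx i).mul (R.rep_B ⊤ i)
  have h3 := h2 ⟨(u, 0), hu, trivial⟩
  have hq : R.normSq u = η.q.1 ⟨(u, 0), hu, trivial⟩ := R.rep_q ⊤ ⟨(u, 0), hu, trivial⟩
  have hs : σ u = η.σ.1 ⟨(u, 0), hu, trivial⟩ := rfl
  rw [← contr_pd]
  refine h3.trans ?_
  rw [h1, hq, hs]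
  generalize η.q = q
  generalize η.σ = s
  simp only [SmoothFun.val_mul, SmoothFun.val_sub, SmoothFun.val_one, SmoothFun.val_two]
  ring

end LocalRanders

variable {n : ℕ} {M : Type*} [TopologicalSpace M] [ChartedSpace (Coord n) M]
variable [IsManifold (𝓡 n) ∞ M] {e e' : OpenPartialHomeomorph M (Coord n)}

namespace RandersMetric
variable (R : RandersMetric n M)
variable (he : e ∈ IsManifold.maximalAtlas (𝓡 n) ∞ M) (he' : e' ∈ IsManifold.maximalAtlas (𝓡 n) ∞ M)
include he he'

theorem contr₂_aMat_trans {u : Coord n} (hu : u ∈ overlap e e') (y : Coord n) :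
    contr₂ (R.aMat e u) y = contr₂ (R.aMat e' (trans e e' u)) (fderiv ℝ (trans e e') u y) := by
  rw [contr₂_aMat, contr₂_aMat]
  exact inChart_trans he he' (fun x v => R.a.inner x v v) hu y

theorem beta_trans {u : Coord n} (hu : u ∈ overlap e e') (y : Coord n) :
    (R.toLocal he).beta u y
      = (R.toLocal he').beta (trans e e' u) (fderiv ℝ (trans e e') u y) := by
  rw [← R.inChart_β, ← R.inChart_β]
  exact inChart_trans he he' _ hu y

theorem bil_trans {u : Coord n} (hu : u ∈ overlap e e') (y z : Coord n) :
    bil ((R.toLocal he).a₂ u) y z = bil ((R.toLocal he').a₂ (trans e e' u))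
      (fderiv ℝ (trans e e') u y) (fderiv ℝ (trans e e') u z) := by
  have h1 := bil_add_swap ((R.toLocal he).a₂ u) y z
  have h2 := bil_add_swap ((R.toLocal he').a₂ (trans e e' u))
      (fderiv ℝ (trans e e') u y) (fderiv ℝ (trans e e') u z)
  rw [LocalRanders.bil_comm _ _ z] at h1
  rw [LocalRanders.bil_comm _ _ (fderiv ℝ (trans e e') u z)] at h2
  have h3 : ∀ y, contr₂ ((R.toLocal he).a₂ u) y = contr₂ ((R.toLocal he').a₂ (trans e e' u))
    (fderiv ℝ (trans e e') u y) := R.contr₂_aMat_trans he he' hu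
  rw [h3, h3, h3, map_add] at h1
  linarith

theorem sharpVec_trans {u : Coord n} (hu : u ∈ overlap e e') :
    fderiv ℝ (trans e e') u ((R.toLocal he).sharpVec u)
      = (R.toLocal he').sharpVec (trans e e' u) := by
  refine LocalRanders.eq_sharpVec _ (trans_mem_target hu) fun y' => ?_
  obtain ⟨y, rfl⟩ := fderiv_trans_surjective he he' hu y'
  rw [← R.bil_trans he he' hu, ← R.beta_trans he he' hu]
  exact LocalRanders.bil_sharpVec _ hu.1 y

theorem normSq_trans {u : Coord n} (hu : u ∈ overlap e e') :
    (R.toLocal he).normSq u = (R.toLocal he').normSq (trans e e' u) := by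
  rw [LocalRanders.normSq, LocalRanders.normSq, R.beta_trans he he' hu, R.sharpVec_trans he he' hu]

/-- The function `σ` in `e₀₀ = 2σ(α² - β²)` does not depend on the chart where `β ≠ 0`. -/
theorem isotropic_trans_of_ne_zero {σ σ' : Coord n → ℝ} (hE : (R.toLocal he).Isotropic σ)
    (hσ : ContDiffOn ℝ ∞ σ e.target) (hE' : (R.toLocal he').Isotropic σ')
    (hσ' : ContDiffOn ℝ ∞ σ' e'.target) {u : Coord n} (hu : u ∈ overlap e e')
    (hb : R.bVec e u ≠ 0) : σ u = σ' (trans e e' u) := by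
  have h1 := hE.fderiv_normSq_sharpVec hσ hu.1
  have h2 := hE'.fderiv_normSq_sharpVec hσ' (trans_mem_target hu)
  have hd : DifferentiableAt ℝ (R.toLocal he').normSq (trans e e' u) :=
    (((R.toLocal he').smooth_normSq).contDiffAt
      (e'.open_target.mem_nhds (trans_mem_target hu))).differentiableAt (by simp)
  have hφ : DifferentiableAt ℝ (trans e e') u :=
    (contDiffAt_trans he he' hu).differentiableAt (by simp)
  have hev : (R.toLocal he).normSq =ᶠ[nhds u] (R.toLocal he').normSq ∘ trans e e' := by
    filter_upwards [(overlap e e').2.mem_nhds hu] with w hw using R.normSq_trans he he' hw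
  rw [hev.fderiv_eq, fderiv_comp u hd hφ, ContinuousLinearMap.comp_apply,
    R.sharpVec_trans he he' hu, h2, R.normSq_trans he he' hu] at h1
  have hq : 0 < (R.toLocal he).normSq u := (R.toLocal he).normSq_pos hu.1 hb
  have hq1 : (R.toLocal he).normSq u < 1 := (R.toLocal he).normSq_lt_one hu.1
  rw [R.normSq_trans he he' hu] at hq hq1
  have hq2 := sub_pos.mpr hq1
  exact (mul_left_cancel₀ (by positivity) h1).symm

/-- `V_{0;0} = ½ ℒ_{V̂}(α²)` does not depend on the chart. -/
theorem contr₂_covD_trans {V : ∀ x : M, TangentSpace (𝓡 n) x}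
    (hV : ContMDiff (𝓡 n) (𝓡 n).tangent 2 (fun x => (⟨x, V x⟩ : TangentBundle (𝓡 n) M)))
    {u : Coord n} (hu : u ∈ overlap e e') (y : Coord n) :
    contr₂ (covD (R.aMat e) (lower (R.aMat e) (vecComp e V)) u) y
      = contr₂ (covD (R.aMat e') (lower (R.aMat e') (vecComp e' V)) (trans e e' u))
        (fderiv ℝ (trans e e') u y) := by
  have key : ∀ {e : OpenPartialHomeomorph M (Coord n)} (he : e ∈ IsManifold.maximalAtlas (𝓡 n) ∞ M)
      {u : Coord n} (_ : u ∈ e.target) (y : Coord n),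
      lieLift (vecComp e V) (fun u y => contr₂ (R.aMat e u) y) u y
        = 2 * contr₂ (covD (R.aMat e) (lower (R.aMat e) (vecComp e V)) u) y := by
    intro e he u hu y
    have h1 := lieLift_eq_lieAt (U := (R.toLocal he).U) (W := ⊤) (vecComp e V) ((R.toLocal he).rep_en ⊤) ⟨(u, y), hu, trivial⟩
    refine h1.trans (LocalRanders.lieAt_en (R := R.toLocal he) (W := ⊤) ⟨(u, y), hu, trivial⟩ fun i => ?_)
    exact ((contDiffOn_vecComp he hV i).contDiffAt (e.open_target.mem_nhds hu)).differentiableAt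
      two_ne_zero
  have hvd : ∀ {e : OpenPartialHomeomorph M (Coord n)} (he : e ∈ IsManifold.maximalAtlas (𝓡 n) ∞ M)
      {u : Coord n} (_ : u ∈ e.target),
      DifferentiableAt ℝ (fun w => (WithLp.toLp 2 (vecComp e V w) : Coord n)) u := by
    intro e he u hu
    rw [differentiableAt_euclidean]
    exact fun i => ((contDiffOn_vecComp he hV i).contDiffAt
      (e.open_target.mem_nhds hu)).differentiableAt two_ne_zero
  have h := lieLift_comp (L := fun u y => contr₂ (R.aMat e u) y)
    (L' := fun u y => contr₂ (R.aMat e' u) y) (y := y) (contDiffAt_trans he he' hu) ?_ (hvd he hu.1)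
    (hvd he' (trans_mem_target hu)) ?_ ?_
  · rw [key he hu.1, key he' (trans_mem_target hu)] at h
    linarith
  · simp only [contr₂]
    have ha : ∀ i j, DifferentiableAt ℝ (fun p : Coord n × Coord n => R.aMat e' p.1 i j)
        (trans e e' u, fderiv ℝ (trans e e') u y) := fun i j =>
      DifferentiableAt.comp (g := fun w => R.aMat e' w i j) _
        ((R.toLocal he').differentiableAt_a (trans_mem_target hu) i j) differentiableAt_fst
    have hy : ∀ i, DifferentiableAt ℝ (fun p : Coord n × Coord n => p.2 i)
        (trans e e' u, fderiv ℝ (trans e e') u y) := fun i => by fun_prop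
    exact DifferentiableAt.fun_sum fun i _ => DifferentiableAt.fun_sum fun j _ =>
      ((ha i j).mul (hy i)).mul (hy j)
  · filter_upwards [(overlap e e').2.mem_nhds hu] with w hw using vecComp_trans he he' V hw
  · filter_upwards [(overlap e e').2.mem_nhds hu] with w hw using R.contr₂_aMat_trans he he' hw

end RandersMetric

end
end RandersSoliton

namespace RandersSoliton
noncomputable section
open Set TopologicalSpace
open Finset Filter

/-! ### Solitons on a connected manifold -/

namespace LocalRanders
variable {n : ℕ} (R : LocalRanders n)

theorem jet_eq_zero {y : Coord n} {u : Coord n} (h : ∀ᶠ w in nhds u, R.b w = 0) :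
    R.jet (R.sigma y) u = 0 := by
  funext i
  rcases i with i | ⟨⟨i, j⟩ | _⟩
  · exact congrFun h.self_of_nhds i
  · exact R.pd_b_eq_zero h i j
  · exact R.sigma_eq_zero y h

theorem continuousAt_jet {σ : Coord n → ℝ} (hσ : ContDiffOn ℝ ∞ σ R.U) {u : Coord n} (hu : u ∈ R.U) :
    ContinuousAt (R.jet σ) u := by
  have hmem := R.U.2.mem_nhds hu
  refine continuousAt_pi.2 fun i => ?_
  rcases i with i | ⟨⟨i, j⟩ | _⟩
  · exact (R.smooth_b i).continuousOn.continuousAt hmem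
  · exact (contDiffOn_pd (R.smooth_b i) j).continuousOn.continuousAt hmem
  · exact hσ.continuousOn.continuousAt hmem

end LocalRanders

variable {n : ℕ} {M : Type*} [TopologicalSpace M] [ChartedSpace (Coord n) M]
variable [IsManifold (𝓡 n) ∞ M] {e e' : OpenPartialHomeomorph M (Coord n)}

namespace RandersMetric
variable (R : RandersMetric n M)

theorem bVec_eq_zero_iff (he : e ∈ IsManifold.maximalAtlas (𝓡 n) ∞ M) {u : Coord n}
    (hu : u ∈ e.target) : R.bVec e u = 0 ↔ R.β (e.symm u) = 0 := by
  constructor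
  · intro h
    ext w
    have hw := tangentVec_vecComp he (fun _ => (w : Coord n)) hu
    have h1 := R.contr_bVec e u (WithLp.toLp 2 (vecComp e (fun _ => (w : Coord n)) u))
    rw [h, hw] at h1
    refine h1.symm.trans ?_
    simp [contr]
  · intro h
    funext i
    simp [bVec, h]

theorem eventually_bVec_eq_zero_iff (he : e ∈ IsManifold.maximalAtlas (𝓡 n) ∞ M) {x : M}
    (hx : x ∈ e.source) :
    (∀ᶠ w in nhds (e x), R.bVec e w = 0) ↔ ∀ᶠ z in nhds x, R.β z = 0 := by
  constructor
  · intro h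
    filter_upwards [(e.continuousAt hx).eventually h, e.open_source.mem_nhds hx] with z hz hzs
    have := (R.bVec_eq_zero_iff he (e.map_source hzs)).1 hz
    rwa [e.left_inv hzs] at this
  · intro h
    have hc := e.continuousAt_symm (e.map_source hx)
    rw [ContinuousAt, e.left_inv hx] at hc
    filter_upwards [hc.eventually h, e.open_target.mem_nhds (e.map_source hx)] with w hw hwt
    exact (R.bVec_eq_zero_iff he hwt).2 hw

theorem exists_β_ne_zero (hR : ¬ IsRiemannian R.F) : ∃ x, R.β x ≠ 0 := by
  by_contra! h
  exact hR ⟨R.a, fun x y => by simp [F, α, h]⟩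

section Soliton
variable {V : ∀ x : M, TangentSpace (𝓡 n) x} {κ : M → ℝ}

theorem contDiffOn_one_vecComp (he : e ∈ IsManifold.maximalAtlas (𝓡 n) ∞ M)
    (hV : ContMDiff (𝓡 n) (𝓡 n).tangent 2 (fun x => (⟨x, V x⟩ : TangentBundle (𝓡 n) M)))
    (i : Fin n) : ContDiffOn ℝ 1 (fun w => vecComp e V w i) e.target :=
  (contDiffOn_vecComp he hV i).of_le one_le_two

/-- The soliton equation in a chart. -/
theorem _root_.RandersSoliton.IsAlmostRicciSoliton.local (hsol : IsAlmostRicciSoliton R.F V κ)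
    (he : e ∈ IsManifold.maximalAtlas (𝓡 n) ∞ M) :
    ∀ u ∈ (R.toLocal he).U, ∀ y : Coord n, y ≠ 0 → 2 * ricci (R.toLocal he).F u y
      + lieLift (vecComp e V) (energy (R.toLocal he).F) u y
      = 2 * κ (e.symm u) * (R.toLocal he).F u y ^ 2 := by
  intro u hu y hy
  have := hsol e he u hu y hy
  rwa [R.inChart_F he] at this

variable (hn : 2 ≤ n)
  (hV : ContMDiff (𝓡 n) (𝓡 n).tangent 2 (fun x => (⟨x, V x⟩ : TangentBundle (𝓡 n) M)))
  (hsol : IsAlmostRicciSoliton R.F V κ) {y₁ : Coord n} (hy₁ : y₁ ≠ 0)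
include hn hV hsol hy₁

theorem isotropic_sigma (he : e ∈ IsManifold.maximalAtlas (𝓡 n) ∞ M) :
    (R.toLocal he).Isotropic ((R.toLocal he).sigma y₁) :=
  LocalRanders.isotropic_sigma _ hn (fun i => (contDiffOn_one_vecComp he hV i).differentiableOn
    one_ne_zero) (hsol.local R he) hy₁

theorem eventually_bVec_eq_zero (he : e ∈ IsManifold.maximalAtlas (𝓡 n) ∞ M) {u : Coord n}
    (hu : u ∈ e.target) (h : (R.toLocal he).jet ((R.toLocal he).sigma y₁) u = 0) :
    ∀ᶠ w in nhds u, R.bVec e w = 0 := by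
  have hv := contDiffOn_one_vecComp he hV
  exact (R.isotropic_sigma hn hV hsol hy₁ he).eventually_b_eq_zero
    ((R.toLocal he).smooth_sigma hy₁) hn hv ((R.toLocal he).continuousOn_confFactor hv hy₁)
    (fun u hu y => (R.toLocal he).dsigma_eq hn hv (hsol.local R he) hy₁ hu y) hu h

/-- On a connected manifold, the form `β` of a non-Riemannian soliton vanishes on no open set: the interior of
its zero set is closed, because at a limit point `(b, ∂b, σ)` vanishes by continuity, and unique
continuation applies. -/
theorem not_eventually_β_eq_zero [ConnectedSpace M] (hR : ¬ IsRiemannian R.F) (x : M) :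
    ¬ ∀ᶠ z in nhds x, R.β z = 0 := by
  intro hx
  have hclopen : IsClopen {x : M | ∀ᶠ z in nhds x, R.β z = 0} := by
    constructor
    · rw [← isOpen_compl_iff, isOpen_iff_mem_nhds]
      intro x hx
      set e := chartAt (Coord n) x with hedef
      have he : e ∈ IsManifold.maximalAtlas (𝓡 n) ∞ M := IsManifold.chart_mem_maximalAtlas x
      have hxe : x ∈ e.source := mem_chart_source _ x
      have hne : (R.toLocal he).jet ((R.toLocal he).sigma y₁) (e x) ≠ 0 := fun h =>
        hx ((R.eventually_bVec_eq_zero_iff he hxe).1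
          (R.eventually_bVec_eq_zero hn hV hsol hy₁ he (e.map_source hxe) h))
      have hev := (((R.toLocal he).continuousAt_jet ((R.toLocal he).smooth_sigma hy₁)
        (e.map_source hxe)).comp (e.continuousAt hxe)).eventually_ne hne
      filter_upwards [hev, e.open_source.mem_nhds hxe] with z hz hze hzZ
      exact hz ((R.toLocal he).jet_eq_zero ((R.eventually_bVec_eq_zero_iff he hze).2 hzZ))
    · rw [isOpen_iff_mem_nhds]
      exact fun x hx => eventually_eventually_nhds.2 hx
  have huniv := hclopen.eq_univ ⟨x, hx⟩
  obtain ⟨z, hz⟩ := R.exists_β_ne_zero hR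
  have : z ∈ {x : M | ∀ᶠ z in nhds x, R.β z = 0} := huniv ▸ mem_univ z
  exact hz this.self_of_nhds

theorem not_eventually_bVec_eq_zero [ConnectedSpace M] (hR : ¬ IsRiemannian R.F)
    (he : e ∈ IsManifold.maximalAtlas (𝓡 n) ∞ M) {u : Coord n} (hu : u ∈ e.target) :
    ¬ ∀ᶠ w in nhds u, R.bVec e w = 0 := by
  have h := R.eventually_bVec_eq_zero_iff he (e.map_target hu)
  rw [e.right_inv hu] at h
  rw [h]
  exact R.not_eventually_β_eq_zero hn hV hsol hy₁ hR _

theorem sigma_trans [ConnectedSpace M] (hR : ¬ IsRiemannian R.F)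
    (he : e ∈ IsManifold.maximalAtlas (𝓡 n) ∞ M) (he' : e' ∈ IsManifold.maximalAtlas (𝓡 n) ∞ M)
    {u : Coord n} (hu : u ∈ overlap e e') :
    (R.toLocal he).sigma y₁ u = (R.toLocal he').sigma y₁ (trans e e' u) := by
  have hs := (R.toLocal he).smooth_sigma hy₁
  have hs' := (R.toLocal he').smooth_sigma hy₁
  have h := eq_zero_of_eq_zero_dense (overlap e e').2 (b := R.bVec e)
    (g := fun u => (R.toLocal he).sigma y₁ u - (R.toLocal he').sigma y₁ (trans e e' u))
    ((hs.continuousOn.mono fun w hw => hw.1).sub (hs'.continuousOn.comp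
      (fun w hw => (contDiffAt_trans he he' hw).continuousAt.continuousWithinAt)
      fun w hw => trans_mem_target hw)) ?_ ?_ hu
  · exact sub_eq_zero.1 h
  · intro w hw hb
    exact sub_eq_zero.2 (R.isotropic_trans_of_ne_zero he he' (R.isotropic_sigma hn hV hsol hy₁ he)
      hs (R.isotropic_sigma hn hV hsol hy₁ he') hs' hw hb)
  · intro w hw hb
    exact absurd hb (R.not_eventually_bVec_eq_zero hn hV hsol hy₁ hR he hw.1)

/-- `V` is conformal at all points of a chart: this holds where `β ≠ 0`, and these points are dense. -/
theorem contr₂_covD_eq [ConnectedSpace M] (hR : ¬ IsRiemannian R.F)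
    (he : e ∈ IsManifold.maximalAtlas (𝓡 n) ∞ M) {u : Coord n} (hu : u ∈ e.target) (y : Coord n) :
    contr₂ (covD (R.aMat e) (lower (R.aMat e) (vecComp e V)) u) y
      = 2 * (R.toLocal he).confFactor (vecComp e V) y₁ u * contr₂ (R.aMat e u) y := by
  have hv := contDiffOn_one_vecComp he hV
  have h := eq_zero_of_eq_zero_dense e.open_target (b := R.bVec e)
    (g := fun u => contr₂ (covD (R.aMat e) (lower (R.aMat e) (vecComp e V)) u) y
      - 2 * (R.toLocal he).confFactor (vecComp e V) y₁ u * contr₂ (R.aMat e u) y)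
    (((R.toLocal he).continuousOn_contr₂_covD_lower hv y).sub
      ((continuousOn_const.mul ((R.toLocal he).continuousOn_confFactor hv hy₁)).mul
        ((R.toLocal he).smooth_contr₂_a y).continuousOn)) ?_ ?_ hu
  · exact sub_eq_zero.1 h
  · intro w hw hb
    obtain ⟨c, hc⟩ := ((R.toLocal he).conformal_and_isotropic hn hw hb
      (fun i => ((hv i).differentiableOn one_ne_zero).differentiableAt (e.open_target.mem_nhds hw))
      (hsol.local R he w hw)).1
    rw [(R.toLocal he).confFactor_eq hy₁ hw hc]
    exact sub_eq_zero.2 (hc y)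
  · intro w hw hb
    exact absurd hb (R.not_eventually_bVec_eq_zero hn hV hsol hy₁ hR he hw)

theorem confFactor_trans [ConnectedSpace M] (hR : ¬ IsRiemannian R.F)
    (he : e ∈ IsManifold.maximalAtlas (𝓡 n) ∞ M) (he' : e' ∈ IsManifold.maximalAtlas (𝓡 n) ∞ M)
    {u : Coord n} (hu : u ∈ overlap e e') :
    (R.toLocal he).confFactor (vecComp e V) y₁ u
      = (R.toLocal he').confFactor (vecComp e' V) y₁ (trans e e' u) := by
  refine LocalRanders.confFactor_eq _ hy₁ hu.1 fun y => ?_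
  have h := R.contr₂_covD_trans he he' hV hu y
  rw [R.contr₂_covD_eq hn hV hsol hy₁ hR he' (trans_mem_target hu),
    ← R.contr₂_aMat_trans he he' hu] at h
  exact h

end Soliton
end RandersMetric

end
end RandersSoliton

namespace RandersSoliton
noncomputable section
open Set TopologicalSpace
open Finset Filter

/-! ### The classification -/

variable {n : ℕ} {M : Type*} [TopologicalSpace M] [ChartedSpace (Coord n) M]
variable [IsManifold (𝓡 n) ∞ M] {e : OpenPartialHomeomorph M (Coord n)}

/-- A function given in charts by smooth functions is smooth. -/
theorem contMDiff_of_forall_chart {f : M → ℝ}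
    (h : ∀ x : M, ContDiffOn ℝ ∞ (fun u => f ((chartAt (Coord n) x).symm u))
      (chartAt (Coord n) x).target) : ContMDiff (𝓡 n) 𝓘(ℝ, ℝ) ∞ f := by
  intro x
  have hx := mem_chart_source (Coord n) x
  have h1 : ContMDiffAt (𝓡 n) 𝓘(ℝ, ℝ) ∞ (fun u => f ((chartAt (Coord n) x).symm u))
      (chartAt (Coord n) x x) :=
    (((h x).contDiffAt ((chartAt (Coord n) x).open_target.mem_nhds
      ((chartAt (Coord n) x).map_source hx)))).contMDiffAt
  have h2 := h1.comp x (contMDiffAt_of_mem_maximalAtlas (I := 𝓡 n) (n := ∞)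
    (IsManifold.chart_mem_maximalAtlas x) hx)
  refine h2.congr_of_eventuallyEq ?_
  filter_upwards [(chartAt (Coord n) x).open_source.mem_nhds hx] with z hz
  simp only [Function.comp, (chartAt (Coord n) x).left_inv hz]

theorem _root_.ContMDiff.contDiffOn_symm {f : M → ℝ} (hf : ContMDiff (𝓡 n) 𝓘(ℝ, ℝ) ∞ f)
    (he : e ∈ IsManifold.maximalAtlas (𝓡 n) ∞ M) :
    ContDiffOn ℝ ∞ (fun u => f (e.symm u)) e.target :=
  contMDiffOn_iff_contDiffOn.1 (hf.comp_contMDiffOn (contMDiffOn_symm_of_mem_maximalAtlas he))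

/-- Functions given in each chart and compatible with changes of charts define a function on `M` by the
values in the preferred charts. -/
theorem eq_of_overlap {f : ∀ e : OpenPartialHomeomorph M (Coord n),
    e ∈ IsManifold.maximalAtlas (𝓡 n) ∞ M → Coord n → ℝ}
    (h : ∀ (e e' : OpenPartialHomeomorph M (Coord n)) (he : e ∈ IsManifold.maximalAtlas (𝓡 n) ∞ M)
      (he' : e' ∈ IsManifold.maximalAtlas (𝓡 n) ∞ M), ∀ u ∈ overlap e e',
      f e he u = f e' he' (trans e e' u)) (he : e ∈ IsManifold.maximalAtlas (𝓡 n) ∞ M)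
    {u : Coord n} (hu : u ∈ e.target) :
    f (chartAt (Coord n) (e.symm u)) (IsManifold.chart_mem_maximalAtlas _)
      (chartAt (Coord n) (e.symm u) (e.symm u)) = f e he u :=
  (h e _ he _ u ⟨hu, mem_chart_source _ _⟩).symm

namespace RandersMetric
variable (R : RandersMetric n M) {V : ∀ x : M, TangentSpace (𝓡 n) x} {κ : M → ℝ}

/-- For an almost Ricci soliton, the functions `sigma` and `confFactor` of the charts fit together to the
required `σ` and `c`. Evaluation at the same coordinate vector `y₁` in every chart is harmless, since the
values do not depend on that vector. -/
theorem exists_of_soliton [ConnectedSpace M] (hn : 2 ≤ n) (hR : ¬ IsRiemannian R.F)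
    (hV : ContMDiff (𝓡 n) (𝓡 n).tangent 2 (fun x => (⟨x, V x⟩ : TangentBundle (𝓡 n) M)))
    (hsol : IsAlmostRicciSoliton R.F V κ) :
    ∃ c σ : M → ℝ, ContMDiff (𝓡 n) 𝓘(ℝ, ℝ) ∞ σ ∧
      R.IsConformal V c ∧ R.EEq σ ∧ R.RicEq κ c σ ∧ R.SigmaEq V c σ := by
  obtain ⟨y₁, hy₁⟩ : ∃ y₁ : Coord n, y₁ ≠ 0 :=
    ⟨EuclideanSpace.single ⟨0, by omega⟩ 1, by simp⟩
  let c : M → ℝ := fun x => (R.toLocal (IsManifold.chart_mem_maximalAtlas x)).confFactor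
    (vecComp (chartAt (Coord n) x) V) y₁ (chartAt (Coord n) x x)
  let σ : M → ℝ := fun x => (R.toLocal (IsManifold.chart_mem_maximalAtlas x)).sigma y₁
    (chartAt (Coord n) x x)
  have hc : ∀ (e : OpenPartialHomeomorph M (Coord n)) (he : e ∈ IsManifold.maximalAtlas (𝓡 n) ∞ M),
      ∀ u ∈ e.target, c (e.symm u) = (R.toLocal he).confFactor (vecComp e V) y₁ u :=
    fun e he u hu => eq_of_overlap (f := fun e he => (R.toLocal he).confFactor (vecComp e V) y₁)
      (fun e e' he he' u hu => R.confFactor_trans hn hV hsol hy₁ hR he he' hu) he hu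
  have hσ : ∀ (e : OpenPartialHomeomorph M (Coord n)) (he : e ∈ IsManifold.maximalAtlas (𝓡 n) ∞ M),
      ∀ u ∈ e.target, σ (e.symm u) = (R.toLocal he).sigma y₁ u :=
    fun e he u hu => eq_of_overlap (f := fun e he => (R.toLocal he).sigma y₁)
      (fun e e' he he' u hu => R.sigma_trans hn hV hsol hy₁ hR he he' hu) he hu
  have hpd : ∀ (e : OpenPartialHomeomorph M (Coord n)) (he : e ∈ IsManifold.maximalAtlas (𝓡 n) ∞ M),
      ∀ u ∈ e.target, (fun i => pd i (fun w => σ (e.symm w)) u)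
        = fun i => pd i ((R.toLocal he).sigma y₁) u := by
    intro e he u hu
    have : (fun w => σ (e.symm w)) =ᶠ[nhds u] (R.toLocal he).sigma y₁ := by
      filter_upwards [e.open_target.mem_nhds hu] with w hw using hσ e he w hw
    funext i
    rw [pd, this.fderiv_eq, pd]
  have hiso := fun (e : OpenPartialHomeomorph M (Coord n)) he =>
    R.isotropic_sigma (e := e) hn hV hsol hy₁ he
  have heq : ∀ (e : OpenPartialHomeomorph M (Coord n)) (he : e ∈ IsManifold.maximalAtlas (𝓡 n) ∞ M),
      ∀ u ∈ e.target, ∀ y, _ := fun e he u hu y =>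
    LocalRanders.equations_of_soliton (by omega) (hiso e he)
      ((R.toLocal he).smooth_sigma hy₁) (u := u) hu
      (fun i => ((contDiffOn_one_vecComp he hV i).differentiableOn one_ne_zero).differentiableAt
        (e.open_target.mem_nhds hu)) (R.contr₂_covD_eq hn hV hsol hy₁ hR he hu)
      (hsol.local R he u hu) y
  refine ⟨c, σ, contMDiff_of_forall_chart fun x => ?_, ?_, ?_, ?_, ?_⟩
  · exact ((R.toLocal (IsManifold.chart_mem_maximalAtlas x)).smooth_sigma hy₁).congr
      fun u hu => hσ _ _ u hu
  · intro e he u hu i j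
    have h := add_swap_eq_of_contr₂_eq
      (m := covD (R.aMat e) (lower (R.aMat e) (vecComp e V)) u)
      (m' := fun i j => 2 * c (e.symm u) * R.aMat e u i j) (fun y => ?_) i j
    · rw [h, show R.aMat e u j i = R.aMat e u i j from R.a.symm _ _ _]
      ring
    · rw [R.contr₂_covD_eq hn hV hsol hy₁ hR he hu y, hc e he u hu]
      simp only [contr₂, mul_sum, mul_assoc]
  · intro e he u hu y
    dsimp only
    rw [R.inChart_α he, R.inChart_β he, hσ e he u hu]
    have h1 := hiso e he u hu y
    have h2 : (R.toLocal he).alpha u y ^ 2 = contr₂ ((R.toLocal he).a u) y :=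
      Real.sq_sqrt ((R.toLocal he).nonneg hu y)
    rw [h2]
    exact h1
  · intro e he u hu y
    dsimp only
    rw [R.inChart_α he, R.inChart_β he, hσ e he u hu, hc e he u hu, hpd e he u hu]
    exact (heq e he u hu y).1
  · intro e he u hu y
    dsimp only
    rw [R.inChart_β he, hc e he u hu, hpd e he u hu]
    exact (heq e he u hu y).2

/-- The three equations imply the soliton equation, chart by chart. -/
theorem soliton_of_exists {c σ : M → ℝ}
    (hV : ContMDiff (𝓡 n) (𝓡 n).tangent 2 (fun x => (⟨x, V x⟩ : TangentBundle (𝓡 n) M)))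
    (hσ : ContMDiff (𝓡 n) 𝓘(ℝ, ℝ) ∞ σ) (hc : R.IsConformal V c) (hE : R.EEq σ)
    (hric : R.RicEq κ c σ) (hlie : R.SigmaEq V c σ) : IsAlmostRicciSoliton R.F V κ := by
  intro e he u hu y hy
  have hiso : (R.toLocal he).Isotropic (fun w => σ (e.symm w)) := by
    intro w hw z
    have h1 := hE e he w hw z
    dsimp only at h1
    rw [R.inChart_α he, R.inChart_β he] at h1
    have h2 : (R.toLocal he).alpha w z ^ 2 = contr₂ ((R.toLocal he).a w) z :=
      Real.sq_sqrt ((R.toLocal he).nonneg hw z)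
    rw [h2] at h1
    exact h1
  rw [R.inChart_F he]
  refine LocalRanders.soliton_of_equations hiso (hσ.contDiffOn_symm he) hu
    (fun i => ((contDiffOn_one_vecComp he hV i).differentiableOn one_ne_zero).differentiableAt
      (e.open_target.mem_nhds hu)) (c := c (e.symm u)) ?_ ?_ ?_ hy
  · intro z
    refine (contr₂_eq_of_add_swap_eq (m' := fun i j => 2 * c (e.symm u) * R.aMat e u i j)
      (fun i j => (hc e he u hu i j).trans ?_) z).trans ?_
    · rw [show R.aMat e u j i = R.aMat e u i j from R.a.symm _ _ _]
      ring
    · simp only [contr₂, mul_sum, mul_assoc]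
      rfl
  · intro z
    have h1 := hric e he u hu z
    dsimp only at h1
    rw [R.inChart_α he, R.inChart_β he] at h1
    exact h1
  · intro z
    have h1 := hlie e he u hu z
    dsimp only at h1
    rw [R.inChart_β he] at h1
    exact h1

end RandersMetric

end
end RandersSoliton

theorem theorem1p2 {n : ℕ} (hn : 2 ≤ n) {M : Type*} [TopologicalSpace M]
    [ChartedSpace (EuclideanSpace ℝ (Fin n)) M] [IsManifold (𝓡 n) ∞ M] [ConnectedSpace M]
    (R : RandersSoliton.RandersMetric n M) (hR : ¬ RandersSoliton.IsRiemannian R.F)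
    (V : ∀ x : M, TangentSpace (𝓡 n) x)
    (hV : ContMDiff (𝓡 n) (𝓡 n).tangent 2 (fun x => (⟨x, V x⟩ : TangentBundle (𝓡 n) M)))
    (κ : M → ℝ) :
    RandersSoliton.IsAlmostRicciSoliton R.F V κ ↔
      ∃ c σ : M → ℝ, ContMDiff (𝓡 n) 𝓘(ℝ, ℝ) ∞ σ ∧
        R.IsConformal V c ∧ R.EEq σ ∧ R.RicEq κ c σ ∧ R.SigmaEq V c σ := by
  exact ⟨R.exists_of_soliton hn hR hV, fun ⟨_, _, hσ, hc, hE, hric, hlie⟩ =>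
    R.soliton_of_exists hV hσ hc hE hric hlie⟩
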